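/- **Setting.** A subsemigroup $T$ of a semigroup is *regular* if every $s\in T$ satisfies $sts=s$ for some $t\in T$. A regular subsemigroup $T$ is *weakly generated* by $X\subseteq T$ if no proper regular subsemigroup of $T$ contains $X$. *The semigroup $F_1$.* Let $A=\{1,x,x'\}$ (the *anchors*), with the involution $1'=1$, $(x)'=x'$, $(x')'=x$. Write 5-tuples as $g=(g^l,g^{la},g^c,g^{ra},g^r)$ and put $g_{xx'}=(1,1,x,x',1)$. Let $G_{1,e}=\{g_{xx'}\}$ and, for $i\ge 2$, let $G_{i,e}$ be the set of all $(g,(g^{la})',g^l,(g^{ra})',g)$ and $(g,(g^{ra})',g^l,(g^{la})',g)$ with $g\in G_{i-1,e}$. Let $G_i=G_{i,e}\cup G_{i,d}$, where $G_{1,d}=G_{2,d}=\emptyset$ and, for $i\ge 3$, $G_{i,d}$ is the set of all $g\in G_{i-1}\times A\times G_{i-2}\times A\times G_{i-1}$ with $g^l\ne g^r$, $(g^c,g^{la})\in\{(g^{ll},(g^{lla})'),(g^{lr},(g^{lra})')\}$ and $(g^c,g^{ra})\in\{(g^{rl},(g^{rla})'),(g^{rr},(g^{rra})')\}$; here $g^{st}=(g^s)^t$.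 Let $G^5=\bigcup_{i\ge1}G_i$, $G=G^5\cup A$, $G'=G^5\cup\{1\}$; elements of $G_i$ have *height* $i$, and $1$ has height $0$. For $g\in G^5$ of height at least $2$ let $g^L=(g^{la})'g^lg^{la}$ and $g^R=(g^{ra})'g^rg^{ra}$. The monoid $F_1^1$ is the quotient of the free semigroup $G^+$ by the congruence generated by $xx'x=x$, $x'xx'=x'$, $g_{xx'}=xx'$; $1g=g=g1$ for all $g\in G$; $g^2=g$ for all $g\in G'$; and $g^cg^Lg=g$, $gg^Rg^c=g$, $g^rg^{ra}g(g^{la})'g^l=g^rg^{ra}g^c(g^{la})'g^l$ for all $g\in G^5$ of height at least $2$. Write $[u]$ for the class of $u$, and $F_1=F_1^1\setminus\{[1]\}$, a semigroup. *Mountains.* For $g_1,g_2\in G'$ and $a\in A$ the triplet $g_1ag_2$ is *anchored* if $g_2\neq 1$ and $(g_1,a)\in\{(g_2^l,g_2^{la}),(g_2^r,g_2^{ra})\}$, or $g_1\ne 1$ and $(g_2,a)\in\{(g_1^l,(g_1^{la})'),(g_1^r,(g_1^{ra})')\}$. A *landscape* is a word $g_0a_1g_1\cdots a_ng_n$ with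 $g_j\in G'$, $a_j\in A$ and all triplets $g_{i-1}a_ig_i$ anchored. A *river* is a letter $g_i$ ($0<i<n$) such that $g_{i-1}$ and $g_{i+1}$ both have height one more than $g_i$. *Uplifting* the river $g_i$ means: if $g_{i-1}=g_{i+1}$ and $a_i=a_{i+1}'$, replace $g_{i-1}a_ig_ia_{i+1}g_{i+1}$ with $g_{i-1}$; otherwise replace the letter $g_i$ with the 5-tuple $(g_{i+1},a_{i+1}',g_i,a_i,g_{i-1})$. A (nontrivial) *mountain range* is a landscape with $n\ge1$ and $g_0=g_n=1$; a *mountain* is a mountain range without rivers. For mountains $u,v$, let $u*v$ be the word $uv$ with the double $11$ of letters at the junction replaced with a single $1$, and let $u\odot v$ be the landscape without rivers obtained from $u*v$ by uplifting rivers. *The set $M^\circ$.* Let $g_{2,e,1}=(g_{xx'},1,1,x,g_{xx'})$ and $g_{2,e,2}=(g_{xx'},x,1,1,g_{xx'})$. Let $G^\circ_1=\{g_{xx'}\}$, $G_2^\circ=\{g_{2,e,1},g_{2,e,2}\}$, let $G^\circ_3$ consist of the four tuples $(g,a,g_{xx'},a,h)$ with $\{g,h\}=G_2^\circ$ and $a\in\{1,x'\}$,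 let $G^\circ_{i+1}=\{g\in G_{i+1,d}: g^l,g^r\in G_i^\circ\}$ for $i\ge3$, and $G^\circ=\bigcup_{i\ge1}G_i^\circ$. Let $MR^\circ$ be the set of mountain ranges $g_0a_1g_1\cdots a_{2n}g_{2n}$ such that (a) all $g_i$ lie in $G^\circ\cup\{1\}$ and (b) $a_{i+1}=(a_i)'$ whenever $g_i$ has height $1$; let $M^\circ$ be the set of mountains in $MR^\circ$. *The semigroup $F_2$.* Write triples as $h=(h^l,h^c,h^r)$. Let $H_0=\{1\}$, $H_1=\{e,f\}$ with $e=(1,e,1)$, $f=(1,f,1)$, and for $i\ge2$ let $H_i$ be the set of $h\in H_{i-1}\times H_{i-2}\times H_{i-1}$ with $h^l\ne h^r$ and $h^c\in\{h^{ll},h^{lr}\}\cap\{h^{rl},h^{rr}\}$; elements of $H_i$ have height $i$, and $H=\bigcup_{i\ge0}H_i$. Then $F_2^1$ is the quotient of $H^+$ by the congruence $\varrho$ generated by $1h=h=h1$, $h^2=h$ for all $h\in H$, and $h^ch^lh=h$, $hh^rh^c=h$, $h^rh^chh^ch^l=h^rh^ch^l$ for all $h\in H$ of height at least $2$; and $F_2=F_2^1\setminus\{1\varrho\}$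 (the free regular semigroup weakly generated by two idempotents). An *i-landscape* is a word $h_0h_1\cdots h_n$ over $H$ in which, of any two consecutive letters, one is different from $1$ and has the other as its left or right entry. i-Rivers, i-mountain ranges, i-mountains and the product $\odot$ are defined as above; the uplifting of an i-river $h_i$ replaces $h_{i-1}h_ih_{i+1}$ with $h_{i-1}$ if $h_{i-1}=h_{i+1}$, and otherwise replaces $h_i$ with $(h_{i+1},h_i,h_{i-1})$. Let $MR_i$ and $M_i$ be the sets of nontrivial i-mountain ranges and i-mountains. *The relabelling.* Let $1\varphi=1$, $g_{2,e,1}\varphi=(e,1,f)$, $g_{2,e,2}\varphi=(f,1,e)$; for $g=(g^l,a,g_{xx'},a,g^r)\in G_3^\circ$ let $g\varphi=(g^l\varphi,e_1,g^r\varphi)$ with $e_1=e$ if $a=1$ and $e_1=f$ if $a=x'$; and for $g\in G_i^\circ$, $i>3$, let $g\varphi=(g^l\varphi,g^c\varphi,g^r\varphi)$. Let $\psi$ be the map defined recursively by $1\psi=1$, $(e,1,f)\psi=g_{2,e,1}$, $(f,1,e)\psi=g_{2,e,2}$; $(h,e_1,k)\psi=(h\psi,a,g_{xx'},a,k\psi)$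 for $(h,e_1,k)\in H_3$, with $a=1$ if $e_1=e$ and $a=x'$ if $e_1=f$; and $h\psi=(h^l\psi,a,h^c\psi,b,h^r\psi)$ for $h\in H_i$, $i>3$, where $a'=(h^l\psi)^{sa}$ for the $s\in\{l,r\}$ with $h^{ls}=h^c$ and $b'=(h^r\psi)^{ta}$ for the $t\in\{l,r\}$ with $h^{rt}=h^c$. For $u=g_0a_1g_1\cdots a_{2n}g_{2n}\in MR^\circ$ let $u\bar\varphi=h_0h_1\cdots h_{2n}$, where $h_i=e$ if $a_ig_ia_{i+1}=1g_{xx'}1$, $h_i=f$ if $a_ig_ia_{i+1}=x'g_{xx'}x$, and $h_i=g_i\varphi$ if $g_i\neq g_{xx'}$. In the other direction, $\bar\psi$ replaces a letter $e$ with $g_{xx'}$ between the anchors $1,1$, a letter $f$ with $g_{xx'}$ between the anchors $x',x$, any other letter $h$ with $h\psi$, and puts between the images of two consecutive letters of height at least $2$ the only anchor that makes the triplet anchored. **Statement.** 1. $\bar\varphi$ and $\bar\psi$ are mutually inverse bijections between $MR^\circ$ and $MR_i$, and restrict to bijections between $M^\circ$ and $M_i$. If $u\in MR^\circ$ and $v$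 is obtained from $u$ by uplifting the river $g_i$, then $v\in MR^\circ$ and $v\bar\varphi$ is obtained from $u\bar\varphi$ by uplifting the i-river $h_i$. 2. On $M^\circ$ and on $M_i$ the product $\odot$ is well defined (there is exactly one landscape, respectively i-landscape, without rivers obtained from $u*v$ by upliftings) and stays in $M^\circ$, respectively $M_i$; and $\bar\varphi:(M^\circ,\odot)\to(M_i,\odot)$ is an isomorphism with inverse $\bar\psi$. 3. The set $F_2^\circ=\{[u]:u\in M^\circ\}$ is a regular subsemigroup of $F_1$; the map $u\mapsto[u]$ is a bijection from $M^\circ$ onto $F_2^\circ$ with $[u\odot v]=[u][v]$. The elements $[xx']$ and $[x'x]$ are idempotents, and $F_2^\circ$ is weakly generated by $\{[xx'],[x'x]\}$. 4. $F_2^\circ$ is isomorphic to $F_2$: there is an isomorphism $\phi:F_2\to F_2^\circ$ with $(e\varrho)\phi=[xx']$, $(f\varrho)\phi=[x'x]$ and $((u\bar\varphi)\varrho)\phi=[u]$ for all $u\in M^\circ$. -/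

import Mathlib

/-! ## Regular and weakly generated subsemigroups -/

/-- A subsemigroup `T` of `S` is regular if each `s ∈ T` satisfies `s * t * s = s` for some `t ∈ T`. -/
def IsRegularSubsemigroup {S : Type*} [Semigroup S] (T : Subsemigroup S) : Prop :=
  ∀ s ∈ T, ∃ t ∈ T, s * t * s = s

/-- The regular subsemigroup `T` is weakly generated by `X`: it contains `X`, and no proper regular
subsemigroup of `T` contains `X`. -/
def IsWeaklyGeneratedBy {S : Type*} [Semigroup S] (T : Subsemigroup S) (X : Set S) : Prop :=
  IsRegularSubsemigroup T ∧ X ⊆ T ∧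
    ∀ U : Subsemigroup S, U ≤ T → IsRegularSubsemigroup U → X ⊆ U → U = T

namespace MonogenicWeak

/-! ## Anchors and 5-tuples -/

/-- The anchors `1`, `x`, `x'` (the last one is written `xi`). -/
inductive Anchor : Type
  | one | x | xi
  deriving DecidableEq

/-- The involution `1 ↦ 1`, `x ↦ x'`, `x' ↦ x` on anchors. -/
def Anchor.inv : Anchor → Anchor
  | .one => .one
  | .x => .xi
  | .xi => .x

/-- Formal terms: an anchor, or a formal 5-tuple `(l, la, c, ra, r)` with two anchor entries. -/
inductive Term : Type
  | anchor (a : Anchor)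
  | node (l : Term) (la : Anchor) (c : Term) (ra : Anchor) (r : Term)
  deriving DecidableEq

namespace Term

/-- The letter `1`. -/
abbrev one : Term := anchor .one

/-- The entries of a 5-tuple; the value on an anchor is irrelevant. -/
def left : Term → Term
  | node l _ _ _ _ => l
  | t => t

def leftAnchor : Term → Anchor
  | node _ la _ _ _ => la
  | anchor a => a

def middle : Term → Term
  | node _ _ c _ _ => c
  | t => t

def rightAnchor : Term → Anchor
  | node _ _ _ ra _ => ra
  | anchor a => a

def right : Term → Term
  | node _ _ _ _ r => r
  | t => t

/-- The height: `0` for `1`, and `i` for the elements of `G_i` (see `height_of_mem_G`). -/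
def height : Term → ℕ
  | anchor _ => 0
  | node l _ _ _ _ => l.height + 1

end Term

open Term

/-- `g_{xx'} = (1, 1, x, x', 1)`. -/
def gxx : Term := node one .one (anchor .x) .xi one

/-- The sets `G_{i,e}`, for `i ≥ 1`. -/
def Ge : ℕ → Set Term
  | 0 => ∅
  | 1 => {gxx}
  | i + 2 => {h | ∃ g ∈ Ge (i + 1),
      h = node g g.leftAnchor.inv g.left g.rightAnchor.inv g ∨
      h = node g g.rightAnchor.inv g.left g.leftAnchor.inv g}

/-- The sets `G_{i,d}`, for `i ≥ 1`. -/
def Gd : ℕ → Set Term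
  | 0 => ∅
  | 1 => ∅
  | 2 => ∅
  | i + 3 => {g | ∃ (l : Term) (la : Anchor) (c : Term) (ra : Anchor) (r : Term),
      g = node l la c ra r ∧
      l ∈ Ge (i + 2) ∪ Gd (i + 2) ∧ c ∈ Ge (i + 1) ∪ Gd (i + 1) ∧ r ∈ Ge (i + 2) ∪ Gd (i + 2) ∧
      l ≠ r ∧
      ((c, la) = (l.left, l.leftAnchor.inv) ∨ (c, la) = (l.right, l.rightAnchor.inv)) ∧
      ((c, ra) = (r.left, r.leftAnchor.inv) ∨ (c, ra) = (r.right, r.rightAnchor.inv))}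

/-- `G_i = G_{i,e} ∪ G_{i,d}`. -/
def Gi (i : ℕ) : Set Term := Ge i ∪ Gd i

/-- The set of all 5-tuples of `G`. -/
def G5 : Set Term := {g | ∃ i, 1 ≤ i ∧ g ∈ Gi i}

/-- `G' = G^5 ∪ {1}`. -/
def Gprime : Set Term := G5 ∪ {one}

/-- `G = G^5 ∪ A`. -/
def G : Set Term := G5 ∪ Set.range Term.anchor

theorem height_of_mem_Gi : ∀ (i : ℕ) (g : Term), g ∈ Gi i → g.height = i := by
  intro i
  induction i using Nat.strong_induction_on with
  | _ i ih =>
    intro g hg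
    match i, ih, hg with
    | 0, _, hg => simp [Gi, Ge, Gd] at hg
    | 1, _, hg =>
      simp only [Gi, Ge, Gd, Set.union_empty, Set.mem_singleton_iff] at hg
      subst hg
      rfl
    | i + 2, ih, hg =>
      rcases hg with hg | hg
      · obtain ⟨k, hk, h | h⟩ := hg <;> subst h <;>
          simpa [height] using ih (i + 1) (by omega) k (Or.inl hk)
      · match i, ih, hg with
        | 0, _, hg => simp [Gd] at hg
        | i + 1, ih, hg =>
          obtain ⟨l, la, c, ra, r, rfl, hl, -⟩ := hg
          simpa [height] using ih (i + 2) (by omega) l hl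

/-! ## The presentation of `F_1^1` and the semigroup `F_1` -/

/-- The generators. -/
abbrev Gen : Type := {t : Term // t ∈ G}

/-- An anchor as a generator. -/
def genA (a : Anchor) : Gen := ⟨anchor a, Or.inr ⟨a, rfl⟩⟩

/-- A generator as a word of length one. -/
abbrev w (g : Gen) : FreeSemigroup Gen := FreeSemigroup.of g

/-- An anchor as a word of length one. -/
abbrev wA (a : Anchor) : FreeSemigroup Gen := FreeSemigroup.of (genA a)

/-- The defining relations. The last three are, for `g ∈ G^5` of height at least two and with
`g^L = (g^{la})' g^l g^{la}` and `g^R = (g^{ra})' g^r g^{ra}`: `g^c g^L g = g`, `g g^R g^c = g` and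
`g^r g^{ra} g (g^{la})' g^l = g^r g^{ra} g^c (g^{la})' g^l`. -/
inductive Rel : FreeSemigroup Gen → FreeSemigroup Gen → Prop
  | x_xi_x : Rel (wA .x * wA .xi * wA .x) (wA .x)
  | xi_x_xi : Rel (wA .xi * wA .x * wA .xi) (wA .xi)
  | gxx (g : Gen) (hg : g.val = gxx) : Rel (w g) (wA .x * wA .xi)
  | one_mul (g : Gen) : Rel (wA .one * w g) (w g)
  | mul_one (g : Gen) : Rel (w g * wA .one) (w g)
  | idem (g : Gen) (hg : g.val ∈ Gprime) : Rel (w g * w g) (w g)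
  | left (g l c r : Gen) (la ra : Anchor) (hg : g.val = node l.val la c.val ra r.val)
      (h2 : 2 ≤ g.val.height) :
      Rel (w c * (wA la.inv * w l * wA la) * w g) (w g)
  | right (g l c r : Gen) (la ra : Anchor) (hg : g.val = node l.val la c.val ra r.val)
      (h2 : 2 ≤ g.val.height) :
      Rel (w g * (wA ra.inv * w r * wA ra) * w c) (w g)
  | sandwich (g l c r : Gen) (la ra : Anchor) (hg : g.val = node l.val la c.val ra r.val)
      (h2 : 2 ≤ g.val.height) :
      Rel (w r * wA ra * w g * wA la.inv * w l) (w r * wA ra * w c * wA la.inv * w l)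

/-- The congruence generated by the relations. -/
def rho : Con (FreeSemigroup Gen) := conGen Rel

/-- `F_1^1 = ⟨G, R⟩`. -/
abbrev F11 : Type := rho.Quotient

/-- The class `[u]` of a word. -/
def cls (u : FreeSemigroup Gen) : F11 := (u : rho.Quotient)

open Classical in
/-- Auxiliary: the letters different from `1` go to `0`, the letter `1` goes to `1`. -/
noncomputable def content : FreeSemigroup Gen →ₙ* ℕ :=
  FreeSemigroup.lift (fun g => if g = genA .one then 1 else 0)

theorem content_of_ne {g : Gen} (hg : g ≠ genA .one) : content (w g) = 0 := by
  simp [content, hg]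

theorem genA_ne {a : Anchor} (ha : a ≠ .one) : genA a ≠ genA .one := by
  intro h
  apply ha
  have := congrArg Subtype.val h
  simpa [genA] using this

theorem gen_ne_of_height {g : Gen} (h : 1 ≤ g.val.height) : g ≠ genA .one := by
  rintro rfl
  simp [genA, height] at h

theorem content_one : content (wA .one) = 1 := by simp [content]

theorem content_rel {u v : FreeSemigroup Gen} (h : Rel u v) : content u = content v := by
  cases h with
  | x_xi_x => simp only [map_mul, content_of_ne (genA_ne (a := .x) (by decide)), mul_zero]
  | xi_x_xi => simp only [map_mul, content_of_ne (genA_ne (a := .xi) (by decide)), mul_zero]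
  | gxx g hg =>
    have : g ≠ genA .one := gen_ne_of_height (by rw [hg]; decide)
    simp only [map_mul, content_of_ne this, content_of_ne (genA_ne (a := .x) (by decide)), zero_mul]
  | one_mul g => simp only [map_mul, content_one, _root_.one_mul]
  | mul_one g => simp only [map_mul, content_one, _root_.mul_one]
  | idem g hg =>
    by_cases h : g = genA .one
    · subst h; simp only [map_mul, content_one, _root_.mul_one]
    · simp only [map_mul, content_of_ne h, mul_zero]
  | left g l c r la ra hg h2 =>
    simp only [map_mul, content_of_ne (gen_ne_of_height (g := g) (by omega)), mul_zero]
  | right g l c r la ra hg h2 =>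
    simp only [map_mul, content_of_ne (gen_ne_of_height (g := g) (by omega)), zero_mul]
  | sandwich g l c r la ra hg h2 =>
    have : 1 ≤ l.val.height := by
      rw [hg] at h2
      simp only [height] at h2
      omega
    simp only [map_mul, content_of_ne (gen_ne_of_height this), mul_zero]

theorem content_rho {u v : FreeSemigroup Gen} (h : cls u = cls v) : content u = content v := by
  have h1 : rho ≤ Con.ker content :=
    Con.conGen_le.2 fun a b hab => content_rel hab
  exact h1 ((Con.eq rho).1 h)

theorem content_zero_or (u : FreeSemigroup Gen) : content u = 0 ∨ cls u = cls (wA .one) := by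
  induction u using FreeSemigroup.recOnMul with
  | ih1 g =>
    by_cases h : g = genA .one
    · subst h; exact Or.inr rfl
    · exact Or.inl (content_of_ne h)
  | ih2 g u h1 h2 =>
    rcases h1 with h1 | h1
    · left; rw [map_mul, h1, zero_mul]
    rcases h2 with h2 | h2
    · left; rw [map_mul, h2, mul_zero]
    right
    change cls _ * cls u = _
    rw [h1, h2]
    exact (Con.eq rho).2 (ConGen.Rel.of _ _ (Rel.one_mul _))

/-- `F_1 = F_1^1 ∖ {[1]}`. -/
def F1 : Subsemigroup F11 where
  carrier := {q | q ≠ cls (wA .one)}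
  mul_mem' := by
    intro p q hp hq h
    induction p, q using Con.induction_on₂ with
    | _ u v =>
      rcases content_zero_or u with hu | hu
      · have := content_rho (u := u * v) h
        rw [map_mul, hu, zero_mul, content_one] at this
        omega
      · exact hp hu

/-- The element `[x]` of `F_1`. -/
def xF : F1 := ⟨cls (wA .x), fun h => by
  have := content_rho h
  rw [content_of_ne (genA_ne (by decide)), content_one] at this
  omega⟩

/-- The element `[x']` of `F_1`. -/
def xiF : F1 := ⟨cls (wA .xi), fun h => by
  have := content_rho h
  rw [content_of_ne (genA_ne (by decide)), content_one] at this
  omega⟩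

/-! ## Landscapes, mountains and uplifting of rivers -/

/-- `g₁ a g` is left anchored: `(g₁, a) = (g^l, g^{la})` or `(g₁, a) = (g^r, g^{ra})`. -/
def LeftAnchored (g₁ : Term) (a : Anchor) : Term → Prop
  | anchor _ => False
  | node l la _ ra r => (g₁, a) = (l, la) ∨ (g₁, a) = (r, ra)

/-- `g a g₁` is right anchored: `(g₁, a) = (g^l, (g^{la})')` or `(g₁, a) = (g^r, (g^{ra})')`. -/
def RightAnchored : Term → Anchor → Term → Prop
  | anchor _, _, _ => False
  | node l la _ ra r, a, g₁ => (g₁, a) = (l, la.inv) ∨ (g₁, a) = (r, ra.inv)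

def Anchored (g : Term) (a : Anchor) (h : Term) : Prop :=
  LeftAnchored g a h ∨ RightAnchored g a h

/-- An alternating word `g₀ a₁ g₁ ⋯ aₙ gₙ`, stored as `g₀` and the list of the pairs `(aᵢ, gᵢ)`. -/
structure AltWord where
  start : Term
  steps : List (Anchor × Term)

instance : Inhabited AltWord := ⟨⟨one, []⟩⟩

namespace AltWord

/-- The letters `g₀, g₁, …, gₙ`. -/
def letters (u : AltWord) : List Term := u.start :: u.steps.map Prod.snd

/-- The last letter `gₙ`. -/
def last (u : AltWord) : Term := (u.steps.map Prod.snd).getLastD u.start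

/-- `u₁ * u₂`, for `u₁` ending with the first letter of `u₂`: the concatenation in which the
double letter at the junction is replaced with a single one. -/
def join (u v : AltWord) : AltWord := ⟨u.start, u.steps ++ v.steps⟩

end AltWord

/-- A landscape: all letters are in `G'`, and all triplets `g_{i-1} aᵢ gᵢ` are anchored. (The anchor
paired with the first letter is a dummy.) -/
def IsLandscape (u : AltWord) : Prop :=
  (∀ g ∈ u.letters, g ∈ Gprime) ∧
    List.IsChain (fun p q : Anchor × Term => Anchored p.2 q.1 q.2) ((.one, u.start) :: u.steps)

/-- `gᵢ` is a river: both neighbours exist and have the height of `gᵢ` plus one. -/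
inductive RiverAt : ℕ → AltWord → Prop
  | here {g r k : Term} {a b : Anchor} {t : List (Anchor × Term)}
      (h₁ : g.height = r.height + 1) (h₂ : k.height = r.height + 1) :
      RiverAt 1 ⟨g, (a, r) :: (b, k) :: t⟩
  | there {i : ℕ} {g k : Term} {a : Anchor} {t : List (Anchor × Term)} (h : RiverAt i ⟨k, t⟩) :
      RiverAt (i + 1) ⟨g, (a, k) :: t⟩

/-- The rewriting performed when the river `gᵢ` in `g_{i-1} aᵢ gᵢ a_{i+1} g_{i+1}` is uplifted:
if `g_{i-1} = g_{i+1}` and `aᵢ = (a_{i+1})'`, this subword is replaced with `g_{i-1}`; otherwise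
`gᵢ` is replaced with the 5-tuple `(g_{i+1}, (a_{i+1})', gᵢ, aᵢ, g_{i-1})`. -/
inductive UpliftStep : ℕ → AltWord → AltWord → Prop
  | drop {g r : Term} {a b : Anchor} {t : List (Anchor × Term)}
      (h : g.height = r.height + 1) (hab : a = b.inv) :
      UpliftStep 1 ⟨g, (a, r) :: (b, g) :: t⟩ ⟨g, t⟩
  | raise {g r k : Term} {a b : Anchor} {t : List (Anchor × Term)}
      (h₁ : g.height = r.height + 1) (h₂ : k.height = r.height + 1) (hne : ¬(g = k ∧ a = b.inv)) :
      UpliftStep 1 ⟨g, (a, r) :: (b, k) :: t⟩ ⟨g, (a, node k b.inv r a g) :: (b, k) :: t⟩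
  | there {i : ℕ} {g k : Term} {a : Anchor} {t t' : List (Anchor × Term)}
      (h : UpliftStep i ⟨k, t⟩ ⟨k, t'⟩) :
      UpliftStep (i + 1) ⟨g, (a, k) :: t⟩ ⟨g, (a, k) :: t'⟩

/-- `v` is obtained from the landscape `u` by uplifting the river `gᵢ`. -/
def UpliftAt (i : ℕ) (u v : AltWord) : Prop := IsLandscape u ∧ UpliftStep i u v

/-- `v` is a landscape with no rivers obtained from `u` by upliftings of rivers. -/
def IsReduct (u v : AltWord) : Prop :=
  Relation.ReflTransGen (fun u v => ∃ i, UpliftAt i u v) u v ∧ ∀ i, ¬ RiverAt i v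

/-- `β₂(u)`: the landscape with no rivers obtained from `u` by upliftings of rivers. -/
noncomputable def beta2 (u : AltWord) : AltWord := Classical.epsilon (IsReduct u)

/-- The product `u ⊙ v = β₂(u * v)` of mountains. -/
noncomputable def odot (u v : AltWord) : AltWord := beta2 (u.join v)

/-- Nontrivial mountain ranges. -/
def IsMountainRange (u : AltWord) : Prop :=
  IsLandscape u ∧ u.start = one ∧ u.last = one ∧ u.steps ≠ []

/-- Nontrivial mountains. -/
def IsMountain (u : AltWord) : Prop := IsMountainRange u ∧ ∀ i, ¬ RiverAt i u

open Classical in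
/-- A term as a generator; terms outside `G` do not matter and are sent to `1`. -/
noncomputable def toGen (t : Term) : Gen := if h : t ∈ G then ⟨t, h⟩ else genA .one

/-- The word `g₀ a₁ g₁ ⋯ aₙ gₙ` of `G⁺`. -/
noncomputable def AltWord.word (u : AltWord) : FreeSemigroup Gen :=
  ⟨toGen u.start, u.steps.flatMap fun p => [genA p.1, toGen p.2]⟩

/-! ## The sets `G°`, `MR°` and `M°` -/

def g2e1 : Term := node gxx .one one .x gxx
def g2e2 : Term := node gxx .x one .one gxx
def g3d1 : Term := node g2e1 .one gxx .one g2e2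
def g3d2 : Term := node g2e1 .xi gxx .xi g2e2
def g3d3 : Term := node g2e2 .one gxx .one g2e1
def g3d4 : Term := node g2e2 .xi gxx .xi g2e1

/-- The sets `G°_i`, for `i ≥ 1`. -/
def GcircI : ℕ → Set Term
  | 0 => ∅
  | 1 => {gxx}
  | 2 => {g2e1, g2e2}
  | 3 => {g3d1, g3d2, g3d3, g3d4}
  | i + 4 => {g | g ∈ Gd (i + 4) ∧ g.left ∈ GcircI (i + 3) ∧ g.right ∈ GcircI (i + 3)}

def Gcirc : Set Term := {g | ∃ i, 1 ≤ i ∧ g ∈ GcircI i}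

/-- `MR°`: the nontrivial mountain ranges such that all letters are in `G° ∪ {1}`, and
`a_{i+1} = (aᵢ)'` whenever `gᵢ` has height one. -/
def MRcirc : Set AltWord :=
  {u | IsMountainRange u ∧ (∀ g ∈ u.letters, g ∈ Gcirc ∪ {one}) ∧
    List.IsChain (fun p q : Anchor × Term => p.2.height = 1 → q.1 = p.1.inv) u.steps}

/-- `M°`: the mountains of `MR°`. -/
def Mcirc : Set AltWord := {u | u ∈ MRcirc ∧ IsMountain u}

/-! ## Triples, the presentation of `F_2^1` and the semigroup `F_2` -/

/-- Formal terms: `1`, the letters `e = (1,e,1)` and `f = (1,f,1)`, and formal triples with left,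
middle and right entries. -/
inductive Tri : Type
  | one | e | f
  | node (l c r : Tri)
  deriving DecidableEq

namespace Tri

/-- Left entry; the value at `1` is irrelevant. -/
def left : Tri → Tri
  | node l _ _ => l
  | _ => one

/-- Right entry; the value at `1` is irrelevant. -/
def right : Tri → Tri
  | node _ _ r => r
  | _ => one

def height : Tri → ℕ
  | one => 0
  | e => 1
  | f => 1
  | node l _ _ => l.height + 1

end Tri

/-- The sets `H_i`, for `i ≥ 0`. -/
def Hi : ℕ → Set Tri
  | 0 => {.one}
  | 1 => {.e, .f}
  | i + 2 => {h | ∃ l c r : Tri, h = .node l c r ∧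
      l ∈ Hi (i + 1) ∧ c ∈ Hi i ∧ r ∈ Hi (i + 1) ∧ l ≠ r ∧
      (c = l.left ∨ c = l.right) ∧ (c = r.left ∨ c = r.right)}

def H : Set Tri := {h | ∃ i, h ∈ Hi i}

abbrev HGen : Type := {h : Tri // h ∈ H}

def h1 : HGen := ⟨.one, 0, rfl⟩
def hE : HGen := ⟨.e, 1, Or.inl rfl⟩
def hF : HGen := ⟨.f, 1, Or.inr rfl⟩

/-- A generator as a word of length one. -/
abbrev wH (h : HGen) : FreeSemigroup HGen := FreeSemigroup.of h

/-- The defining relations of `F_2^1`. -/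
inductive IRel : FreeSemigroup HGen → FreeSemigroup HGen → Prop
  | one_mul (h : HGen) : IRel (wH h1 * wH h) (wH h)
  | mul_one (h : HGen) : IRel (wH h * wH h1) (wH h)
  | idem (h : HGen) : IRel (wH h * wH h) (wH h)
  | left (h l c r : HGen) (hh : h.val = .node l.val c.val r.val) : IRel (wH c * wH l * wH h) (wH h)
  | right (h l c r : HGen) (hh : h.val = .node l.val c.val r.val) : IRel (wH h * wH r * wH c) (wH h)
  | sandwich (h l c r : HGen) (hh : h.val = .node l.val c.val r.val) :
      IRel (wH r * wH c * wH h * wH c * wH l) (wH r * wH c * wH l)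

/-- The congruence generated by the relations. -/
def rhoI : Con (FreeSemigroup HGen) := conGen IRel

/-- `F_2^1`. -/
abbrev F21 : Type := rhoI.Quotient

def clsI (u : FreeSemigroup HGen) : F21 := (u : rhoI.Quotient)

open Classical in
/-- Auxiliary: the letters different from `1` go to `0`, the letter `1` goes to `1`. -/
noncomputable def contentI : FreeSemigroup HGen →ₙ* ℕ :=
  FreeSemigroup.lift (fun g => if g = h1 then 1 else 0)

theorem contentI_of_ne {g : HGen} (hg : g ≠ h1) : contentI (wH g) = 0 := by
  simp [contentI, hg]

theorem contentI_one : contentI (wH h1) = 1 := by simp [contentI]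

theorem height_of_mem_Hi : ∀ (i : ℕ) (h : Tri), h ∈ Hi i → h.height = i := by
  intro i
  induction i using Nat.strong_induction_on with
  | _ i ih =>
    intro h hh
    match i, ih, hh with
    | 0, _, hh =>
      have : h = .one := hh
      subst this
      rfl
    | 1, _, hh =>
      rcases hh with hh | hh <;> subst hh <;> rfl
    | i + 2, ih, hh =>
      obtain ⟨l, c, r, rfl, hl, -⟩ := hh
      simpa [Tri.height] using ih (i + 1) (by omega) l hl

theorem node_left_ne {h l c r : HGen} (hh : h.val = .node l.val c.val r.val) : l ≠ h1 := by
  rintro rfl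
  obtain ⟨i, hi⟩ := h.2
  rw [hh] at hi
  match i, hi with
  | 0, hi => exact Tri.noConfusion (show Tri.node _ _ _ = Tri.one from hi)
  | 1, hi =>
    rcases hi with hi | hi
    · exact Tri.noConfusion (show Tri.node _ _ _ = Tri.e from hi)
    · exact Tri.noConfusion (show Tri.node _ _ _ = Tri.f from hi)
  | i + 2, hi =>
    obtain ⟨l, c, r, h0, hl, -⟩ := hi
    have := height_of_mem_Hi _ _ hl
    injection h0 with h0
    rw [← h0] at this
    simp [h1, Tri.height] at this

theorem contentI_rel {u v : FreeSemigroup HGen} (h : IRel u v) : contentI u = contentI v := by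
  cases h with
  | one_mul g => simp only [map_mul, contentI_one, _root_.one_mul]
  | mul_one g => simp only [map_mul, contentI_one, _root_.mul_one]
  | idem g =>
    by_cases h : g = h1
    · subst h; simp only [map_mul, contentI_one, _root_.mul_one]
    · simp only [map_mul, contentI_of_ne h, mul_zero]
  | left h l c r hh =>
    have : h ≠ h1 := by
      rintro rfl
      exact Tri.noConfusion (show Tri.one = Tri.node _ _ _ from hh)
    simp only [map_mul, contentI_of_ne this, mul_zero]
  | right h l c r hh =>
    have : h ≠ h1 := by
      rintro rfl
      exact Tri.noConfusion (show Tri.one = Tri.node _ _ _ from hh)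
    simp only [map_mul, contentI_of_ne this, zero_mul]
  | sandwich h l c r hh =>
    simp only [map_mul, contentI_of_ne (node_left_ne hh), mul_zero]

theorem contentI_rho {u v : FreeSemigroup HGen} (h : clsI u = clsI v) :
    contentI u = contentI v := by
  have h0 : rhoI ≤ Con.ker contentI :=
    Con.conGen_le.2 fun a b hab => contentI_rel hab
  exact h0 ((Con.eq rhoI).1 h)

theorem contentI_zero_or (u : FreeSemigroup HGen) :
    contentI u = 0 ∨ clsI u = clsI (wH h1) := by
  induction u using FreeSemigroup.recOnMul with
  | ih1 g =>
    by_cases h : g = h1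
    · subst h; exact Or.inr rfl
    · exact Or.inl (contentI_of_ne h)
  | ih2 g u i1 i2 =>
    rcases i1 with i1 | i1
    · left; rw [map_mul, i1, zero_mul]
    rcases i2 with i2 | i2
    · left; rw [map_mul, i2, mul_zero]
    right
    change clsI _ * clsI u = _
    rw [i1, i2]
    exact (Con.eq rhoI).2 (ConGen.Rel.of _ _ (IRel.one_mul _))

/-- `F_2 = F_2^1 ∖ {[1]}`. -/
def F2 : Subsemigroup F21 where
  carrier := {q | q ≠ clsI (wH h1)}
  mul_mem' := by
    intro p q hp hq h
    induction p, q using Con.induction_on₂ with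
    | _ u v =>
      rcases contentI_zero_or u with hu | hu
      · have := contentI_rho (u := u * v) h
        rw [map_mul, hu, zero_mul, contentI_one] at this
        omega
      · exact hp hu

/-- The generating idempotents of `F_2`. -/
def eF : F2 := ⟨clsI (wH hE), fun h => by
  have := contentI_rho h
  rw [contentI_of_ne (fun h0 => Tri.noConfusion (show Tri.e = Tri.one from congrArg Subtype.val h0)), contentI_one] at this
  omega⟩

def fF : F2 := ⟨clsI (wH hF), fun h => by
  have := contentI_rho h
  rw [contentI_of_ne (fun h0 => Tri.noConfusion (show Tri.f = Tri.one from congrArg Subtype.val h0)), contentI_one] at this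
  omega⟩

/-! ## i-mountains and uplifting of i-rivers -/

/-- Words `h₀ h₁ ⋯ hₙ`. -/
abbrev IWord : Type := FreeSemigroup Tri

instance : Inhabited IWord := ⟨⟨.one, []⟩⟩

namespace IWord

def letters (u : IWord) : List Tri := u.head :: u.tail

def last (u : IWord) : Tri := u.tail.getLastD u.head

/-- Concatenation with the double letter at the junction replaced with a single one. -/
def join (u v : IWord) : IWord := ⟨u.head, u.tail ++ v.tail⟩

end IWord

/-- `k ∈ {h^l, h^r}`. -/
def IBelow (k : Tri) : Tri → Prop
  | .one => False
  | .e => k = .one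
  | .f => k = .one
  | .node l _ r => k = l ∨ k = r

def IsILandscape (u : IWord) : Prop :=
  (∀ h ∈ IWord.letters u, h ∈ H) ∧
    List.IsChain (fun h k : Tri => IBelow h k ∨ IBelow k h) (IWord.letters u)

inductive IRiverAt : ℕ → IWord → Prop
  | here {g r k : Tri} {t : List Tri}
      (h₁ : g.height = r.height + 1) (h₂ : k.height = r.height + 1) :
      IRiverAt 1 ⟨g, r :: k :: t⟩
  | there {i : ℕ} {g k : Tri} {t : List Tri} (h : IRiverAt i ⟨k, t⟩) :
      IRiverAt (i + 1) ⟨g, k :: t⟩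

/-- If `h_{i-1} = h_{i+1}`, the subword `h_{i-1} hᵢ h_{i+1}` is replaced with `h_{i-1}`; otherwise
`hᵢ` is replaced with the triple with left entry `h_{i+1}`, middle entry `hᵢ` and right entry
`h_{i-1}`. -/
inductive IUpliftStep : ℕ → IWord → IWord → Prop
  | drop {g r : Tri} {t : List Tri} (h : g.height = r.height + 1) :
      IUpliftStep 1 ⟨g, r :: g :: t⟩ ⟨g, t⟩
  | raise {g r k : Tri} {t : List Tri}
      (h₁ : g.height = r.height + 1) (h₂ : k.height = r.height + 1) (hne : g ≠ k) :
      IUpliftStep 1 ⟨g, r :: k :: t⟩ ⟨g, .node k r g :: k :: t⟩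
  | there {i : ℕ} {g k : Tri} {t t' : List Tri} (h : IUpliftStep i ⟨k, t⟩ ⟨k, t'⟩) :
      IUpliftStep (i + 1) ⟨g, k :: t⟩ ⟨g, k :: t'⟩

/-- `v` is obtained from the i-landscape `u` by uplifting the i-river `hᵢ`. -/
def IUpliftAt (i : ℕ) (u v : IWord) : Prop := IsILandscape u ∧ IUpliftStep i u v

def IsIReduct (u v : IWord) : Prop :=
  Relation.ReflTransGen (fun u v => ∃ i, IUpliftAt i u v) u v ∧ ∀ i, ¬ IRiverAt i v

/-- The i-landscape with no i-rivers obtained from `u` by upliftings of i-rivers. -/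
noncomputable def ibeta2 (u : IWord) : IWord := Classical.epsilon (IsIReduct u)

/-- The product of i-mountains. -/
noncomputable def iodot (u v : IWord) : IWord := ibeta2 (IWord.join u v)

/-- The nontrivial i-mountain ranges. -/
def MRi : Set IWord :=
  {u | IsILandscape u ∧ u.head = .one ∧ IWord.last u = .one ∧ u.tail ≠ []}

/-- The nontrivial i-mountains. -/
def Mi : Set IWord := {u | u ∈ MRi ∧ ∀ i, ¬ IRiverAt i u}

open Classical in
/-- A term as a generator; terms outside `H` do not matter and are sent to `1`. -/
noncomputable def toHGen (t : Tri) : HGen := if h : t ∈ H then ⟨t, h⟩ else h1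

noncomputable def IWord.word (u : IWord) : FreeSemigroup HGen := FreeSemigroup.map toHGen u

/-! ## The relabelling -/

def h21 : Tri := .node .e .one .f
def h22 : Tri := .node .f .one .e

/-- The bijection `φ` from `(G° ∖ {g_{xx'}}) ∪ {1}` onto `H ∖ {e, f}`. A middle entry `g_{xx'}` (this
happens at height three only, where the two anchors are equal) is sent to `e` or `f`
according to whether these anchors are `1` or `x'`. -/
def phi : Term → Tri
  | .anchor _ => .one
  | .node l la c ra r =>
    if Term.node l la c ra r = g2e1 then h21
    else if Term.node l la c ra r = g2e2 then h22
    else .node (phi l) (if c = gxx then (if la = .one then .e else .f) else phi c) (phi r)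

/-- The relabelling `φ̄`: a letter `gᵢ = g_{xx'}` becomes `e` if `aᵢ = 1` (so that
`aᵢ gᵢ a_{i+1} = 1 g_{xx'} 1`) and `f` if `aᵢ = x'` (so that `aᵢ gᵢ a_{i+1} = x' g_{xx'} x`); any
other letter `gᵢ` becomes `φ(gᵢ)`. -/
def phibar (u : AltWord) : IWord :=
  ⟨phi u.start, u.steps.map fun p =>
    if p.2 = gxx then (if p.1 = .one then .e else .f) else phi p.2⟩

/-- The map `ψ`, extended to `e` and `f` by the letter `g_{xx'}`. -/
def psi : Tri → Term
  | .one => one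
  | .e => gxx
  | .f => gxx
  | .node l c r =>
    if Tri.node l c r = h21 then g2e1
    else if Tri.node l c r = h22 then g2e2
    else if c = .e then node (psi l) .one gxx .one (psi r)
    else if c = .f then node (psi l) .xi gxx .xi (psi r)
    else node (psi l)
      (if l.left = c then (psi l).leftAnchor.inv else (psi l).rightAnchor.inv)
      (psi c)
      (if r.left = c then (psi r).leftAnchor.inv else (psi r).rightAnchor.inv)
      (psi r)

/-- The anchor placed by `ψ̄` between the letters obtained from the consecutive letters `h`, `k`. If
both have height at least two, it is the only one that makes the triplet anchored. -/
def anchorBetween (h k : Tri) : Anchor :=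
  if k = .e then .one
  else if k = .f then .xi
  else if h = .e then .one
  else if h = .f then .x
  else if h.height < k.height then
    (if k.left = h then (psi k).leftAnchor else (psi k).rightAnchor)
  else (if h.left = k then (psi h).leftAnchor.inv else (psi h).rightAnchor.inv)

/-- The pairs `(aᵢ, gᵢ)` obtained from the letters that follow `h`. -/
def psiSteps : Tri → List Tri → List (Anchor × Term)
  | _, [] => []
  | h, k :: t => (anchorBetween h k, psi k) :: psiSteps k t

/-- The relabelling `ψ̄` in the opposite direction. -/
def psibar (v : IWord) : AltWord := ⟨psi v.head, psiSteps v.head v.tail⟩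

end MonogenicWeak

open MonogenicWeak

/-! The word problem of `F_2` is solved first, and everything else is transported from there. In
every monoid where the relations of `F_2^1` hold, uplifting an i-river preserves values, and
upliftings terminate. So every element of `F_2^1` is the value of an i-landscape from `1` to `1`
without i-rivers. Uniqueness is a van der Waerden argument. A stack machine, `run`, reads letters
and uplifts each i-river as soon as it appears. Reading the canonical loops from `1` through `h`
back to `1` gives transformations that satisfy the relations (`iRep_readRep`), while reading a word
without i-rivers returns that word reversed (`run_asc_desc`). This yields `eq_of_ev_eq`, and with it
the uniqueness of reducts.

For the relabelling, each letter `h` of `H` is described by a 5-tuple `code h` and a type `tau h`,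
which is `true` exactly when the chain of middle entries ends at `f`. The anchor between neighbours
is the function `delta` of their types. Only `e` and `f` are confused by `code`, and the types
separate them. In this form `codeWord` visibly matches upliftings with upliftings; it agrees with
`psibar` on i-landscapes, and the image of `MRi` is `MRcirc`.

In `F_1^1`, the 5-tuple of `h`, multiplied on both sides by the anchors of its type (`pull`),
satisfies the relations of `F_2^1`; this gives a homomorphism `embed`. For its injectivity one needs
a map out of `F_1^1`. Such a map exists into every regular monoid with two mutually inverse
elements, since the values of the 5-tuples can be chosen recursively as sandwich elements
(`exists_termRep`). The monoid used is the semidirect product of `F_2^1` with the group of order two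
that swaps `e` and `f`, where `x` goes to `e` and `x'` to `f`, each times the swap.

The recursive choices are arbitrary, and the rigidity result `eq_node` controls them: in `F_2^1` the
letter `(l, c, r)` is the only solution of its own relations. Hence `pull h` is always sent to `h`,
and `embed` is injective. Rigidity also gives weak generation, because a regular subsemigroup that
contains `l`, `c`, `r` contains a solution of these relations. -/

namespace MonogenicWeak

/-! ## Neighbouring letters of `H` -/

/-- `g` and `k` are letters of `H`, and `g` is the left or right entry of `k`. -/
def Below (g k : Tri) : Prop := g ∈ H ∧ k ∈ H ∧ IBelow g k

theorem mem_Hi_height {h : Tri} (hh : h ∈ H) : h ∈ Hi h.height := by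
  obtain ⟨i, hi⟩ := hh
  rwa [height_of_mem_Hi i h hi]

theorem one_mem_H : Tri.one ∈ H := ⟨0, rfl⟩

theorem e_mem_H : Tri.e ∈ H := ⟨1, Or.inl rfl⟩

theorem f_mem_H : Tri.f ∈ H := ⟨1, Or.inr rfl⟩

theorem node_mem_Hi {i : ℕ} {l c r : Tri} (h : Tri.node l c r ∈ Hi i) : ∃ j, i = j + 2 ∧
    l ∈ Hi (j + 1) ∧ c ∈ Hi j ∧ r ∈ Hi (j + 1) ∧ l ≠ r ∧
      (c = l.left ∨ c = l.right) ∧ (c = r.left ∨ c = r.right) := by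
  match i, h with
  | 0, h => exact Tri.noConfusion (show Tri.node _ _ _ = Tri.one from h)
  | 1, h =>
    rcases h with h | h
    · exact Tri.noConfusion (show Tri.node _ _ _ = Tri.e from h)
    · exact Tri.noConfusion (show Tri.node _ _ _ = Tri.f from h)
  | j + 2, h =>
    obtain ⟨l', c', r', h0, h⟩ := h
    injection h0 with h1 h2 h3
    subst h1 h2 h3
    exact ⟨j, rfl, h⟩

theorem Below.height {g k : Tri} (h : Below g k) : k.height = g.height + 1 := by
  obtain ⟨-, hk, hb⟩ := h
  cases k with
  | one => exact hb.elim
  | e => rw [show g = .one from hb]; rfl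
  | f => rw [show g = .one from hb]; rfl
  | node l c r =>
    obtain ⟨j, -, hl, -, hr, -⟩ := node_mem_Hi (mem_Hi_height hk)
    have := height_of_mem_Hi _ _ hl
    have := height_of_mem_Hi _ _ hr
    rcases hb with rfl | rfl <;> simp_all [Tri.height]

/-- This form frees the rest of the proof from the indices of `Hi`: the heights are forced by the
relation `Below`, and induction can follow the structure of the triple. -/
theorem node_mem_H {l c r : Tri} : Tri.node l c r ∈ H ↔ Below c l ∧ Below c r ∧ l ≠ r := by
  have key : ∀ {k c : Tri}, k.height ≠ 0 → (c = k.left ∨ c = k.right) → IBelow c k := by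
    intro k c hk hc
    cases k <;> simp_all [Tri.left, Tri.right, IBelow, Tri.height]
  have key' : ∀ {k c : Tri}, IBelow c k → (c = k.left ∨ c = k.right) := by
    intro k c hc
    cases k <;> simp_all [Tri.left, Tri.right, IBelow]
  constructor
  · intro hh
    obtain ⟨j, -, hl, hc, hr, hne, h1, h2⟩ := node_mem_Hi (mem_Hi_height hh)
    have a := height_of_mem_Hi _ _ hl
    have b := height_of_mem_Hi _ _ hr
    exact ⟨⟨⟨_, hc⟩, ⟨_, hl⟩, key (by omega) h1⟩, ⟨⟨_, hc⟩, ⟨_, hr⟩, key (by omega) h2⟩, hne⟩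
  · rintro ⟨h1, h2, hne⟩
    have a := mem_Hi_height h1.1
    have b := mem_Hi_height h1.2.1
    have d := mem_Hi_height h2.2.1
    rw [h1.height] at b
    rw [h2.height] at d
    exact ⟨c.height + 2, l, c, r, rfl, b, a, d, hne, key' h1.2.2, key' h2.2.2⟩

theorem below_left {l c r : Tri} (h : Tri.node l c r ∈ H) : Below l (.node l c r) :=
  ⟨(node_mem_H.1 h).1.2.1, h, Or.inl rfl⟩

theorem below_right {l c r : Tri} (h : Tri.node l c r ∈ H) : Below r (.node l c r) :=
  ⟨(node_mem_H.1 h).2.1.2.1, h, Or.inr rfl⟩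

theorem below_one_e : Below .one .e := ⟨one_mem_H, e_mem_H, rfl⟩

theorem below_one_f : Below .one .f := ⟨one_mem_H, f_mem_H, rfl⟩

theorem not_below_one {g : Tri} : ¬ Below g .one := fun h => h.2.2

/-- Two letters that may be neighbours in an i-landscape. -/
def Adj (g k : Tri) : Prop := Below g k ∨ Below k g

theorem Adj.symm {g k : Tri} (h : Adj g k) : Adj k g := Or.symm h

theorem isILandscape_nil {g : Tri} : IsILandscape ⟨g, []⟩ ↔ g ∈ H := by
  simp [IsILandscape, IWord.letters]

theorem isILandscape_cons {g k : Tri} {t : List Tri} :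
    IsILandscape ⟨g, k :: t⟩ ↔ Adj g k ∧ IsILandscape ⟨k, t⟩ := by
  simp only [IsILandscape, IWord.letters, List.mem_cons, List.isChain_cons_cons, Adj, Below,
    forall_eq_or_imp]
  tauto

theorem IsILandscape.head_mem {g : Tri} {t : List Tri} (h : IsILandscape ⟨g, t⟩) : g ∈ H :=
  h.1 g (by simp [IWord.letters])

/-- The landscape obtained by reading `s` after `⟨g, t⟩`. -/
theorem isILandscape_append {g : Tri} {t s : List Tri} :
    IsILandscape ⟨g, t ++ s⟩ ↔ IsILandscape ⟨g, t⟩ ∧ IsILandscape ⟨t.getLastD g, s⟩ := by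
  induction t generalizing g with
  | nil =>
    simp only [List.nil_append, List.getLastD_nil]
    exact ⟨fun h => ⟨isILandscape_nil.2 h.head_mem, h⟩, fun h => h.2⟩
  | cons k t ih =>
    rw [List.cons_append, isILandscape_cons, isILandscape_cons, ih, List.getLastD_cons]
    tauto

/-! ## Families satisfying the relations of `F_2` -/

/-- The relations of `F_2^1` for a family of elements of a monoid indexed by the letters. -/
structure IRep {M : Type*} [Monoid M] (f : Tri → M) : Prop where
  one : f .one = 1
  idem : ∀ h ∈ H, f h * f h = f h
  left : ∀ l c r, Tri.node l c r ∈ H → f c * f l * f (.node l c r) = f (.node l c r)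
  right : ∀ l c r, Tri.node l c r ∈ H → f (.node l c r) * f r * f c = f (.node l c r)
  sandwich : ∀ l c r, Tri.node l c r ∈ H →
    f r * f c * f (.node l c r) * f c * f l = f r * f c * f l

/-- The value of a word of letters. -/
def ev {M : Type*} [Monoid M] (f : Tri → M) (l : List Tri) : M := (l.map f).prod

section

variable {M : Type*} [Monoid M] {f : Tri → M}

theorem ev_nil : ev f [] = 1 := rfl

theorem ev_cons (g : Tri) (l : List Tri) : ev f (g :: l) = f g * ev f l := by simp [ev]

theorem ev_append (l s : List Tri) : ev f (l ++ s) = ev f l * ev f s := by simp [ev]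

namespace IRep

variable (hf : IRep f)
include hf

theorem middle_mul {l c r : Tri} (h : Tri.node l c r ∈ H) :
    f c * f (.node l c r) = f (.node l c r) := by
  rw [← hf.left l c r h, mul_assoc, ← mul_assoc (f c) (f c), hf.idem c (node_mem_H.1 h).1.1]

theorem mul_middle {l c r : Tri} (h : Tri.node l c r ∈ H) :
    f (.node l c r) * f c = f (.node l c r) := by
  rw [← hf.right l c r h, mul_assoc, hf.idem c (node_mem_H.1 h).1.1]

/-- Inserting the absorbed middle entry next to `h` turns the product into an instance of the left
or right relation. This identity justifies dropping an i-river between two equal letters. -/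
theorem below_mul {c h : Tri} (hb : Below c h) : f h * f c * f h = f h := by
  obtain ⟨-, hh, hb⟩ := hb
  cases h with
  | one => exact hb.elim
  | e => rw [show c = .one from hb, hf.one, mul_one, hf.idem _ hh]
  | f => rw [show c = .one from hb, hf.one, mul_one, hf.idem _ hh]
  | node l d r =>
    rcases hb with rfl | rfl
    · rw [← hf.mul_middle hh, mul_assoc, mul_assoc, ← mul_assoc (f d), hf.mul_middle hh,
        hf.left _ _ _ hh, hf.idem _ hh]
    · rw [← hf.middle_mul hh, ← mul_assoc, hf.middle_mul hh, hf.right _ _ _ hh, hf.idem _ hh]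

/-- The sandwich relation, once the new letter has absorbed the middle entry on both sides. This
identity justifies replacing an i-river with a triple. -/
theorem raise {g r k : Tri} (h : Tri.node k r g ∈ H) :
    f g * f r * f k = f g * f (.node k r g) * f k := by
  rw [← hf.sandwich _ _ _ h, mul_assoc (f g) (f r), hf.middle_mul h, mul_assoc (f g) _ (f r),
    hf.mul_middle h]

theorem uplift {i : ℕ} {u v : IWord} (hs : IUpliftStep i u v) (hu : IsILandscape u) :
    ev f (IWord.letters u) = ev f (IWord.letters v) := by
  induction hs with
  | @drop g r t h =>
    rw [isILandscape_cons, isILandscape_cons] at hu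
    have : Below r g := by
      rcases hu.1 with h1 | h1
      · have := h1.height; omega
      · exact h1
    simp only [IWord.letters, ev_cons, ← mul_assoc, hf.below_mul this]
  | @raise g r k t h₁ h₂ hne =>
    rw [isILandscape_cons, isILandscape_cons] at hu
    have h1 : Below r g := by
      rcases hu.1 with h1 | h1
      · have := h1.height; omega
      · exact h1
    have h2 : Below r k := by
      rcases hu.2.1 with h1 | h1
      · exact h1
      · have := h1.height; omega
    simp only [IWord.letters, ev_cons, ← mul_assoc,
      hf.raise (node_mem_H.2 ⟨h2, h1, hne.symm⟩)]
  | there h ih =>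
    rw [isILandscape_cons] at hu
    have := ih hu.2
    simp only [IWord.letters, ev_cons] at this ⊢
    rw [this]

end IRep

/-- The homomorphism from `F_2^1` given by a family satisfying its relations. -/
def IRep.lift (hf : IRep f) : F21 →ₙ* M where
  toFun q := Con.liftOn q (FreeSemigroup.lift (fun h : HGen => f h.1)) (by
    intro a b hab
    have h0 : rhoI ≤ Con.ker (FreeSemigroup.lift (fun h : HGen => f h.1)) := by
      refine Con.conGen_le.2 fun a b hab => ?_
      rw [Con.ker_rel]
      cases hab with
      | one_mul h => simp [h1, hf.one]
      | mul_one h => simp [h1, hf.one]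
      | idem h => simp [hf.idem _ h.2]
      | left h l c r hh =>
        have := hf.left l.1 c.1 r.1 (hh ▸ h.2)
        simpa [hh] using this
      | right h l c r hh =>
        have := hf.right l.1 c.1 r.1 (hh ▸ h.2)
        simpa [hh] using this
      | sandwich h l c r hh =>
        have := hf.sandwich l.1 c.1 r.1 (hh ▸ h.2)
        simpa [hh] using this
    exact h0 hab)
  map_mul' p q := by
    induction p, q using Con.induction_on₂ with
    | _ u v => exact map_mul (FreeSemigroup.lift (fun h : HGen => f h.1)) u v

end

/-! ## Upliftings of i-landscapes -/

theorem river_below {g r k : Tri} {t : List Tri} (hu : IsILandscape ⟨g, r :: k :: t⟩)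
    (h₁ : g.height = r.height + 1) (h₂ : k.height = r.height + 1) : Below r g ∧ Below r k := by
  rw [isILandscape_cons, isILandscape_cons] at hu
  constructor
  · rcases hu.1 with h1 | h1
    · have := h1.height; omega
    · exact h1
  · rcases hu.2.1 with h1 | h1
    · exact h1
    · have := h1.height; omega

theorem IUpliftStep.head_eq {i : ℕ} {u v : IWord} (hs : IUpliftStep i u v) : u.head = v.head := by
  cases hs <;> rfl

theorem IUpliftStep.isILandscape {i : ℕ} {u v : IWord} (hs : IUpliftStep i u v)
    (hu : IsILandscape u) : IsILandscape v := by
  induction hs with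
  | drop h => exact (isILandscape_cons.1 (isILandscape_cons.1 hu).2).2
  | raise h₁ h₂ hne =>
    obtain ⟨a, b⟩ := river_below hu h₁ h₂
    have hz := node_mem_H.2 ⟨b, a, Ne.symm hne⟩
    simp only [isILandscape_cons] at hu ⊢
    exact ⟨Or.inl (below_right hz), Or.inr (below_left hz), hu.2.2⟩
  | there h ih =>
    rw [isILandscape_cons] at hu ⊢
    exact ⟨hu.1, ih hu.2⟩

theorem IUpliftStep.last_eq {i : ℕ} {u v : IWord} (hs : IUpliftStep i u v) :
    IWord.last u = IWord.last v := by
  induction hs with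
  | drop h => simp only [IWord.last, List.getLastD_cons]
  | raise h₁ h₂ hne => simp only [IWord.last, List.getLastD_cons]
  | there h ih => simpa only [IWord.last, List.getLastD_cons] using ih

theorem IUpliftStep.tail_ne_nil {i : ℕ} {u v : IWord} (hs : IUpliftStep i u v)
    (h : u.head = .one) : v.tail ≠ [] := by
  cases hs with
  | drop h1 =>
    change _ = Tri.one at h
    subst h
    simp [Tri.height] at h1
  | raise => simp
  | there => simp

theorem IRiverAt.exists_step {i : ℕ} {u : IWord} (h : IRiverAt i u) : ∃ v, IUpliftStep i u v := by
  induction h with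
  | @here g r k t h₁ h₂ =>
    by_cases hgk : g = k
    · subst hgk
      exact ⟨_, .drop h₁⟩
    · exact ⟨_, .raise h₁ h₂ hgk⟩
  | @there i g k t h ih =>
    obtain ⟨⟨k', t'⟩, hv⟩ := ih
    obtain rfl : k = k' := hv.head_eq
    exact ⟨_, .there hv⟩

/-- The sum of the deficiencies of the heights from `B`. -/
def deficit (B : ℕ) (l : List Tri) : ℕ := (l.map fun g => B - g.height).sum

/-- Heights change by one from letter to letter, so the first height plus the length bounds all
heights strictly below `B`. Dropping removes positive deficits, and raising lifts one letter by two.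
The first letter stays and the length does not grow, so the same `B` serves for the next step. -/
theorem IUpliftStep.deficit_lt {B i : ℕ} {u v : IWord} (hs : IUpliftStep i u v)
    (hu : IsILandscape u) (hB : u.head.height + u.tail.length < B) :
    v.tail.length ≤ u.tail.length ∧
      deficit B (IWord.letters v) < deficit B (IWord.letters u) := by
  induction hs with
  | drop h =>
    simp only [List.length_cons] at hB
    simp only [List.length_cons, deficit, IWord.letters, List.map_cons, List.sum_cons]
    omega
  | raise h₁ h₂ hne =>
    simp only [List.length_cons] at hB
    simp only [List.length_cons, deficit, IWord.letters, List.map_cons, List.sum_cons, Tri.height]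
    omega
  | there h ih =>
    rw [isILandscape_cons] at hu
    have hgk : _ ≤ _ := (show Tri.height _ ≤ Tri.height _ + 1 from
      hu.1.elim (fun h => h.height.le) (fun h => by have := h.height; omega))
    have := ih hu.2 (by simp only [List.length_cons] at hB ⊢; omega)
    simp only [List.length_cons, deficit, IWord.letters, List.map_cons, List.sum_cons] at this ⊢
    omega

theorem exists_isIReduct {u : IWord} (hu : IsILandscape u) : ∃ v, IsIReduct u v := by
  obtain ⟨B, hB⟩ : ∃ B, u.head.height + u.tail.length < B := ⟨_, Nat.lt_succ_self _⟩
  induction hn : deficit B (IWord.letters u) using Nat.strong_induction_on generalizing u with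
  | _ n ih =>
    by_cases hr : ∃ i, IRiverAt i u
    · obtain ⟨i, hi⟩ := hr
      obtain ⟨v, hv⟩ := hi.exists_step
      have h1 := hv.deficit_lt hu hB
      obtain ⟨w, hw⟩ := ih _ (hn ▸ h1.2) (hv.isILandscape hu)
        (by rw [← hv.head_eq]; omega) rfl
      exact ⟨w, Relation.ReflTransGen.head ⟨i, hu, hv⟩ hw.1, hw.2⟩
    · exact ⟨u, .refl, fun i hi => hr ⟨i, hi⟩⟩

theorem upliftings_invariant {u v : IWord}
    (h : Relation.ReflTransGen (fun u v => ∃ i, IUpliftAt i u v) u v) (hu : IsILandscape u) :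
    IsILandscape v ∧ u.head = v.head ∧ IWord.last u = IWord.last v ∧
      (u.head = .one → u.tail ≠ [] → v.tail ≠ []) ∧
      ∀ {M : Type} [Monoid M] {f : Tri → M}, IRep f →
        ev f (IWord.letters u) = ev f (IWord.letters v) := by
  induction h with
  | refl => exact ⟨hu, rfl, rfl, fun _ h => h, fun _ => rfl⟩
  | tail _ hs ih =>
    obtain ⟨i, -, hs⟩ := hs
    obtain ⟨h1, h2, h3, h4, h5⟩ := ih
    exact ⟨hs.isILandscape h1, h2.trans hs.head_eq, h3.trans hs.last_eq,
      fun h _ => hs.tail_ne_nil (h2 ▸ h), fun hf => (h5 hf).trans (hf.uplift hs h1)⟩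

/-! ## Ascending and descending words -/

def Asc (g : Tri) (a : List Tri) : Prop := List.IsChain Below (g :: a)

def Desc (g : Tri) (a : List Tri) : Prop := List.IsChain (fun h k => Below k h) (g :: a)

theorem asc_nil (g : Tri) : Asc g [] := by simp [Asc]

theorem asc_cons {g k : Tri} {t : List Tri} : Asc g (k :: t) ↔ Below g k ∧ Asc k t := by
  simp [Asc]

theorem desc_nil (g : Tri) : Desc g [] := by simp [Desc]

theorem desc_cons {g k : Tri} {t : List Tri} : Desc g (k :: t) ↔ Below k g ∧ Desc k t := by
  simp [Desc]

theorem asc_append {g : Tri} {t s : List Tri} :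
    Asc g (t ++ s) ↔ Asc g t ∧ Asc (t.getLastD g) s := by
  induction t generalizing g with
  | nil => simp [asc_nil]
  | cons k t ih => rw [List.cons_append, asc_cons, asc_cons, ih, List.getLastD_cons, and_assoc]

theorem Asc.isILandscape {g : Tri} {a : List Tri} (hg : g ∈ H) (h : Asc g a) :
    IsILandscape ⟨g, a⟩ := by
  induction a generalizing g with
  | nil => exact isILandscape_nil.2 hg
  | cons k t ih =>
    rw [asc_cons] at h
    exact isILandscape_cons.2 ⟨Or.inl h.1, ih h.1.2.1 h.2⟩

theorem Desc.isILandscape {g : Tri} {a : List Tri} (hg : g ∈ H) (h : Desc g a) :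
    IsILandscape ⟨g, a⟩ := by
  induction a generalizing g with
  | nil => exact isILandscape_nil.2 hg
  | cons k t ih =>
    rw [desc_cons] at h
    exact isILandscape_cons.2 ⟨Or.inr h.1, ih h.1.1 h.2⟩

theorem Desc.height {g : Tri} {a : List Tri} (h : Desc g a) :
    (a.getLastD g).height + a.length = g.height := by
  induction a generalizing g with
  | nil => rfl
  | cons k t ih =>
    rw [desc_cons] at h
    have := ih h.2
    have := h.1.height
    rw [List.getLastD_cons, List.length_cons]
    omega

/-- An i-landscape without i-rivers first ascends and then descends. -/
theorem exists_asc_desc {g : Tri} {t : List Tri} (hu : IsILandscape ⟨g, t⟩)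
    (hr : ∀ i, ¬ IRiverAt i ⟨g, t⟩) :
    ∃ a b, t = a ++ b ∧ Asc g a ∧ Desc (a.getLastD g) b := by
  induction t generalizing g with
  | nil => exact ⟨[], [], rfl, asc_nil g, desc_nil g⟩
  | cons k t ih =>
    rw [isILandscape_cons] at hu
    obtain ⟨a, b, rfl, ha, hb⟩ := ih hu.2 (fun i hi => hr _ (.there hi))
    rcases hu.1 with h | h
    · exact ⟨k :: a, b, rfl, asc_cons.2 ⟨h, ha⟩, by rwa [List.getLastD_cons]⟩
    · cases a with
      | nil => exact ⟨[], k :: b, rfl, asc_nil g, desc_cons.2 ⟨h, hb⟩⟩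
      | cons k₂ a => exact (hr 1 (.here h.height (asc_cons.1 ha).1.height)).elim

/-! ## The canonical paths between `1` and a letter -/

/-- The letters that follow `1` on the canonical ascending path from `1` to a letter. -/
def upPath : Tri → List Tri
  | .one => []
  | .e => [.e]
  | .f => [.f]
  | .node l c r => upPath c ++ [l, .node l c r]

/-- The letters that follow the given one on its canonical descending path to `1`. -/
def downPath : Tri → List Tri
  | .one => []
  | .e => [.one]
  | .f => [.one]
  | .node _ c r => r :: c :: downPath c

theorem upPath_last (h : Tri) : (upPath h).getLastD .one = h := by
  cases h with
  | node l c r =>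
    rw [upPath, List.getLastD_eq_getLast?, List.getLast?_append]
    simp
  | _ => rfl

theorem downPath_last (h : Tri) : (downPath h).getLastD h = .one := by
  induction h with
  | node l c r _ ih _ => simpa only [downPath, List.getLastD_cons] using ih
  | _ => rfl

theorem asc_upPath {h : Tri} (hh : h ∈ H) : Asc .one (upPath h) := by
  induction h with
  | one => exact asc_nil _
  | e => exact asc_cons.2 ⟨below_one_e, asc_nil _⟩
  | f => exact asc_cons.2 ⟨below_one_f, asc_nil _⟩
  | node l c r _ ih _ =>
    have h1 := (node_mem_H.1 hh).1
    rw [upPath, asc_append, upPath_last]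
    exact ⟨ih h1.1, asc_cons.2 ⟨h1, asc_cons.2 ⟨below_left hh, asc_nil _⟩⟩⟩

theorem desc_downPath {h : Tri} (hh : h ∈ H) : Desc h (downPath h) := by
  induction h with
  | one => exact desc_nil _
  | e => exact desc_cons.2 ⟨below_one_e, desc_nil _⟩
  | f => exact desc_cons.2 ⟨below_one_f, desc_nil _⟩
  | node l c r _ ih _ =>
    have h1 := (node_mem_H.1 hh).2.1
    exact desc_cons.2 ⟨below_right hh, desc_cons.2 ⟨h1, ih h1.1⟩⟩

theorem Asc.height_le {g : Tri} {a : List Tri} (h : Asc g a) :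
    ∀ k ∈ a, k.height ≤ (a.getLastD g).height ∧ g.height ≤ (a.getLastD g).height := by
  induction a generalizing g with
  | nil => simp
  | cons k t ih =>
    rw [asc_cons] at h
    have h1 := h.1.height
    rw [List.getLastD_cons]
    have h2 : k.height ≤ (t.getLastD k).height := by
      cases t with
      | nil => rfl
      | cons m t => exact (ih h.2 m (by simp)).2
    intro m hm
    rcases List.mem_cons.1 hm with rfl | hm
    · omega
    · have := ih h.2 m hm
      omega

theorem Desc.height_le {g : Tri} {a : List Tri} (h : Desc g a) : ∀ k ∈ a, k.height ≤ g.height := by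
  induction a generalizing g with
  | nil => simp
  | cons k t ih =>
    rw [desc_cons] at h
    have h1 := h.1.height
    intro m hm
    rcases List.mem_cons.1 hm with rfl | hm
    · omega
    · have := ih h.2 m hm
      omega

section

variable {M : Type*} [Monoid M] {f : Tri → M} (hf : IRep f)
include hf

/-- The path up to `(l, c, r)` goes through `c` and `l`, so the left relation collapses it. Together
with its descending counterpart this makes the canonical loop through `h` a landscape with value
`h`. -/
theorem IRep.ev_upPath {h : Tri} (hh : h ∈ H) : ev f (upPath h) = f h := by
  induction h with
  | one => rw [upPath, ev_nil, hf.one]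
  | e => simp [upPath, ev]
  | f => simp [upPath, ev]
  | node l c r _ ih _ =>
    rw [upPath, ev_append, ih (node_mem_H.1 hh).1.1, ev_cons, ev_cons, ev_nil, mul_one, ← mul_assoc,
      hf.left _ _ _ hh]

theorem IRep.ev_downPath {h : Tri} (hh : h ∈ H) : f h * ev f (downPath h) = f h := by
  induction h with
  | one => rw [downPath, ev_nil, mul_one]
  | e => simp [downPath, ev, hf.one]
  | f => simp [downPath, ev, hf.one]
  | node l c r _ ih _ =>
    rw [downPath, ev_cons, ev_cons, ih (node_mem_H.1 hh).1.1, ← mul_assoc, hf.right _ _ _ hh]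

theorem IRep.ev_mul_last {g : Tri} {a : List Tri} (h : (a.getLastD g) ∈ H) :
    ev f (g :: a) * f (a.getLastD g) = ev f (g :: a) := by
  induction a generalizing g with
  | nil =>
    rw [List.getLastD_nil] at h ⊢
    rw [ev_cons, ev_nil, mul_one, hf.idem _ h]
  | cons k t ih =>
    rw [List.getLastD_cons] at h ⊢
    rw [ev_cons, mul_assoc, ih h]

theorem IRep.ev_desc_mul_reverse {g : Tri} {b : List Tri} (hg : g ∈ H) (h : Desc g b) :
    ev f (g :: b) * ev f (g :: b).reverse = f g := by
  induction b generalizing g with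
  | nil => simp [ev, hf.idem g hg]
  | cons k t ih =>
    rw [desc_cons] at h
    rw [ev_cons, List.reverse_cons, ev_append, mul_assoc, ← mul_assoc (ev f (k :: t)),
      ih h.1.1 h.2, ev_cons, ev_nil, mul_one, ← mul_assoc, hf.below_mul h.1]

theorem IRep.ev_reverse_mul_asc {g : Tri} {a : List Tri} (hg : g ∈ H) (h : Asc g a) :
    ev f (g :: a).reverse * ev f (g :: a) = f (a.getLastD g) := by
  induction a generalizing g with
  | nil => simp [ev, hf.idem g hg]
  | cons k t ih =>
    rw [asc_cons] at h
    rw [List.getLastD_cons, ← ih h.1.2.1 h.2]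
    have h1 := hf.below_mul h.1
    have h2 := hf.idem k h.1.2.1
    have h3 := hf.idem g hg
    simp only [List.reverse_cons, ev_append, ev_cons, ev_nil, mul_one]
    calc ev f t.reverse * f k * f g * (f g * (f k * ev f t))
        = ev f t.reverse * (f k * (f g * f g) * f k) * ev f t := by simp only [mul_assoc]
      _ = ev f t.reverse * (f k * f k) * ev f t := by rw [h3, h1, h2]
      _ = _ := by simp only [mul_assoc]

end

/-! ## Reading letters: reduction of i-landscapes letter by letter

The state is the reversed list of the letters of an i-landscape without i-rivers. -/

/-- Reading a letter that lies above the first letter of the state. -/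
def climb : List Tri → Tri → List Tri
  | [], n => [n]
  | [c], n => [n, c]
  | c :: s :: t, n =>
    if c.height < s.height then
      -- Here `c` has become an i-river between `s` and `n`. If it is raised, `s` may in turn become
      -- an i-river below the new triple, so the triple is itself read on top of `s`.
      if n = s then s :: t else n :: climb (s :: t) (.node n c s)
    else n :: c :: s :: t

/-- The default `n` sends the empty state to the climbing case, which pushes `n`. -/
def readLetter (s : List Tri) (n : Tri) : List Tri :=
  if n.height < (s.headD n).height then n :: s else climb s n

def run (l s : List Tri) : List Tri := l.foldl readLetter s

theorem run_nil (s : List Tri) : run [] s = s := rfl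

theorem run_cons (n : Tri) (l s : List Tri) : run (n :: l) s = run l (readLetter s n) := rfl

theorem run_append (l m s : List Tri) : run (l ++ m) s = run m (run l s) := by
  simp [run]

theorem exists_climb_eq (s : List Tri) (n : Tri) : ∃ t, climb s n = n :: t := by
  match s with
  | [] => exact ⟨_, rfl⟩
  | [c] => exact ⟨_, rfl⟩
  | c :: s :: t =>
    rw [climb]
    split_ifs with h1 h2
    · exact ⟨t, by rw [h2]⟩
    · exact ⟨_, rfl⟩
    · exact ⟨_, rfl⟩

theorem exists_run_eq (l : List Tri) (c : Tri) (s : List Tri) :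
    ∃ t, run l (c :: s) = l.getLastD c :: t := by
  induction l generalizing c s with
  | nil => exact ⟨s, rfl⟩
  | cons n l ih =>
    rw [run_cons, List.getLastD_cons]
    have : ∃ t, readLetter (c :: s) n = n :: t := by
      rw [readLetter]
      split_ifs
      · exact ⟨_, rfl⟩
      · exact exists_climb_eq _ _
    obtain ⟨t, ht⟩ := this
    rw [ht]
    exact ih n t

theorem readLetter_down {n c : Tri} (h : Below n c) (s : List Tri) :
    readLetter (c :: s) n = n :: c :: s := by
  have := h.height
  rw [readLetter, if_pos]
  simp only [List.headD_cons]
  omega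

theorem readLetter_up {n c : Tri} (h : Below c n) (s : List Tri) :
    readLetter (c :: s) n = climb (c :: s) n := by
  have := h.height
  rw [readLetter, if_neg]
  simp only [List.headD_cons]
  omega

theorem run_down_up {c g : Tri} (h : Below c g) (s : List Tri) : run [c, g] (g :: s) = g :: s := by
  have := h.height
  rw [run_cons, readLetter_down h, run_cons, readLetter_up h, climb, if_pos (by omega), if_pos rfl,
    run_nil]

/-- On the left the machine raises `r` when it reads `k`; on the right the triple is read explicitly
and `k` is then a descent from it. The resulting stacks coincide, whatever further raisings the
triple causes below. -/
theorem run_raise {g r k : Tri} (hz : Tri.node k r g ∈ H) (s : List Tri) :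
    run [r, k] (g :: s) = run [.node k r g, k] (g :: s) := by
  obtain ⟨h1, h2, hne⟩ := node_mem_H.1 hz
  have := h2.height
  rw [run_cons, readLetter_down h2, run_cons, readLetter_up h1, climb, if_pos (by omega),
    if_neg hne, run_nil, run_cons, readLetter_up (below_right hz)]
  obtain ⟨t, ht⟩ := exists_climb_eq (g :: s) (.node k r g)
  rw [ht, run_cons, readLetter_down (below_left hz), run_nil]

/-- Reading `a` and reading `b` have the same effect on the states with first letter `c`. -/
def SameRun (c : Tri) (a b : List Tri) : Prop := ∀ s, run a (c :: s) = run b (c :: s)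

namespace SameRun

theorem refl (c : Tri) (a : List Tri) : SameRun c a a := fun _ => rfl

theorem trans {c : Tri} {a b d : List Tri} (h1 : SameRun c a b) (h2 : SameRun c b d) :
    SameRun c a d := fun s => (h1 s).trans (h2 s)

theorem append {c : Tri} {a b : List Tri} (h : SameRun c a b) (d : List Tri) :
    SameRun c (a ++ d) (b ++ d) := fun s => by rw [run_append, run_append, h s]

theorem prepend {c : Tri} {a b : List Tri} (d : List Tri) (h : SameRun (d.getLastD c) a b) :
    SameRun c (d ++ a) (d ++ b) := fun s => by
  rw [run_append, run_append]
  obtain ⟨t, ht⟩ := exists_run_eq d c s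
  rw [ht, h t]

theorem cons {c n : Tri} {a b : List Tri} (h : SameRun n a b) : SameRun c (n :: a) (n :: b) :=
  prepend [n] h

end SameRun

theorem sameRun_down_up {c g : Tri} (h : Below c g) (d : List Tri) : SameRun g (c :: g :: d) d :=
  SameRun.append (a := [c, g]) (b := []) (run_down_up h) d

theorem sameRun_raise {g r k : Tri} (hz : Tri.node k r g ∈ H) (d : List Tri) :
    SameRun g (r :: k :: d) (.node k r g :: k :: d) :=
  SameRun.append (a := [r, k]) (b := [.node k r g, k]) (run_raise hz) d

/-! ### Reading a descent to `1` followed by a return -/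

/-- The two claims are proved together by induction on height. The middle entry of a triple lies
below both of its outer entries, so each claim for `h` reduces, through the other claim at an entry
of `h`, to a short walk around `h`. That walk is simplified by one raising and by cancelling steps
down and back up. -/
theorem sameRun_down_up_paths (n : ℕ) : ∀ h : Tri, h.height = n →
    (∀ c, Below c h → SameRun h (downPath h ++ upPath c) [c]) ∧
    (∀ k, Below k h → SameRun k (downPath k ++ upPath h) [h]) := by
  induction n using Nat.strong_induction_on with
  | _ n ih =>
    intro h hn
    constructor
    · intro c hc
      have hch := hc.height
      obtain ⟨-, hh, hb⟩ := hc
      cases h with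
      | one => exact hb.elim
      | e => rw [show c = .one from hb]; exact .refl _ _
      | f => rw [show c = .one from hb]; exact .refl _ _
      | node l d r =>
        obtain ⟨h1, h2, hne⟩ := node_mem_H.1 hh
        have hdc : Below d c := by rcases hb with rfl | rfl <;> assumption
        -- The detour through `1` that starts at `d` is replaced with the single step from `d` up to
        -- `c`.
        refine SameRun.trans (b := [r, d, c]) ?_ ?_
        · exact .cons (.cons ((ih c.height (by omega) c rfl).2 d hdc))
        · rcases hb with rfl | rfl
          · exact (SameRun.cons (sameRun_raise hh [])).trans
              (sameRun_down_up (below_right hh) _)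
          · exact .cons (sameRun_down_up h2 [])
    · intro k hk
      have hkh := hk.height
      obtain ⟨hk1, hh, hb⟩ := hk
      cases h with
      | one => exact hb.elim
      | e => rw [show k = .one from hb]; exact .refl _ _
      | f => rw [show k = .one from hb]; exact .refl _ _
      | node l c r =>
        obtain ⟨h1, h2, hne⟩ := node_mem_H.1 hh
        have hck : Below c k := by rcases hb with rfl | rfl <;> assumption
        have h0 := ((ih k.height (by omega) k rfl).1 c hck).append [l, .node l c r]
        rw [upPath, ← List.append_assoc]
        refine h0.trans ?_
        rcases hb with rfl | rfl
        · exact sameRun_down_up h1 _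
        · exact (sameRun_raise hh _).trans (.cons (sameRun_down_up (below_left hh) []))

theorem sameRun_self {h : Tri} (hh : h ∈ H) : SameRun h (downPath h ++ upPath h) [] := by
  induction h with
  | one => exact .refl _ _
  | e => exact sameRun_down_up below_one_e []
  | f => exact sameRun_down_up below_one_f []
  | node l c r _ ih _ =>
    obtain ⟨h1, h2, hne⟩ := node_mem_H.1 hh
    have h0 : SameRun (.node l c r) (r :: c :: ((downPath c ++ upPath c) ++ [l, .node l c r]))
        (r :: c :: [l, .node l c r]) := .cons (.cons ((ih h1.1).append _))
    rw [List.append_assoc] at h0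
    refine h0.trans ?_
    refine (SameRun.cons (sameRun_raise hh _)).trans ?_
    exact (sameRun_down_up (below_right hh) _).trans (sameRun_down_up (below_left hh) [])

theorem sameRun_adj {g k : Tri} (h : Adj g k) : SameRun g (downPath g ++ upPath k) [k] := by
  rcases h with h | h
  · exact (sameRun_down_up_paths _ k rfl).2 g h
  · exact (sameRun_down_up_paths _ g rfl).1 k h

/-- The transformation given by reading a word that ends with `1`, in a state with first
letter `1`; this letter is left out. -/
def readMap (l : List Tri) : (Function.End (List Tri))ᵐᵒᵖ :=
  MulOpposite.op fun s => (run l (.one :: s)).tail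

/-- Since `a` ends with `1`, the letter removed by `tail` is exactly the one that the second reading
puts back. The opposite monoid makes the left factor act first. -/
theorem readMap_append {a : List Tri} (h : a.getLastD .one = .one) (b : List Tri) :
    readMap (a ++ b) = readMap a * readMap b := by
  apply MulOpposite.unop_injective
  funext s
  change (run (a ++ b) (.one :: s)).tail = (run b (.one :: (run a (.one :: s)).tail)).tail
  obtain ⟨t, ht⟩ := exists_run_eq a .one s
  rw [run_append, ht, h, List.tail_cons]

theorem SameRun.readMap_eq {a b : List Tri} (h : SameRun .one a b) : readMap a = readMap b := by
  apply MulOpposite.unop_injective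
  funext s
  exact congrArg List.tail (h s)

theorem getLastD_append {α : Type*} (a b : List α) (d : α) :
    (a ++ b).getLastD d = b.getLastD (a.getLastD d) := by
  induction a generalizing d with
  | nil => rfl
  | cons k t ih => rw [List.cons_append, List.getLastD_cons, List.getLastD_cons, ih]

theorem loop_last (h : Tri) : (upPath h ++ downPath h).getLastD .one = .one := by
  rw [getLastD_append, upPath_last, downPath_last]

/-- The representation of `F_2^1` by reading canonical words. -/
def readRep (h : Tri) : (Function.End (List Tri))ᵐᵒᵖ := readMap (upPath h ++ downPath h)

theorem readRep_mul_readMap (g : Tri) (d : List Tri) :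
    readRep g * readMap d = readMap (upPath g ++ (downPath g ++ d)) := by
  rw [readRep, ← readMap_append (loop_last g), List.append_assoc]

/-- Passing from `g` to a neighbouring letter. -/
theorem readMap_step {g k : Tri} (h : Adj g k) (d : List Tri) :
    readMap (upPath g ++ (downPath g ++ (upPath k ++ d))) = readMap (upPath g ++ (k :: d)) := by
  refine SameRun.readMap_eq (.prepend _ ?_)
  rw [upPath_last, ← List.append_assoc]
  exact (sameRun_adj h).append d

theorem readMap_self {g : Tri} (h : g ∈ H) (d : List Tri) :
    readMap (upPath g ++ (downPath g ++ (upPath g ++ d))) = readMap (upPath g ++ d) := by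
  refine SameRun.readMap_eq (.prepend _ ?_)
  rw [upPath_last, ← List.append_assoc]
  exact (sameRun_self h).append d

/-- Products of loops contain a descent to `1` followed by an ascent; each such detour is replaced
with a direct step between neighbouring letters, or with nothing when the letters are equal. What
remains are canonical paths, except in the sandwich relation, where the two sides differ by a
raising. -/
theorem iRep_readRep : IRep readRep where
  one := rfl
  idem h hh := by
    conv_lhs => rhs; rw [readRep]
    rw [readRep_mul_readMap, readMap_self hh, readRep]
  left l c r hh := by
    obtain ⟨h1, h2, hne⟩ := node_mem_H.1 hh
    rw [mul_assoc, readRep.eq_1 (.node l c r), readRep_mul_readMap,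
      readMap_step (Or.inl (below_left hh)), readRep_mul_readMap, readMap_step (Or.inl h1)]
    simp [upPath]
  right l c r hh := by
    obtain ⟨h1, h2, hne⟩ := node_mem_H.1 hh
    rw [mul_assoc, readRep.eq_1 c, readRep_mul_readMap, readMap_step (Or.inr h2),
      readRep_mul_readMap, readMap_step (Or.inr (below_right hh)), readRep.eq_1]
    simp [downPath]
  sandwich l c r hh := by
    obtain ⟨h1, h2, hne⟩ := node_mem_H.1 hh
    have hm : readRep c * readRep (.node l c r) = readRep (.node l c r) := by
      have h3 : readRep (.node l c r) =
          readMap (upPath c ++ (l :: .node l c r :: downPath (.node l c r))) := by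
        rw [readRep]; simp [upPath]
      rw [h3, readRep_mul_readMap, readMap_self h1.1]
    have hm' : readRep (.node l c r) * readRep c = readRep (.node l c r) := by
      conv_lhs => rw [readRep.eq_1 c, readRep_mul_readMap]
      rw [readRep]
      refine SameRun.readMap_eq ?_
      -- The cancellation takes place at `c`, inside the descending path of the triple, after its
      -- first two letters `r` and `c`.
      have h3 := SameRun.prepend (c := .one) (upPath (.node l c r) ++ [r, c])
        (a := (downPath c ++ upPath c) ++ downPath c) (b := downPath c)
        (by simpa using (sameRun_self h1.1).append (downPath c))
      simpa [downPath] using h3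
    have e1 : readRep (.node l c r) * readRep l =
        readMap (upPath (.node l c r) ++ (l :: downPath l)) := by
      rw [readRep.eq_1 l, readRep_mul_readMap, readMap_step (Or.inr (below_left hh))]
    have e2 : readRep c * readRep l = readMap (upPath c ++ (l :: downPath l)) := by
      rw [readRep.eq_1 l, readRep_mul_readMap, readMap_step (Or.inl h1)]
    rw [mul_assoc _ (readRep c) (readRep (.node l c r)), hm, mul_assoc (readRep r), hm',
      mul_assoc, mul_assoc, e1, e2, readRep_mul_readMap, readRep_mul_readMap,
      readMap_step (Or.inl (below_right hh)), readMap_step (Or.inr h2)]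
    refine SameRun.readMap_eq (.prepend _ ?_)
    rw [upPath_last]
    exact fun s => (sameRun_raise hh _ s).symm

/-! ## Normal forms in `F_2^1` -/

theorem toHGen_of_mem {t : Tri} (h : t ∈ H) : toHGen t = ⟨t, h⟩ := by
  rw [toHGen, dif_pos h]

theorem toHGen_one : toHGen .one = h1 := toHGen_of_mem one_mem_H

/-- A letter as an element of `F_2^1`. -/
noncomputable def letter (t : Tri) : F21 := clsI (wH (toHGen t))

theorem clsI_mul (u v : FreeSemigroup HGen) : clsI (u * v) = clsI u * clsI v := rfl

theorem clsI_eq_of_rel {u v : FreeSemigroup HGen} (h : IRel u v) : clsI u = clsI v :=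
  (Con.eq rhoI).2 (ConGen.Rel.of _ _ h)

theorem F21_induction {p : F21 → Prop} (hl : ∀ t ∈ H, p (letter t))
    (hm : ∀ t ∈ H, ∀ b, p b → p (letter t * b)) (q : F21) : p q := by
  induction q using Con.induction_on with
  | H u =>
    have hg : ∀ g : HGen, letter g.1 = clsI (wH g) := fun g => by
      rw [letter, toHGen_of_mem g.2]
    induction u using FreeSemigroup.recOnMul with
    | ih1 g =>
      have := hl g.1 g.2
      rw [hg g] at this
      exact this
    | ih2 g u _ h2 =>
      have := hm g.1 g.2 _ h2
      rw [hg g] at this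
      exact this

theorem clsI_one_mul (q : F21) : clsI (wH h1) * q = q := by
  have h0 : ∀ t, clsI (wH h1) * letter t = letter t := fun t =>
    show clsI (wH h1 * wH (toHGen t)) = clsI (wH (toHGen t)) from clsI_eq_of_rel (.one_mul _)
  induction q using F21_induction with
  | hl t _ => exact h0 t
  | hm t _ b _ => rw [← mul_assoc, h0]

theorem clsI_mul_one (q : F21) : q * clsI (wH h1) = q := by
  have h0 : ∀ t, letter t * clsI (wH h1) = letter t := fun t =>
    show clsI (wH (toHGen t) * wH h1) = clsI (wH (toHGen t)) from clsI_eq_of_rel (.mul_one _)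
  induction q using F21_induction with
  | hl t _ => exact h0 t
  | hm t _ b hb => rw [mul_assoc, hb]

/-- The monoid structure of `F_2^1`. -/
@[reducible] def monoidF21 : Monoid F21 where
  __ := (inferInstance : Mul F21)
  mul_assoc := mul_assoc
  one := clsI (wH h1)
  one_mul := clsI_one_mul
  mul_one := clsI_mul_one

section

attribute [local instance] monoidF21

theorem F21_one : (1 : F21) = clsI (wH h1) := rfl

theorem iRep_letter : IRep letter where
  one := by rw [letter, toHGen_one]; rfl
  idem h hh := clsI_eq_of_rel (.idem _)
  left l c r hh := by
    obtain ⟨h1, h2, -⟩ := node_mem_H.1 hh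
    rw [letter, letter, letter, toHGen_of_mem hh, toHGen_of_mem h1.1, toHGen_of_mem h1.2.1]
    exact clsI_eq_of_rel (.left _ _ _ ⟨r, h2.2.1⟩ rfl)
  right l c r hh := by
    obtain ⟨h1, h2, -⟩ := node_mem_H.1 hh
    rw [letter, letter, letter, toHGen_of_mem hh, toHGen_of_mem h2.1, toHGen_of_mem h2.2.1]
    exact clsI_eq_of_rel (.right _ ⟨l, h1.2.1⟩ _ _ rfl)
  sandwich l c r hh := by
    obtain ⟨h1, h2, -⟩ := node_mem_H.1 hh
    rw [letter, letter, letter, letter, toHGen_of_mem hh, toHGen_of_mem h2.1,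
      toHGen_of_mem h2.2.1, toHGen_of_mem h1.2.1]
    exact clsI_eq_of_rel (.sandwich _ _ _ _ rfl)

theorem clsI_word (u : IWord) : clsI (IWord.word u) = ev letter (IWord.letters u) := by
  obtain ⟨g, t⟩ := u
  induction t generalizing g with
  | nil => simp only [IWord.letters, ev_cons, ev_nil, mul_one]; rfl
  | cons k t ih =>
    have : IWord.word ⟨g, k :: t⟩ = wH (toHGen g) * IWord.word ⟨k, t⟩ :=
      map_mul (FreeSemigroup.map toHGen) (FreeSemigroup.of g) ⟨k, t⟩
    rw [this, clsI_mul, ih]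
    simp only [IWord.letters, ev_cons]
    rfl

theorem IRep.lift_letter {M : Type*} [Monoid M] {f : Tri → M} (hf : IRep f) {t : Tri}
    (ht : t ∈ H) : hf.lift (letter t) = f t := by
  rw [letter, toHGen_of_mem ht]
  rfl

theorem IRep.lift_ev {M : Type*} [Monoid M] {f : Tri → M} (hf : IRep f) {l : List Tri}
    (hl : ∀ t ∈ l, t ∈ H) : hf.lift (ev letter l) = ev f l := by
  induction l with
  | nil => exact (hf.lift_letter one_mem_H ▸ congrArg hf.lift iRep_letter.one.symm).trans hf.one
  | cons k t ih =>
    rw [ev_cons, ev_cons, map_mul, hf.lift_letter (hl k (by simp)),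
      ih fun t ht => hl t (by simp [ht])]

/-- The loops at consecutive letters telescope, because the detour through `1` between neighbours is
read as a single step. -/
theorem ev_readRep {g : Tri} {t : List Tri} (hu : IsILandscape ⟨g, t⟩) :
    ev readRep (g :: t) = readMap (upPath g ++ (t ++ downPath (t.getLastD g))) := by
  induction t generalizing g with
  | nil => rw [ev_cons, ev_nil, mul_one, readRep]; rfl
  | cons k t ih =>
    rw [isILandscape_cons] at hu
    rw [ev_cons, ih hu.2, readRep_mul_readMap, readMap_step hu.1, List.getLastD_cons]
    rfl

/-- Words with the same value are read in the same way. -/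
theorem run_eq_of_ev_eq {a b : List Tri} (ha : IsILandscape ⟨.one, a⟩)
    (hb : IsILandscape ⟨.one, b⟩) (ha1 : a.getLastD .one = .one) (hb1 : b.getLastD .one = .one)
    (h : ev letter (.one :: a) = ev letter (.one :: b)) : run a [.one] = run b [.one] := by
  have h0 := congrArg iRep_readRep.lift h
  rw [iRep_readRep.lift_ev (show ∀ t ∈ .one :: a, t ∈ H from ha.1),
    iRep_readRep.lift_ev (show ∀ t ∈ .one :: b, t ∈ H from hb.1), ev_readRep ha, ev_readRep hb,
    ha1, hb1] at h0
  have e : ∀ d, upPath .one ++ (d ++ downPath .one) = d := fun d => by simp [upPath, downPath]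
  rw [e, e] at h0
  -- The two equal transformations are applied to the empty state.
  have h2 : (run a [.one]).tail = (run b [.one]).tail :=
    congrFun (congrArg MulOpposite.unop h0) []
  obtain ⟨s, hs⟩ := exists_run_eq a .one []
  obtain ⟨t, ht⟩ := exists_run_eq b .one []
  rw [hs, ht, List.tail_cons, List.tail_cons] at h2
  rw [hs, ht, h2, ha1, hb1]

theorem run_desc {g : Tri} {b : List Tri} (h : Desc g b) (s : List Tri) :
    run b (g :: s) = b.reverse ++ g :: s := by
  induction b generalizing g s with
  | nil => rfl
  | cons k t ih =>
    rw [desc_cons] at h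
    rw [run_cons, readLetter_down h.1, ih h.2]
    simp

/-- The condition on `s` says that the top letter is not at the foot of a descent, so the first step
up creates no i-river; later steps satisfy the condition automatically. -/
theorem run_asc {g : Tri} {a : List Tri} (h : Asc g a) (s : List Tri)
    (hs : ∀ k ∈ s.head?, k.height ≤ g.height) : run a (g :: s) = a.reverse ++ g :: s := by
  induction a generalizing g s with
  | nil => rfl
  | cons k t ih =>
    rw [asc_cons] at h
    have h1 : climb (g :: s) k = k :: g :: s := by
      cases s with
      | nil => rfl
      | cons m s =>
        rw [climb, if_neg]
        have := hs m (by simp)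
        omega
    rw [run_cons, readLetter_up h.1, h1, ih h.2]
    · simp
    · have := h.1.height
      simp only [List.head?_cons, Option.mem_def, Option.some.injEq, forall_eq']
      omega

theorem run_asc_desc {g : Tri} {a b : List Tri} (ha : Asc g a) (hb : Desc (a.getLastD g) b) :
    run (a ++ b) [g] = (a ++ b).reverse ++ [g] := by
  have h1 := run_asc ha [] (by simp)
  obtain ⟨t, ht⟩ := exists_run_eq a g []
  rw [run_append, ht, run_desc hb, ← ht, h1]
  simp

/-- I-landscapes from `1` to `1` without i-rivers are determined by their values. -/
theorem eq_of_ev_eq {a b : List Tri} (ha : IsILandscape ⟨.one, a⟩)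
    (hb : IsILandscape ⟨.one, b⟩) (ha1 : a.getLastD .one = .one) (hb1 : b.getLastD .one = .one)
    (hra : ∀ i, ¬ IRiverAt i ⟨.one, a⟩) (hrb : ∀ i, ¬ IRiverAt i ⟨.one, b⟩)
    (h : ev letter (.one :: a) = ev letter (.one :: b)) : a = b := by
  have h0 := run_eq_of_ev_eq ha hb ha1 hb1 h
  obtain ⟨a1, a2, rfl, h1, h2⟩ := exists_asc_desc ha hra
  obtain ⟨b1, b2, rfl, h3, h4⟩ := exists_asc_desc hb hrb
  rw [run_asc_desc h1 h2, run_asc_desc h3 h4] at h0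
  exact List.reverse_injective (List.append_cancel_right h0)

/-- Each generator is replaced with its canonical loop, which has the same value; loops at `1` can
be concatenated. -/
theorem exists_landscape (q : F21) : ∃ a, IsILandscape ⟨.one, a⟩ ∧ a.getLastD .one = .one ∧
    q = ev letter (.one :: a) := by
  have hloop : ∀ t ∈ H, IsILandscape ⟨.one, upPath t ++ downPath t⟩ := fun t ht => by
    rw [isILandscape_append, upPath_last]
    exact ⟨(asc_upPath ht).isILandscape one_mem_H, (desc_downPath ht).isILandscape ht⟩
  have hev : ∀ t ∈ H, ev letter (upPath t ++ downPath t) = letter t := fun t ht => by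
    rw [ev_append, iRep_letter.ev_upPath ht, iRep_letter.ev_downPath ht]
  induction q using F21_induction with
  | hl t ht =>
    exact ⟨_, hloop t ht, loop_last t, by rw [ev_cons, hev t ht, iRep_letter.one, one_mul]⟩
  | hm t ht b ih =>
    obtain ⟨a, h1, h2, h3⟩ := ih
    refine ⟨(upPath t ++ downPath t) ++ a, ?_, ?_, ?_⟩
    · rw [isILandscape_append, loop_last]
      exact ⟨hloop t ht, h1⟩
    · rw [getLastD_append, loop_last, h2]
    · rw [h3, ev_cons, ev_cons, ev_append, hev t ht, iRep_letter.one, one_mul, one_mul]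

/-- Each landscape has the value of one without i-rivers and with the same ends. -/
theorem exists_reduced {g : Tri} {t : List Tri} (hu : IsILandscape ⟨g, t⟩) :
    ∃ a b, Asc g a ∧ Desc (a.getLastD g) b ∧ (a ++ b).getLastD g = t.getLastD g ∧
      ev letter (g :: t) = ev letter (g :: (a ++ b)) := by
  obtain ⟨⟨g', t'⟩, h1, h2⟩ := exists_isIReduct hu
  obtain ⟨h3, h4, h5, -, h6⟩ := upliftings_invariant h1 hu
  obtain rfl : g = g' := h4
  obtain ⟨a, b, rfl, h7, h8⟩ := exists_asc_desc h3 h2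
  exact ⟨a, b, h7, h8, h5.symm, h6 iRep_letter⟩

/-- In a normal form, an ascent followed by a descent, the reversed word is an inverse. The ascent
preceded by its reverse has the value of the peak, and so has the descent followed by its reverse.
-/
theorem F21_regular (q : F21) : ∃ q', q * q' * q = q := by
  obtain ⟨t, h1, h2, rfl⟩ := exists_landscape q
  obtain ⟨a, b, ha, hb, -, h⟩ := exists_reduced h1
  rw [h]
  have hk : a.getLastD .one ∈ H := by
    have := ha.isILandscape one_mem_H
    rw [← List.append_nil a, isILandscape_append] at this
    exact this.2.head_mem
  -- The peak is idempotent, so it may be doubled and shared by both halves.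
  have e1 : ev letter (.one :: (a ++ b)) =
      ev letter (.one :: a) * ev letter (a.getLastD .one :: b) := by
    rw [ev_cons, ev_append, ev_cons (a.getLastD .one) b, ← mul_assoc, ← ev_cons,
      ← mul_assoc (ev letter _) (letter _), iRep_letter.ev_mul_last hk]
  have e2 := iRep_letter.ev_desc_mul_reverse hk hb
  have e3 := iRep_letter.ev_reverse_mul_asc one_mem_H ha
  rw [e1]
  set X := ev letter (.one :: a)
  set Z := ev letter (a.getLastD .one :: b) with hZ
  have e4 : letter (a.getLastD .one) * Z = Z := by
    rw [hZ, ev_cons, ← mul_assoc, iRep_letter.idem _ hk]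
  refine ⟨ev letter (a.getLastD .one :: b).reverse * ev letter (.one :: a).reverse, ?_⟩
  calc X * Z * (ev letter (a.getLastD .one :: b).reverse * ev letter (.one :: a).reverse) * (X * Z)
      = X * (Z * ev letter (a.getLastD .one :: b).reverse) *
        (ev letter (.one :: a).reverse * X) * Z := by simp only [mul_assoc]
    _ = X * Z := by rw [e2, e3, mul_assoc, mul_assoc, e4, e4]

/-! ### Rigidity: a triple is determined by its relations -/

theorem exists_climb_height {g : Tri} {s : List Tri} (hg : g ∈ s) (n : Tri) :
    ∃ k ∈ climb s n, g.height ≤ k.height := by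
  match s, hg with
  | [c], hg => exact ⟨g, by simp_all [climb], le_rfl⟩
  | c :: s :: t, hg =>
    rw [climb]
    split_ifs with h1 h2
    · rcases List.mem_cons.1 hg with rfl | hg
      · exact ⟨s, by simp, by omega⟩
      · exact ⟨g, hg, le_rfl⟩
    · have h3 : ∃ m ∈ s :: t, g.height ≤ m.height := by
        rcases List.mem_cons.1 hg with rfl | hg
        · exact ⟨s, by simp, by omega⟩
        · exact ⟨g, hg, le_rfl⟩
      obtain ⟨m, hm, hgm⟩ := h3
      obtain ⟨k, hk, hmk⟩ := exists_climb_height hm (.node n c s)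
      exact ⟨k, List.mem_cons_of_mem _ hk, by omega⟩
    · exact ⟨g, List.mem_cons_of_mem _ hg, le_rfl⟩

/-- A letter disappears from the state only when a higher one remains, so the maximal height on the
stack never decreases. In `eq_node` this excludes letters higher than the triple. -/
theorem exists_run_height {g : Tri} {s : List Tri} (hg : g ∈ s) (l : List Tri) :
    ∃ k ∈ run l s, g.height ≤ k.height := by
  induction l generalizing g s with
  | nil => exact ⟨g, hg, le_rfl⟩
  | cons n l ih =>
    have h0 : ∃ m ∈ readLetter s n, g.height ≤ m.height := by
      rw [readLetter]
      split_ifs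
      · exact ⟨g, List.mem_cons_of_mem _ hg, le_rfl⟩
      · exact exists_climb_height hg n
    obtain ⟨m, hm, hgm⟩ := h0
    obtain ⟨k, hk, hmk⟩ := ih hm
    exact ⟨k, hk, by omega⟩

/-- The letter `(l, c, r)` is the only solution of its defining relations. -/
theorem eq_node {l c r : Tri} (hh : Tri.node l c r ∈ H) {t : F21}
    (h1 : letter c * letter l * t = t) (h2 : t * letter r * letter c = t)
    (h3 : letter r * letter c * t * letter c * letter l = letter r * letter c * letter l) :
    t = letter (.node l c r) := by
  obtain ⟨hcl, hcr, hne⟩ := node_mem_H.1 hh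
  have hl := hcl.2.1
  have hr := hcr.2.1
  have hc := hcl.1
  have hhl := (below_left hh).height
  have hhr := (below_right hh).height
  have hf := iRep_letter
  set h := Tri.node l c r with hh0
  -- the landscape from `l` to `r` with value `l t r`
  obtain ⟨w, hw1, hw2, rfl⟩ := exists_landscape t
  have hup := (asc_upPath hr).isILandscape one_mem_H
  have hdn := (desc_downPath hl).isILandscape hl
  have hV : IsILandscape ⟨l, downPath l ++ (w ++ upPath r)⟩ := by
    rw [isILandscape_append, downPath_last, isILandscape_append, hw2]
    exact ⟨hdn, hw1, hup⟩
  obtain ⟨a, b, ha, hb, hlast, hval⟩ := exists_reduced hV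
  rw [getLastD_append (downPath l), downPath_last, getLastD_append w, hw2, upPath_last] at hlast
  have hval' : letter l * ev letter (.one :: w) * letter r = ev letter (l :: (a ++ b)) := by
    rw [← hval, ev_cons l, ev_append, ev_append, ← mul_assoc (letter l) (ev _ _),
      hf.ev_downPath hl, hf.ev_upPath hr, ev_cons, hf.one, one_mul, mul_assoc]
  set t := ev letter (.one :: w)
  -- The first two relations give `t = c l t r c`, so `t` can be recovered from the landscape with
  -- value `l t r`.
  have ht : t = letter c * ev letter (l :: (a ++ b)) * letter c := by
    rw [← hval', ← mul_assoc, ← mul_assoc, h1, h2]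
  have hland : IsILandscape ⟨l, a ++ b⟩ := by
    have := ha.isILandscape hl
    have h0 := this
    rw [← List.append_nil a, isILandscape_append] at h0
    exact isILandscape_append.2 ⟨this, hb.isILandscape h0.2.head_mem⟩
  -- both sides of the last relation as landscapes
  have hcc := hf.idem c hc
  have hA : IsILandscape ⟨.one, upPath r ++ (c :: l :: ((a ++ b) ++ (c :: l :: downPath l)))⟩ := by
    rw [isILandscape_append, upPath_last, isILandscape_cons, isILandscape_cons,
      isILandscape_append, hlast, isILandscape_cons, isILandscape_cons]
    exact ⟨hup, Or.inr hcr, Or.inl hcl, hland, Or.inr hcr, Or.inl hcl, hdn⟩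
  have hB : IsILandscape ⟨.one, upPath r ++ (c :: l :: downPath l)⟩ := by
    rw [isILandscape_append, upPath_last, isILandscape_cons, isILandscape_cons]
    exact ⟨hup, Or.inr hcr, Or.inl hcl, hdn⟩
  -- The third relation becomes an equality of readings: inserting the reduced landscape from `l` to
  -- `r`, followed by `c` and `l`, has no effect on the final state.
  have hAB := run_eq_of_ev_eq hA hB
    (by simp only [getLastD_append, List.getLastD_cons, downPath_last])
    (by simp only [getLastD_append, List.getLastD_cons, downPath_last]) (by
      rw [ht] at h3
      have e1 := hf.ev_downPath hl
      have e2 := hf.ev_upPath hr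
      have e3 : letter r * letter c * (letter c * ev letter (l :: (a ++ b)) * letter c) * letter c *
          letter l = letter r * (letter c * letter c) * ev letter (l :: (a ++ b)) *
            (letter c * letter c) * letter l := by simp only [mul_assoc]
      rw [e3, hcc] at h3
      simp only [ev_cons, ev_append, e1, e2, hf.one, one_mul] at h3 ⊢
      simpa only [mul_assoc] using h3)
  have hasc : Asc .one (upPath r ++ [h]) := by
    rw [asc_append, upPath_last]
    exact ⟨asc_upPath hr, asc_cons.2 ⟨below_right hh, asc_nil _⟩⟩
  have hS := run_asc hasc [] (by simp)
  rw [List.reverse_append, List.reverse_singleton, List.append_assoc, List.singleton_append] at hS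
  set S := (upPath r).reverse ++ [Tri.one] with hS0
  -- Reading `c` and `l` after the path up to `r` raises the i-river `c` to `h`, so both readings
  -- continue from the state with `l` on top of `h`.
  have hstart : ∀ d, run (upPath r ++ (c :: l :: d)) [.one] = run d (l :: h :: S) := fun d => by
    have e1 : run (upPath r ++ (c :: l :: d)) [.one] = run (upPath r ++ (h :: l :: d)) [.one] := by
      refine SameRun.prepend (upPath r) ?_ []
      rw [upPath_last]
      exact sameRun_raise hh d
    rw [e1, show upPath r ++ (h :: l :: d) = (upPath r ++ [h]) ++ (l :: d) by simp, run_append, hS,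
      run_cons, readLetter_down (below_left hh)]
  rw [hstart, hstart, run_append, run_desc (desc_downPath hl)] at hAB
  -- no letter higher than `h` occurs
  have hbound : ∀ k ∈ (downPath l).reverse ++ l :: h :: S, k.height ≤ h.height := by
    intro k hk
    simp only [hS0, List.mem_append, List.mem_reverse, List.mem_cons, List.not_mem_nil,
      or_false] at hk
    rcases hk with hk | rfl | rfl | hk | rfl
    · have := (desc_downPath hl).height_le k hk
      omega
    · omega
    · exact le_rfl
    · have := ((asc_upPath hr).height_le k hk).1
      rw [upPath_last] at this
      omega
    · exact Nat.zero_le _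
  have hno : ∀ {s d d' : List Tri} {k : Tri}, k ∈ s → h.height < k.height →
      run d' (run d s) ≠ (downPath l).reverse ++ l :: h :: S := by
    intro s d d' k hk hlt heq
    rw [← run_append] at heq
    obtain ⟨m, hm, hkm⟩ := exists_run_height hk (d ++ d')
    rw [heq] at hm
    have := hbound m hm
    omega
  -- the landscape from `l` to `r` is `l h r`
  have hab : a ++ b = [h, r] := by
    cases a with
    | nil =>
      -- Without an ascent, `b` descends between letters of equal height; it is then empty and `l =
      -- r`.
      have h4 := hb.height
      simp only [List.nil_append, List.getLastD_nil] at h4 hlast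
      rw [hlast] at h4
      cases b with
      | nil => exact absurd hlast hne
      | cons => simp at h4; omega
    | cons p a =>
      rw [asc_cons] at ha
      have hp := ha.1.height
      -- Otherwise `l` would be an i-river between `h` and `p`, and its raising would leave a letter
      -- higher than `h` in the state.
      have hpe : p = h := by
        by_contra hpe
        rw [List.cons_append, run_cons p, readLetter_up ha.1, climb, if_pos (by omega),
          if_neg hpe] at hAB
        obtain ⟨s, hs⟩ := exists_climb_eq (h :: S) (.node p l h)
        rw [hs] at hAB
        exact hno (k := .node p l h) (by simp) (by simp only [Tri.height]; omega) hAB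
      subst hpe
      cases a with
      | cons p' a =>
        -- A second step up would reach a letter higher than `h`.
        have hp' := (asc_cons.1 ha.2).1
        have hph := hp'.height
        rw [List.cons_append, run_cons h, readLetter_up ha.1, climb, if_pos (by omega), if_pos rfl,
          List.cons_append, run_cons p', readLetter_up hp'] at hAB
        obtain ⟨s, hs⟩ := exists_climb_eq (h :: S) p'
        rw [hs] at hAB
        exact (hno (k := p') (by simp) (by omega) hAB).elim
      | nil =>
        simp only [List.getLastD_cons, List.getLastD_nil, List.cons_append,
          List.nil_append] at hb hlast
        have h4 := hb.height
        rw [hlast] at h4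
        match b, h4, hlast with
        | [q], _, hlast => rw [← show q = r from hlast]; rfl
        | [], h4, _ => simp at h4; omega
        | _ :: _ :: _, h4, _ => simp at h4; omega
  rw [ht, hab, ev_cons, ev_cons, ev_cons, ev_nil, mul_one, ← mul_assoc, ← mul_assoc,
    hf.left l c r hh, hf.right l c r hh]

end

/-! ## A uniform description of the relabelling -/

/-- The type of a letter of `H`: the side `e` or `f` on which it is placed. -/
def tau : Tri → Bool
  | .one => false
  | .e => false
  | .f => true
  | .node _ c _ => tau c

/-- The anchor between letters of given types. -/
def delta : Bool → Bool → Anchor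
  | true, false => .x
  | false, true => .xi
  | _, _ => .one

theorem delta_inv (i j : Bool) : (delta i j).inv = delta j i := by
  cases i <;> cases j <;> rfl

theorem delta_self (i : Bool) : delta i i = .one := by cases i <;> rfl

theorem delta_left_injective {i i' j : Bool} (h : delta i j = delta i' j) : i = i' := by
  revert i i' j; decide

/-- The 5-tuple of a letter of `H`. -/
def code : Tri → Term
  | .one => Term.one
  | .e => gxx
  | .f => gxx
  | .node l c r =>
    .node (code l) (delta (tau l) (tau c)) (code c) (delta (tau r) (tau c)) (code r)

def codeSteps : Tri → List Tri → List (Anchor × Term)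
  | _, [] => []
  | h, k :: t => (delta (tau h) (tau k), code k) :: codeSteps k t

def codeWord (v : IWord) : AltWord := ⟨code v.head, codeSteps v.head v.tail⟩

theorem height_code (t : Tri) : (code t).height = t.height := by
  induction t with
  | node l c r ih _ _ => simp [code, Term.height, Tri.height, ih]
  | _ => rfl

/-- With the type of the triple known, each anchor of its code reveals the type of the corresponding
outer entry, and the middle entry has the type of the triple. So the induction hypothesis applies to
all three entries. -/
theorem code_injective {s t : Tri} (h : code s = code t) (ht : tau s = tau t) : s = t := by
  have hno : ∀ l c r, code (.node l c r) ≠ gxx := by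
    intro l c r h
    simp only [code, gxx, Term.node.injEq] at h
    cases c <;> simp [code, gxx] at h
  induction s generalizing t with
  | one => cases t <;> simp [code, gxx] at h ⊢
  | e =>
    cases t with
    | node l c r => exact (hno _ _ _ h.symm).elim
    | _ => simp_all [code, gxx, tau]
  | f =>
    cases t with
    | node l c r => exact (hno _ _ _ h.symm).elim
    | _ => simp_all [code, gxx, tau]
  | node l c r ihl ihc ihr =>
    cases t with
    | one => simp [code] at h
    | e => exact (hno _ _ _ h).elim
    | f => exact (hno _ _ _ h).elim
    | node l' c' r' =>
      simp only [code, Term.node.injEq] at h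
      obtain ⟨h1, h2, h3, h4, h5⟩ := h
      have ht' : tau c = tau c' := ht
      rw [ht'] at h2 h4
      rw [ihl h1 (delta_left_injective h2), ihc h3 ht', ihr h5 (delta_left_injective h4)]

theorem eq_one_of_height {h : Tri} (h0 : h.height = 0) : h = .one := by
  cases h <;> simp_all [Tri.height]

theorem node_height_two {l c r : Tri} (hh : Tri.node l c r ∈ H) :
    1 ≤ l.height ∧ 1 ≤ r.height := by
  obtain ⟨h1, h2, -⟩ := node_mem_H.1 hh
  exact ⟨by have := h1.height; omega, by have := h2.height; omega⟩

theorem eq_of_height_one {h : Tri} (hh : h ∈ H) (h1 : h.height = 1) : h = .e ∨ h = .f := by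
  cases h with
  | one => simp [Tri.height] at h1
  | e => exact Or.inl rfl
  | f => exact Or.inr rfl
  | node l c r =>
    have := node_height_two hh
    simp only [Tri.height] at h1
    omega

theorem eq_of_height_two {h : Tri} (hh : h ∈ H) (h2 : h.height = 2) : h = h21 ∨ h = h22 := by
  cases h with
  | node l c r =>
    obtain ⟨h3, h4, hne⟩ := node_mem_H.1 hh
    have a1 := h3.height
    have a2 := h4.height
    simp only [Tri.height] at h2
    obtain rfl := eq_one_of_height (h := c) (by omega)
    rcases eq_of_height_one h3.2.1 (by omega) with rfl | rfl <;>
      rcases eq_of_height_one h4.2.1 (by omega) with rfl | rfl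
    · exact (hne rfl).elim
    · exact Or.inl rfl
    · exact Or.inr rfl
    · exact (hne rfl).elim
  | _ => simp [Tri.height] at h2

theorem h21_mem_H : h21 ∈ H := node_mem_H.2 ⟨below_one_e, below_one_f, by decide⟩

theorem h22_mem_H : h22 ∈ H := node_mem_H.2 ⟨below_one_f, below_one_e, by decide⟩

theorem tau_of_height_two {h : Tri} (hh : h ∈ H) (h2 : h.height = 2) : tau h = false := by
  rcases eq_of_height_two hh h2 with rfl | rfl <;> rfl

/-- The neighbours of the letters of height one have type `false`. -/
theorem tau_of_adj {g h : Tri} (ha : Adj g h) (h1 : h.height = 1) : tau g = false := by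
  rcases ha with ha | ha
  · have := ha.height
    rw [eq_one_of_height (h := g) (by omega)]
    rfl
  · exact tau_of_height_two ha.2.1 (by have := ha.height; omega)

theorem tau_node (l c r : Tri) : tau (.node l c r) = tau c := rfl

theorem leftAnchor_code {l c r : Tri} :
    (code (.node l c r)).leftAnchor = delta (tau l) (tau (.node l c r)) := rfl

theorem rightAnchor_code {l c r : Tri} :
    (code (.node l c r)).rightAnchor = delta (tau r) (tau (.node l c r)) := rfl

theorem code_below {k h : Tri} (hb : IBelow k h) (h2 : 2 ≤ h.height) :
    (code k, delta (tau h) (tau k)) = ((code h).left, (code h).leftAnchor.inv) ∨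
    (code k, delta (tau h) (tau k)) = ((code h).right, (code h).rightAnchor.inv) := by
  cases h with
  | node l c r =>
    rw [leftAnchor_code, rightAnchor_code, delta_inv, delta_inv]
    rcases hb with rfl | rfl
    · exact Or.inl rfl
    · exact Or.inr rfl
  | _ => simp [Tri.height] at h2

/-- The anchors that `psi` takes from the outer entries are, by induction, values of `delta` at the
types. At height three the outer entries have type `false`, so both anchors are `delta false (tau
c)`, that is `1` for `e` and `x'` for `f`. -/
theorem psi_eq_code {h : Tri} (hh : h ∈ H) : psi h = code h := by
  induction h with
  | one => rfl
  | e => rfl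
  | f => rfl
  | node l c r ihl ihc ihr =>
    obtain ⟨hl, hr, hne⟩ := node_mem_H.1 hh
    have el := ihl hl.2.1
    have er := ihr hr.2.1
    have a1 := hl.height
    have a2 := hr.height
    by_cases h1 : Tri.node l c r = h21
    · rw [h1]; rfl
    by_cases h2 : Tri.node l c r = h22
    · rw [h2]; rfl
    rw [psi, if_neg h1, if_neg h2]
    by_cases h3 : c = .e
    · subst h3
      rw [if_pos rfl, el, er, code, tau_of_height_two hl.2.1 a1, tau_of_height_two hr.2.1 a2]
      rfl
    by_cases h4 : c = .f
    · subst h4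
      rw [if_neg h3, if_pos rfl, el, er, code, tau_of_height_two hl.2.1 a1,
        tau_of_height_two hr.2.1 a2]
      rfl
    rw [if_neg h3, if_neg h4]
    have hc : c.height ≠ 0 := fun h0 => by
      rcases eq_of_height_two hh (by simp only [Tri.height]; omega) with h | h
      · exact h1 h
      · exact h2 h
    have key : ∀ k, Below c k → psi k = code k →
        (if k.left = c then (psi k).leftAnchor.inv else (psi k).rightAnchor.inv) =
          delta (tau k) (tau c) := by
      intro k hk ek
      have := hk.height
      rw [ek]
      obtain ⟨-, -, hb⟩ := hk
      cases k with
      | node kl kc kr =>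
        rw [leftAnchor_code, rightAnchor_code, delta_inv, delta_inv]
        split_ifs with h5
        · rw [← h5]; rfl
        · rcases hb with rfl | rfl
          · exact (h5 rfl).elim
          · rfl
      | _ => simp only [Tri.height] at this; omega
    rw [key l hl el, key r hr er, el, er, ihc hl.1, code]

/-- Next to a letter of height one the other letter has type `false`, which explains the four
special cases. Otherwise the anchor is stored in the higher letter. -/
theorem anchorBetween_eq {h k : Tri} (ha : Adj h k) : anchorBetween h k = delta (tau h) (tau k) := by
  have hr : ∀ {k l : Tri}, Below k l → 2 ≤ l.height →
      (if l.left = k then (psi l).leftAnchor else (psi l).rightAnchor) =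
        delta (tau k) (tau l) := by
    intro k l hb h2
    rw [psi_eq_code hb.2.1]
    obtain ⟨-, -, hb⟩ := hb
    cases l with
    | node l c r =>
      rw [leftAnchor_code, rightAnchor_code]
      split_ifs with h5
      · rw [← h5]; rfl
      · rcases hb with rfl | rfl
        · exact (h5 rfl).elim
        · rfl
    | _ => simp [Tri.height] at h2
  rw [anchorBetween]
  split_ifs with h1 h2 h3 h4 h5 h6 h7
  · subst h1; rw [tau_of_adj ha rfl]; rfl
  · subst h2; rw [tau_of_adj ha rfl]; rfl
  · subst h3; rw [tau_of_adj ha.symm rfl]; rfl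
  · subst h4; rw [tau_of_adj ha.symm rfl]; rfl
  · have hb : Below h k := ha.resolve_right fun hb => by have := hb.height; omega
    have h2 : 2 ≤ k.height := by
      have := hb.height
      by_contra h0
      rcases eq_of_height_one hb.2.1 (by omega) with h | h
      · exact h1 h
      · contradiction
    rw [← hr hb h2, if_pos h6]
  · have hb : Below h k := ha.resolve_right fun hb => by have := hb.height; omega
    have h2 : 2 ≤ k.height := by
      have := hb.height
      by_contra h0
      rcases eq_of_height_one hb.2.1 (by omega) with h | h
      · exact h1 h
      · contradiction
    rw [← hr hb h2, if_neg h6]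
  all_goals
    have hb : Below k h := ha.resolve_left fun hb => by have := hb.height; omega
    have h2 : 2 ≤ h.height := by
      have := hb.height
      by_contra h0
      rcases eq_of_height_one hb.2.1 (by omega) with h | h
      · exact h3 h
      · contradiction
    rw [← delta_inv, ← hr hb h2]
  · rw [if_pos h7]
  · rw [if_neg h7]

theorem psibar_eq {v : IWord} (hv : IsILandscape v) : psibar v = codeWord v := by
  obtain ⟨g, t⟩ := v
  have h0 : psiSteps g t = codeSteps g t := by
    induction t generalizing g with
    | nil => rfl
    | cons k t ih =>
      rw [isILandscape_cons] at hv
      rw [psiSteps, codeSteps, ih _ hv.2, anchorBetween_eq hv.1, psi_eq_code hv.2.head_mem]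
  rw [psibar, codeWord, psi_eq_code hv.head_mem]
  exact congrArg _ h0

/-! ### Decoding letters and mountain ranges -/

theorem code_eq_gxx_iff {h : Tri} (hh : h ∈ H) : code h = gxx ↔ h.height = 1 := by
  constructor
  · intro h1
    rw [← height_code, h1]
    rfl
  · intro h1
    rcases eq_of_height_one hh h1 with rfl | rfl <;> rfl

/-- The type of a middle entry `g_{xx'}` is recovered from the left anchor, because the left entry
then has height two and type `false`. -/
theorem phi_code {h : Tri} (hh : h ∈ H) (h1 : h.height ≠ 1) : phi (code h) = h := by
  induction h with
  | one => rfl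
  | e => exact (h1 rfl).elim
  | f => exact (h1 rfl).elim
  | node l c r ihl ihc ihr =>
    obtain ⟨hl, hr, hne⟩ := node_mem_H.1 hh
    have a1 := hl.height
    have a2 := hr.height
    by_cases h2 : (Tri.node l c r).height = 2
    · rcases eq_of_height_two hh h2 with h3 | h3 <;> rw [h3] <;> decide
    · have h3 : code (.node l c r) ≠ g2e1 := fun h => h2 (by rw [← height_code, h]; rfl)
      have h4 : code (.node l c r) ≠ g2e2 := fun h => h2 (by rw [← height_code, h]; rfl)
      simp only [Tri.height] at h1 h2
      rw [code] at h3 h4 ⊢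
      rw [phi, if_neg h3, if_neg h4, ihl hl.2.1 (by omega), ihr hr.2.1 (by omega)]
      by_cases h5 : c.height = 1
      · rw [if_pos ((code_eq_gxx_iff hl.1).2 h5), tau_of_height_two hl.2.1 (by omega)]
        rcases eq_of_height_one hl.1 h5 with rfl | rfl <;> rfl
      · rw [if_neg (fun h => h5 ((code_eq_gxx_iff hl.1).1 h)), ihc hl.1 h5]

theorem code_injective_of_height {g h : Tri} (hg : g ∈ H) (hh : h ∈ H) (h1 : h.height ≠ 1)
    (he : code g = code h) : g = h := by
  have h2 : g.height = h.height := by rw [← height_code, he, height_code]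
  rw [← phi_code hg (h2 ▸ h1), he, phi_code hh h1]

theorem phibar_codeWord {v : IWord} (hv : IsILandscape v) (h1 : v.head = .one) :
    phibar (codeWord v) = v := by
  obtain ⟨g, t⟩ := v
  obtain rfl : g = .one := h1
  have h0 : ∀ (g : Tri), IsILandscape ⟨g, t⟩ → (codeSteps g t).map (fun p =>
    if p.2 = gxx then (if p.1 = .one then Tri.e else .f) else phi p.2) = t := by
    clear hv
    induction t with
    | nil => exact fun _ _ => rfl
    | cons k t ih =>
      intro g hv
      rw [isILandscape_cons] at hv
      have hk := hv.2.head_mem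
      rw [codeSteps, List.map_cons, ih k hv.2]
      by_cases h2 : k.height = 1
      · rw [if_pos ((code_eq_gxx_iff hk).2 h2), tau_of_adj hv.1 h2]
        rcases eq_of_height_one hk h2 with rfl | rfl <;> rfl
      · rw [if_neg fun h => h2 ((code_eq_gxx_iff hk).1 h), phi_code hk h2]
  exact congrArg (FreeSemigroup.mk Tri.one) (h0 _ hv)

/-- The two letters of height two give tuples in `Ge`. All higher ones fall in `Gd`, since their
outer entries have height at least two, where `code` is injective and keeps them different. -/
theorem Gi_of_mem_H {h : Tri} (hh : h ∈ H) (h1 : h ≠ .one) : code h ∈ Gi h.height := by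
  induction h with
  | one => exact (h1 rfl).elim
  | e => exact Or.inl rfl
  | f => exact Or.inl rfl
  | node l c r ihl ihc ihr =>
    obtain ⟨hl, hr, hne⟩ := node_mem_H.1 hh
    have a1 := hl.height
    have a2 := hr.height
    by_cases h2 : (Tri.node l c r).height = 2
    · rcases eq_of_height_two hh h2 with h3 | h3 <;> rw [h3]
      · exact Or.inl ⟨gxx, rfl, Or.inl rfl⟩
      · exact Or.inl ⟨gxx, rfl, Or.inr rfl⟩
    · obtain ⟨i, hi⟩ : ∃ i, c.height = i + 1 := Nat.exists_eq_succ_of_ne_zero fun h0 =>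
        h2 (by simp only [Tri.height]; omega)
      have e1 := ihl hl.2.1 (fun h => not_below_one (h ▸ hl))
      have e2 := ihc hl.1 (fun h => by rw [h] at hi; simp [Tri.height] at hi)
      have e3 := ihr hr.2.1 (fun h => not_below_one (h ▸ hr))
      rw [a1, hi] at e1
      rw [a2, hi] at e3
      rw [hi] at e2
      rw [show (Tri.node l c r).height = i + 3 by simp only [Tri.height]; omega]
      refine Or.inr ⟨_, _, _, _, _, rfl, e1, e2, e3, ?_, code_below hl.2.2 (by omega),
        code_below hr.2.2 (by omega)⟩
      exact fun he => hne (code_injective_of_height hl.2.1 hr.2.1 (by omega) he)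

theorem GcircI_of_mem_H {h : Tri} (hh : h ∈ H) (h1 : h ≠ .one) : code h ∈ GcircI h.height := by
  induction h with
  | one => exact (h1 rfl).elim
  | e => exact rfl
  | f => exact rfl
  | node l c r ihl ihc ihr =>
    obtain ⟨hl, hr, hne⟩ := node_mem_H.1 hh
    have a1 := hl.height
    have a2 := hr.height
    have e1 := ihl hl.2.1 (fun h => not_below_one (h ▸ hl))
    have e3 := ihr hr.2.1 (fun h => not_below_one (h ▸ hr))
    have hG := Gi_of_mem_H hh h1
    match hi : c.height with
    | 0 =>
      rcases eq_of_height_two hh (by simp only [Tri.height]; omega) with h3 | h3 <;> rw [h3]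
      · exact Or.inl rfl
      · exact Or.inr rfl
    | 1 =>
      rw [show (Tri.node l c r).height = 3 by simp only [Tri.height]; omega]
      rcases eq_of_height_one hl.1 hi with rfl | rfl <;>
      rcases eq_of_height_two hl.2.1 a1 with rfl | rfl <;>
      rcases eq_of_height_two hr.2.1 a2 with rfl | rfl
      · exact (hne rfl).elim
      · exact Or.inl rfl
      · exact Or.inr (Or.inr (Or.inl rfl))
      · exact (hne rfl).elim
      · exact (hne rfl).elim
      · exact Or.inr (Or.inl rfl)
      · exact Or.inr (Or.inr (Or.inr rfl))
      · exact (hne rfl).elim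
    | i + 2 =>
      rw [show (Tri.node l c r).height = i + 4 by simp only [Tri.height]; omega] at hG ⊢
      rw [a1, hi] at e1
      rw [a2, hi] at e3
      refine ⟨hG.resolve_left ?_, e1, e3⟩
      -- Tuples of `Ge` at this height have equal left and right entries, which is impossible for
      -- the code of a triple.
      rintro ⟨g, -, h | h⟩
      all_goals
        simp only [code, Term.node.injEq] at h
        exact hne (code_injective_of_height hl.2.1 hr.2.1 (by omega) (h.1.trans h.2.2.2.2.symm))

theorem node_h2_mem_H {a b : Tri} (ha : a = h21 ∨ a = h22) (hb : b = h21 ∨ b = h22) (hab : a ≠ b)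
    {c : Tri} (hc : c = .e ∨ c = .f) : Tri.node a c b ∈ H := by
  have key : ∀ a, a = h21 ∨ a = h22 → Below c a := by
    rintro a (rfl | rfl)
    · exact ⟨by rcases hc with rfl | rfl; exacts [e_mem_H, f_mem_H], h21_mem_H, hc⟩
    · exact ⟨by rcases hc with rfl | rfl; exacts [e_mem_H, f_mem_H], h22_mem_H, hc.symm⟩
  exact node_mem_H.2 ⟨key a ha, key b hb, hab⟩

/-- From height four on, the middle entry and its anchors come from entries of the two decoded outer
letters. This gives two candidates for the decoded middle entry, which agree because `code` is
injective away from height one. -/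
theorem exists_code_eq : ∀ (i : ℕ) {g : Term}, g ∈ GcircI (i + 2) →
    ∃ h ∈ H, h.height = i + 2 ∧ code h = g
  | 0, g, hg => by
    rcases hg with rfl | rfl
    · exact ⟨h21, h21_mem_H, rfl, rfl⟩
    · exact ⟨h22, h22_mem_H, rfl, rfl⟩
  | 1, g, hg => by
    have n1 : h21 ≠ h22 := by decide
    rcases hg with rfl | rfl | rfl | rfl
    · exact ⟨.node h21 .e h22, node_h2_mem_H (.inl rfl) (.inr rfl) n1 (.inl rfl), rfl, rfl⟩
    · exact ⟨.node h21 .f h22, node_h2_mem_H (.inl rfl) (.inr rfl) n1 (.inr rfl), rfl, rfl⟩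
    · exact ⟨.node h22 .e h21, node_h2_mem_H (.inr rfl) (.inl rfl) n1.symm (.inl rfl), rfl, rfl⟩
    · exact ⟨.node h22 .f h21, node_h2_mem_H (.inr rfl) (.inl rfl) n1.symm (.inr rfl), rfl, rfl⟩
  | i + 2, g, hg => by
    obtain ⟨⟨l, la, c, ra, r, rfl, hl, hc, hr, hne, h1, h2⟩, hgl, hgr⟩ := hg
    obtain ⟨hl', hlH, al, rfl⟩ := exists_code_eq (i + 1) hgl
    obtain ⟨hr', hrH, ar, rfl⟩ := exists_code_eq (i + 1) hgr
    have key : ∀ (k : Tri) (a : Anchor), k ∈ H → 2 ≤ k.height →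
        ((c, a) = ((code k).left, (code k).leftAnchor.inv) ∨
          (c, a) = ((code k).right, (code k).rightAnchor.inv)) →
        ∃ m, Below m k ∧ code m = c ∧ a = delta (tau k) (tau m) := by
      intro k a hk h2 h
      cases k with
      | node kl kc kr =>
        rw [leftAnchor_code, rightAnchor_code, delta_inv, delta_inv] at h
        simp only [Prod.mk.injEq] at h
        rcases h with ⟨rfl, rfl⟩ | ⟨rfl, rfl⟩
        · exact ⟨kl, below_left hk, rfl, rfl⟩
        · exact ⟨kr, below_right hk, rfl, rfl⟩
      | _ => simp [Tri.height] at h2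
    obtain ⟨m, hm, hmc, rfl⟩ := key hl' la hlH (by omega) h1
    obtain ⟨m', hm', hmc', rfl⟩ := key hr' ra hrH (by omega) h2
    have am := hm.height
    obtain rfl : m' = m := code_injective_of_height hm'.1 hm.1 (by omega) (hmc'.trans hmc.symm)
    subst hmc
    exact ⟨.node hl' m' hr', node_mem_H.2 ⟨hm, hm', fun h => hne (by rw [h])⟩,
      by simp only [Tri.height]; omega, rfl⟩

theorem anchored_code {h k : Tri} (ha : Adj h k) :
    Anchored (code h) (delta (tau h) (tau k)) (code k) := by
  rcases ha with ⟨-, -, hb⟩ | ⟨-, -, hb⟩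
  · left
    cases k with
    | one => exact hb.elim
    | e => rw [show h = .one from hb]; exact Or.inl rfl
    | f => rw [show h = .one from hb]; exact Or.inr rfl
    | node l c r =>
      rcases hb with rfl | rfl
      · exact Or.inl rfl
      · exact Or.inr rfl
  · right
    cases h with
    | one => exact hb.elim
    | e => rw [show k = .one from hb]; exact Or.inl rfl
    | f => rw [show k = .one from hb]; exact Or.inr rfl
    | node l c r =>
      rcases hb with rfl | rfl
      · exact Or.inl (by rw [delta_inv]; rfl)
      · exact Or.inr (by rw [delta_inv]; rfl)

theorem code_mem_Gprime {h : Tri} (hh : h ∈ H) : code h ∈ Gprime := by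
  by_cases h1 : h = .one
  · subst h1; exact Or.inr rfl
  · exact Or.inl ⟨h.height, Nat.one_le_iff_ne_zero.2 fun h0 => h1 (eq_one_of_height h0),
      Gi_of_mem_H hh h1⟩

theorem code_mem_Gcirc {h : Tri} (hh : h ∈ H) : code h ∈ Gcirc ∪ {Term.one} := by
  by_cases h1 : h = .one
  · subst h1; exact Or.inr rfl
  · exact Or.inl ⟨h.height, Nat.one_le_iff_ne_zero.2 fun h0 => h1 (eq_one_of_height h0),
      GcircI_of_mem_H hh h1⟩

theorem codeSteps_letters (g : Tri) (t : List Tri) :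
    (codeSteps g t).map Prod.snd = t.map code := by
  induction t generalizing g with
  | nil => rfl
  | cons k t ih => rw [codeSteps, List.map_cons, List.map_cons, ih]

theorem isLandscape_codeWord {v : IWord} (hv : IsILandscape v) : IsLandscape (codeWord v) := by
  obtain ⟨g, t⟩ := v
  constructor
  · intro x hx
    simp only [codeWord, AltWord.letters, codeSteps_letters, ← List.map_cons, List.mem_map] at hx
    obtain ⟨h, hh, rfl⟩ := hx
    exact code_mem_Gprime (hv.1 h hh)
  · have h0 : ∀ a, List.IsChain (fun p q : Anchor × Term => Anchored p.2 q.1 q.2)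
        ((a, code g) :: codeSteps g t) := by
      induction t generalizing g with
      | nil => intro a; simp [codeSteps]
      | cons k t ih =>
        intro a
        rw [isILandscape_cons] at hv
        rw [codeSteps, List.isChain_cons_cons]
        exact ⟨anchored_code hv.1, ih k hv.2 _⟩
    exact h0 _

theorem codeWord_last (v : IWord) : (codeWord v).last = code (IWord.last v) := by
  obtain ⟨g, t⟩ := v
  simp only [AltWord.last, codeWord, codeSteps_letters, IWord.last]
  induction t generalizing g with
  | nil => rfl
  | cons k t ih => rw [List.map_cons, List.getLastD_cons, List.getLastD_cons, ih]

theorem codeWord_mem_MRcirc {v : IWord} (hv : v ∈ MRi) : codeWord v ∈ MRcirc := by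
  obtain ⟨h1, h2, h3, h4⟩ := hv
  refine ⟨⟨isLandscape_codeWord h1, ?_, ?_, ?_⟩, ?_, ?_⟩
  · simp only [codeWord, h2]; rfl
  · rw [codeWord_last, h3]; rfl
  · obtain ⟨g, _ | ⟨k, t⟩⟩ := v
    · exact (h4 rfl).elim
    · simp [codeWord, codeSteps]
  · obtain ⟨g, t⟩ := v
    intro x hx
    simp only [codeWord, AltWord.letters, codeSteps_letters, ← List.map_cons, List.mem_map] at hx
    obtain ⟨h, hh, rfl⟩ := hx
    exact code_mem_Gcirc (h1.1 h hh)
  · obtain ⟨g, t⟩ := v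
    clear h2 h3 h4
    simp only [codeWord]
    induction t generalizing g with
    | nil => simp [codeSteps]
    | cons k t ih =>
      rw [isILandscape_cons] at h1
      cases t with
      | nil => simp [codeSteps]
      | cons m t =>
        have h2 := ih k h1.2
        rw [isILandscape_cons] at h1
        simp only [codeSteps, List.isChain_cons_cons] at h2 ⊢
        refine ⟨fun hk => ?_, h2⟩
        rw [height_code] at hk
        -- Both neighbours of a letter of height one have type `false`, so the anchors around it are
        -- inverse to each other.
        rw [delta_inv, tau_of_adj h1.1 hk, tau_of_adj h1.2.1.symm hk]

/-- Decoding one step of a mountain range of `MR°`. -/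
theorem exists_adj_code {h : Tri} (hh : h ∈ H) {a : Anchor} {g : Term}
    (hg : g ∈ Gcirc ∪ {Term.one}) (ha : Anchored (code h) a g)
    (h1 : h.height = 1 → a = delta (tau h) false) :
    ∃ k, Adj h k ∧ code k = g ∧ a = delta (tau h) (tau k) := by
  rcases ha with ha | ha
  · rcases hg with ⟨i, hi, hg⟩ | rfl
    · match i, hi, hg with
      | 1, _, hg =>
        obtain rfl : g = gxx := hg
        simp only [gxx, LeftAnchored, Prod.mk.injEq] at ha
        have h0 : h = .one := eq_one_of_height (by
          rw [← height_code]; rcases ha with ha | ha <;> rw [ha.1] <;> rfl)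
        subst h0
        rcases ha with ⟨-, rfl⟩ | ⟨-, rfl⟩
        · exact ⟨.e, Or.inl below_one_e, rfl, rfl⟩
        · exact ⟨.f, Or.inl below_one_f, rfl, rfl⟩
      | i + 2, _, hg =>
        obtain ⟨k, hk, hgh, rfl⟩ := exists_code_eq i hg
        cases k with
        | node l c r =>
          have key : ∀ m, Below m (.node l c r) → code h = code m → a = delta (tau m) (tau c) →
              h = m := by
            intro m hm he ha
            -- At height one the code does not distinguish `e` from `f`; the anchor that leaves `h`
            -- does, since the next letter has height two and type `false`.
            by_cases hm1 : m.height = 1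
            · have hh1 : h.height = 1 := by rw [← height_code, he, height_code, hm1]
              have := h1 hh1
              have hc : tau (.node l c r) = false := tau_of_height_two hk (by rw [hm.height, hm1])
              rw [ha, show tau c = false from hc] at this
              exact code_injective he (delta_left_injective this.symm)
            · exact code_injective_of_height hh hm.1 hm1 he
          simp only [code, LeftAnchored, Prod.mk.injEq] at ha
          rcases ha with ⟨e1, e2⟩ | ⟨e1, e2⟩
          · obtain rfl := key l (below_left hk) e1 e2
            exact ⟨_, Or.inl (below_left hk), rfl, e2⟩
          · obtain rfl := key r (below_right hk) e1 e2
            exact ⟨_, Or.inl (below_right hk), rfl, e2⟩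
        | one => exact ha.elim
        | e => simp [Tri.height] at hgh
        | f => simp [Tri.height] at hgh
    · exact ha.elim
  · cases h with
    | one => exact ha.elim
    | e =>
      simp only [code, gxx, RightAnchored, Prod.mk.injEq] at ha
      refine ⟨.one, Or.inr below_one_e, ?_, h1 rfl⟩
      rcases ha with ha | ha <;> rw [ha.1] <;> rfl
    | f =>
      simp only [code, gxx, RightAnchored, Prod.mk.injEq] at ha
      refine ⟨.one, Or.inr below_one_f, ?_, h1 rfl⟩
      rcases ha with ha | ha <;> rw [ha.1] <;> rfl
    | node l c r =>
      simp only [code, RightAnchored, Prod.mk.injEq, delta_inv] at ha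
      rcases ha with ⟨rfl, e2⟩ | ⟨rfl, e2⟩
      · exact ⟨l, Or.inr (below_left hh), rfl, e2⟩
      · exact ⟨r, Or.inr (below_right hh), rfl, e2⟩

/-- The word is decoded from left to right. The last hypothesis says that the anchor after a letter
of height one fits the type already chosen for it; condition (b) of `MRcirc` hands this on to the
next letter. -/
theorem exists_codeSteps_eq (t : List (Anchor × Term)) : ∀ (h : Tri) (b : Anchor), h ∈ H →
    (∀ p ∈ t, p.2 ∈ Gcirc ∪ {Term.one}) →
    List.IsChain (fun p q : Anchor × Term => Anchored p.2 q.1 q.2) ((b, code h) :: t) →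
    List.IsChain (fun p q : Anchor × Term => p.2.height = 1 → q.1 = p.1.inv) t →
    (∀ p ∈ t.head?, h.height = 1 → p.1 = delta (tau h) false) →
    ∃ s, IsILandscape ⟨h, s⟩ ∧ codeSteps h s = t := by
  induction t with
  | nil => exact fun h b hh _ _ _ _ => ⟨[], isILandscape_nil.2 hh, rfl⟩
  | cons p t ih =>
    obtain ⟨a, g⟩ := p
    intro h b hh hmem hch hch' hfirst
    rw [List.isChain_cons_cons] at hch
    obtain ⟨k, hk, rfl, rfl⟩ := exists_adj_code hh (hmem _ (by simp)) hch.1 (hfirst _ (by simp))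
    have hkH : k ∈ H := hk.elim (fun h => h.2.1) (fun h => h.1)
    obtain ⟨s, hs, rfl⟩ := ih k _ hkH (fun p hp => hmem p (by simp [hp])) hch.2
      (List.IsChain.of_cons hch') (by
        intro p hp hk1
        cases t with
        | nil => simp at hp
        | cons q t =>
          obtain rfl : q = p := by simpa using hp
          rw [List.isChain_cons_cons] at hch'
          rw [hch'.1 (by rw [height_code]; exact hk1), delta_inv, tau_of_adj hk hk1])
    exact ⟨k :: s, isILandscape_cons.2 ⟨hk, hs⟩, rfl⟩

theorem exists_codeWord_eq {u : AltWord} (hu : u ∈ MRcirc) : ∃ v ∈ MRi, codeWord v = u := by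
  obtain ⟨g, t⟩ := u
  obtain ⟨⟨h1, h2, h3, h4⟩, h5, h6⟩ := hu
  obtain rfl : g = Term.one := h2
  obtain ⟨s, hs, rfl⟩ := exists_codeSteps_eq t .one .one one_mem_H
    (fun p hp => h5 p.2 (List.mem_cons_of_mem _ (List.mem_map_of_mem hp))) h1.2 h6
    (by intro p _ h; simp [Tri.height] at h)
  refine ⟨⟨.one, s⟩, ⟨hs, rfl, ?_, ?_⟩, rfl⟩
  · apply eq_one_of_height
    rw [← height_code, ← codeWord_last]
    exact congrArg Term.height h3
  · rintro rfl
    exact h4 rfl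

/-! ## The relabelling and upliftings -/

theorem IUpliftStep.codeWord {i : ℕ} {p q : IWord} (h : IUpliftStep i p q) :
    UpliftStep i (codeWord p) (codeWord q) := by
  induction h with
  | drop h =>
    exact .drop (by rw [height_code, height_code]; exact h) (by rw [delta_inv])
  | @raise g r k t h₁ h₂ hne =>
    have h0 : UpliftStep 1 (MonogenicWeak.codeWord ⟨g, r :: k :: t⟩) _ :=
      .raise (by rw [height_code, height_code]; exact h₁)
        (by rw [height_code, height_code]; exact h₂) (by
          rw [delta_inv]
          exact fun h => hne (code_injective h.1 (delta_left_injective h.2)))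
    rw [delta_inv] at h0
    exact h0
  | there h ih => exact .there ih

/-- The test for dropping compares tuples and anchors. With a common river letter, equal tuples and
matching anchors mean equal codes and equal types, hence equal letters of `H`, so the two test
conditions coincide. -/
theorem exists_iUpliftStep {i : ℕ} {u v : AltWord} (h : UpliftStep i u v) {p : IWord}
    (hp : codeWord p = u) : ∃ q, IUpliftStep i p q ∧ codeWord q = v := by
  induction h generalizing p with
  | drop h hab =>
    obtain ⟨g, _ | ⟨r, _ | ⟨k, t⟩⟩⟩ := p
    · simp [codeWord, codeSteps] at hp
    · simp [codeWord, codeSteps] at hp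
    · simp only [codeWord, codeSteps, AltWord.mk.injEq, List.cons.injEq, Prod.mk.injEq] at hp
      obtain ⟨rfl, ⟨rfl, rfl⟩, ⟨rfl, hgk⟩, rfl⟩ := hp
      rw [delta_inv] at hab
      obtain rfl := code_injective hgk (delta_left_injective hab).symm
      rw [height_code, height_code] at h
      exact ⟨_, .drop h, rfl⟩
  | raise h₁ h₂ hne =>
    obtain ⟨g, _ | ⟨r, _ | ⟨k, t⟩⟩⟩ := p
    · simp [codeWord, codeSteps] at hp
    · simp [codeWord, codeSteps] at hp
    · simp only [codeWord, codeSteps, AltWord.mk.injEq, List.cons.injEq, Prod.mk.injEq] at hp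
      obtain ⟨rfl, ⟨rfl, rfl⟩, ⟨rfl, rfl⟩, rfl⟩ := hp
      rw [height_code, height_code] at h₁ h₂
      refine ⟨_, .raise h₁ h₂ fun h => ?_, ?_⟩
      · subst h
        exact hne ⟨rfl, (delta_inv _ _).symm⟩
      · rw [delta_inv]
        rfl
  | there h ih =>
    obtain ⟨g, _ | ⟨k, t⟩⟩ := p
    · simp [codeWord, codeSteps] at hp
    · simp only [codeWord, codeSteps, AltWord.mk.injEq, List.cons.injEq, Prod.mk.injEq] at hp
      obtain ⟨rfl, ⟨rfl, rfl⟩, rfl⟩ := hp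
      obtain ⟨⟨k', t'⟩, h1, h2⟩ := ih (p := ⟨k, t⟩) rfl
      obtain rfl : k = k' := h1.head_eq
      simp only [codeWord, AltWord.mk.injEq, true_and] at h2
      subst h2
      exact ⟨_, .there h1, rfl⟩

theorem IRiverAt.codeWord {i : ℕ} {p : IWord} (h : IRiverAt i p) : RiverAt i (codeWord p) := by
  induction h with
  | here h₁ h₂ =>
    exact .here (by rw [height_code, height_code]; exact h₁)
      (by rw [height_code, height_code]; exact h₂)
  | there h ih => exact .there ih

theorem iRiverAt_of_riverAt {i : ℕ} {u : AltWord} (h : RiverAt i u) {p : IWord}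
    (hp : codeWord p = u) : IRiverAt i p := by
  induction h generalizing p with
  | here h₁ h₂ =>
    obtain ⟨g, _ | ⟨r, _ | ⟨k, t⟩⟩⟩ := p
    · simp [codeWord, codeSteps] at hp
    · simp [codeWord, codeSteps] at hp
    · simp only [codeWord, codeSteps, AltWord.mk.injEq, List.cons.injEq, Prod.mk.injEq] at hp
      obtain ⟨rfl, ⟨rfl, rfl⟩, ⟨rfl, rfl⟩, rfl⟩ := hp
      rw [height_code, height_code] at h₁ h₂
      exact .here h₁ h₂
  | there h ih =>
    obtain ⟨g, _ | ⟨k, t⟩⟩ := p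
    · simp [codeWord, codeSteps] at hp
    · simp only [codeWord, codeSteps, AltWord.mk.injEq, List.cons.injEq, Prod.mk.injEq] at hp
      obtain ⟨rfl, ⟨rfl, rfl⟩, rfl⟩ := hp
      exact .there (ih (p := ⟨k, t⟩) rfl)

theorem riverless_codeWord {p : IWord} :
    (∀ i, ¬ RiverAt i (codeWord p)) ↔ ∀ i, ¬ IRiverAt i p :=
  ⟨fun h i hi => h i hi.codeWord, fun h i hi => h i (iRiverAt_of_riverAt hi rfl)⟩

theorem IUpliftStep.mem_MRi {i : ℕ} {p q : IWord} (h : IUpliftStep i p q) (hp : p ∈ MRi) :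
    q ∈ MRi :=
  ⟨h.isILandscape hp.1, h.head_eq ▸ hp.2.1, h.last_eq ▸ hp.2.2.1, h.tail_ne_nil hp.2.1⟩

theorem phibar_codeWord_of_mem {p : IWord} (hp : p ∈ MRi) : phibar (codeWord p) = p :=
  phibar_codeWord hp.1 hp.2.1

theorem phibar_mapsTo : Set.MapsTo phibar MRcirc MRi := by
  intro u hu
  obtain ⟨p, hp, rfl⟩ := exists_codeWord_eq hu
  rwa [phibar_codeWord_of_mem hp]

theorem psibar_mapsTo : Set.MapsTo psibar MRi MRcirc := fun p hp => by
  rw [psibar_eq hp.1]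
  exact codeWord_mem_MRcirc hp

theorem invOn_psibar_phibar : Set.InvOn psibar phibar MRcirc MRi := by
  constructor
  · intro u hu
    obtain ⟨p, hp, rfl⟩ := exists_codeWord_eq hu
    rw [phibar_codeWord_of_mem hp, psibar_eq hp.1]
  · intro p hp
    rw [psibar_eq hp.1, phibar_codeWord_of_mem hp]

theorem bijOn_phibar : Set.BijOn phibar MRcirc MRi :=
  invOn_psibar_phibar.bijOn phibar_mapsTo psibar_mapsTo

theorem bijOn_psibar : Set.BijOn psibar MRi MRcirc :=
  invOn_psibar_phibar.symm.bijOn psibar_mapsTo phibar_mapsTo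

theorem uplift_phibar (i : ℕ) (u v : AltWord) (hu : u ∈ MRcirc) (h : UpliftAt i u v) :
    v ∈ MRcirc ∧ IUpliftAt i (phibar u) (phibar v) := by
  obtain ⟨p, hp, rfl⟩ := exists_codeWord_eq hu
  obtain ⟨q, hq, rfl⟩ := exists_iUpliftStep h.2 rfl
  have hq' := hq.mem_MRi hp
  rw [phibar_codeWord_of_mem hp, phibar_codeWord_of_mem hq']
  exact ⟨codeWord_mem_MRcirc hq', hp.1, hq⟩

theorem codeWord_mem_Mcirc {p : IWord} (hp : p ∈ Mi) : codeWord p ∈ Mcirc :=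
  ⟨codeWord_mem_MRcirc hp.1, (codeWord_mem_MRcirc hp.1).1, riverless_codeWord.2 hp.2⟩

theorem exists_codeWord_eq_of_mem_Mcirc {u : AltWord} (hu : u ∈ Mcirc) :
    ∃ p ∈ Mi, codeWord p = u := by
  obtain ⟨p, hp, rfl⟩ := exists_codeWord_eq hu.1
  exact ⟨p, ⟨hp, riverless_codeWord.1 hu.2.2⟩, rfl⟩

theorem phibar_mapsTo_mountains : Set.MapsTo phibar Mcirc Mi := by
  intro u hu
  obtain ⟨p, hp, rfl⟩ := exists_codeWord_eq_of_mem_Mcirc hu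
  rwa [phibar_codeWord_of_mem hp.1]

theorem psibar_mapsTo_mountains : Set.MapsTo psibar Mi Mcirc := fun p hp => by
  rw [psibar_eq hp.1.1]
  exact codeWord_mem_Mcirc hp

theorem invOn_mountains : Set.InvOn psibar phibar Mcirc Mi :=
  invOn_psibar_phibar.mono (fun _ h => h.1) (fun _ h => h.1)

theorem bijOn_phibar_mountains : Set.BijOn phibar Mcirc Mi :=
  invOn_mountains.bijOn phibar_mapsTo_mountains psibar_mapsTo_mountains

theorem bijOn_psibar_mountains : Set.BijOn psibar Mi Mcirc :=
  invOn_mountains.symm.bijOn psibar_mapsTo_mountains phibar_mapsTo_mountains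

/-! ## The products of mountains -/

theorem join_mem_MRi {p q : IWord} (hp : p ∈ MRi) (hq : q ∈ MRi) : IWord.join p q ∈ MRi := by
  obtain ⟨g, s⟩ := p
  obtain ⟨k, t⟩ := q
  obtain ⟨h1, h2, h3, h4⟩ := hp
  obtain ⟨h5, h6, h7, h8⟩ := hq
  obtain rfl : g = .one := h2
  obtain rfl : k = .one := h6
  have h3' : s.getLastD .one = .one := h3
  have h7' : t.getLastD .one = .one := h7
  refine ⟨?_, rfl, ?_, ?_⟩
  · exact isILandscape_append.2 ⟨h1, by rwa [h3']⟩
  · change (s ++ t).getLastD .one = .one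
    rw [getLastD_append, h3', h7']
  · exact fun h => h8 (List.append_eq_nil_iff.1 h).2

theorem codeSteps_append (g : Tri) (s t : List Tri) :
    codeSteps g (s ++ t) = codeSteps g s ++ codeSteps (s.getLastD g) t := by
  induction s generalizing g with
  | nil => rfl
  | cons k s ih =>
    rw [List.cons_append, codeSteps, codeSteps, ih, List.getLastD_cons, List.cons_append]

theorem codeWord_join {p q : IWord} (hp : p ∈ MRi) (hq : q ∈ MRi) :
    codeWord (IWord.join p q) = (codeWord p).join (codeWord q) := by
  obtain ⟨g, s⟩ := p
  obtain ⟨k, t⟩ := q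
  have h3 : s.getLastD g = .one := hp.2.2.1
  have h6 : k = .one := hq.2.1
  simp only [codeWord, IWord.join, AltWord.join, codeSteps_append, h3, h6]

theorem upliftings_codeWord {p q : IWord} (hp : p ∈ MRi)
    (h : Relation.ReflTransGen (fun u v => ∃ i, IUpliftAt i u v) p q) :
    q ∈ MRi ∧ Relation.ReflTransGen (fun u v => ∃ i, UpliftAt i u v) (codeWord p) (codeWord q) := by
  induction h with
  | refl => exact ⟨hp, .refl⟩
  | tail _ hs ih =>
    obtain ⟨i, h1, hs⟩ := hs
    exact ⟨hs.mem_MRi ih.1, ih.2.tail ⟨i, isLandscape_codeWord h1, hs.codeWord⟩⟩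

theorem exists_iUpliftings {p : IWord} {v : AltWord} (hp : p ∈ MRi)
    (h : Relation.ReflTransGen (fun u v => ∃ i, UpliftAt i u v) (codeWord p) v) :
    ∃ q ∈ MRi, Relation.ReflTransGen (fun u v => ∃ i, IUpliftAt i u v) p q ∧ codeWord q = v := by
  induction h with
  | refl => exact ⟨p, hp, .refl, rfl⟩
  | tail _ hs ih =>
    obtain ⟨i, h1, hs⟩ := hs
    obtain ⟨q, hq, h2, rfl⟩ := ih
    obtain ⟨q', h3, rfl⟩ := exists_iUpliftStep hs rfl
    exact ⟨q', h3.mem_MRi hq, h2.tail ⟨i, hq.1, h3⟩, rfl⟩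

theorem IsIReduct.mem_Mi {p q : IWord} (h : IsIReduct p q) (hp : p ∈ MRi) : q ∈ Mi :=
  ⟨(upliftings_codeWord hp h.1).1, h.2⟩

theorem IsIReduct.codeWord {p q : IWord} (h : IsIReduct p q) (hp : p ∈ MRi) :
    IsReduct (codeWord p) (codeWord q) :=
  ⟨(upliftings_codeWord hp h.1).2, riverless_codeWord.2 h.2⟩

theorem exists_isIReduct_of_isReduct {p : IWord} {v : AltWord} (hp : p ∈ MRi)
    (h : IsReduct (codeWord p) v) : ∃ q, IsIReduct p q ∧ MonogenicWeak.codeWord q = v := by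
  obtain ⟨q, -, h1, rfl⟩ := exists_iUpliftings hp h.1
  exact ⟨q, ⟨h1, riverless_codeWord.1 h.2⟩, rfl⟩

section

attribute [local instance] monoidF21

theorem IsIReduct.clsI_eq {p q : IWord} (h : IsIReduct p q) (hp : IsILandscape p) :
    clsI (IWord.word p) = clsI (IWord.word q) := by
  rw [clsI_word, clsI_word]
  exact (upliftings_invariant h.1 hp).2.2.2.2 iRep_letter

theorem eq_of_clsI_eq {p q : IWord} (hp : p ∈ Mi) (hq : q ∈ Mi)
    (h : clsI (IWord.word p) = clsI (IWord.word q)) : p = q := by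
  obtain ⟨g, s⟩ := p
  obtain ⟨k, t⟩ := q
  rw [clsI_word, clsI_word] at h
  obtain ⟨⟨h1, h2, h3, -⟩, h4⟩ := hp
  obtain ⟨⟨h5, h6, h7, -⟩, h8⟩ := hq
  obtain rfl : g = .one := h2
  obtain rfl : k = .one := h6
  rw [eq_of_ev_eq h1 h5 h3 h7 h4 h8 h]

theorem clsI_join {p q : IWord} (hq : q ∈ MRi) :
    clsI (IWord.word (IWord.join p q)) = clsI (IWord.word p) * clsI (IWord.word q) := by
  have h6 : q.head = .one := hq.2.1
  simp only [clsI_word, IWord.letters, IWord.join, ev_cons, ev_append, h6]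
  rw [iRep_letter.one, one_mul, mul_assoc]

end

/-- Two reducts are i-mountains with the same value in `F_2^1`, so they are the same normal form; no
confluence of upliftings has to be checked. -/
theorem existsUnique_isIReduct {p : IWord} (hp : p ∈ MRi) : ∃! w, IsIReduct p w := by
  obtain ⟨w, hw⟩ := exists_isIReduct hp.1
  refine ⟨w, hw, fun w' hw' => ?_⟩
  exact eq_of_clsI_eq (hw'.mem_Mi hp) (hw.mem_Mi hp)
    ((hw'.clsI_eq hp.1).symm.trans (hw.clsI_eq hp.1))

theorem existsUnique_isReduct {p : IWord} (hp : p ∈ MRi) : ∃! w, IsReduct (codeWord p) w := by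
  obtain ⟨w, hw, huniq⟩ := existsUnique_isIReduct hp
  refine ⟨codeWord w, hw.codeWord hp, fun w' hw' => ?_⟩
  obtain ⟨q, hq, rfl⟩ := exists_isIReduct_of_isReduct hp hw'
  rw [huniq q hq]

theorem isIReduct_iodot {p q : IWord} (hp : p ∈ MRi) (hq : q ∈ MRi) :
    IsIReduct (IWord.join p q) (iodot p q) :=
  Classical.epsilon_spec (existsUnique_isIReduct (join_mem_MRi hp hq)).exists

theorem iodot_mem_Mi {p q : IWord} (hp : p ∈ MRi) (hq : q ∈ MRi) : iodot p q ∈ Mi :=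
  (isIReduct_iodot hp hq).mem_Mi (join_mem_MRi hp hq)

theorem odot_codeWord {p q : IWord} (hp : p ∈ MRi) (hq : q ∈ MRi) :
    odot (codeWord p) (codeWord q) = codeWord (iodot p q) := by
  have hj := join_mem_MRi hp hq
  have hu := existsUnique_isReduct hj
  rw [odot, beta2, ← codeWord_join hp hq]
  exact hu.unique (Classical.epsilon_spec hu.exists) ((isIReduct_iodot hp hq).codeWord hj)

theorem clsI_iodot {p q : IWord} (hp : p ∈ MRi) (hq : q ∈ MRi) :
    clsI (IWord.word (iodot p q)) = clsI (IWord.word p) * clsI (IWord.word q) := by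
  rw [← (isIReduct_iodot hp hq).clsI_eq (join_mem_MRi hp hq).1, clsI_join hq]

theorem odot_mountains {u v : AltWord} (hu : u ∈ Mcirc) (hv : v ∈ Mcirc) :
    (∃! w, IsReduct (u.join v) w) ∧ odot u v ∈ Mcirc ∧
      phibar (odot u v) = iodot (phibar u) (phibar v) := by
  obtain ⟨p, hp, rfl⟩ := exists_codeWord_eq_of_mem_Mcirc hu
  obtain ⟨q, hq, rfl⟩ := exists_codeWord_eq_of_mem_Mcirc hv
  have hi := iodot_mem_Mi hp.1 hq.1
  rw [odot_codeWord hp.1 hq.1, phibar_codeWord_of_mem hp.1, phibar_codeWord_of_mem hq.1,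
    phibar_codeWord_of_mem hi.1, ← codeWord_join hp.1 hq.1]
  exact ⟨existsUnique_isReduct (join_mem_MRi hp.1 hq.1), codeWord_mem_Mcirc hi, rfl⟩

theorem iodot_mountains {p q : IWord} (hp : p ∈ Mi) (hq : q ∈ Mi) :
    (∃! w, IsIReduct (IWord.join p q) w) ∧ iodot p q ∈ Mi ∧
      psibar (iodot p q) = odot (psibar p) (psibar q) := by
  have hi := iodot_mem_Mi hp.1 hq.1
  rw [psibar_eq hp.1.1, psibar_eq hq.1.1, psibar_eq hi.1.1, odot_codeWord hp.1 hq.1]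
  exact ⟨existsUnique_isIReduct (join_mem_MRi hp.1 hq.1), hi, rfl⟩

/-! ## Families satisfying the relations of `F_1` -/

/-- The relations of `F_1^1` for a family of elements of a monoid indexed by the letters. -/
structure TermRep {M : Type*} [Monoid M] (f : Term → M) : Prop where
  x_xi_x : f (.anchor .x) * f (.anchor .xi) * f (.anchor .x) = f (.anchor .x)
  xi_x_xi : f (.anchor .xi) * f (.anchor .x) * f (.anchor .xi) = f (.anchor .xi)
  gxx : f gxx = f (.anchor .x) * f (.anchor .xi)
  one : f Term.one = 1
  idem : ∀ g ∈ Gprime, f g * f g = f g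
  left : ∀ l la c ra r, Term.node l la c ra r ∈ G5 → 2 ≤ l.height + 1 →
    f c * (f (.anchor la.inv) * f l * f (.anchor la)) * f (.node l la c ra r) =
      f (.node l la c ra r)
  right : ∀ l la c ra r, Term.node l la c ra r ∈ G5 → 2 ≤ l.height + 1 →
    f (.node l la c ra r) * (f (.anchor ra.inv) * f r * f (.anchor ra)) * f c =
      f (.node l la c ra r)
  sandwich : ∀ l la c ra r, Term.node l la c ra r ∈ G5 → 2 ≤ l.height + 1 →
    f r * f (.anchor ra) * f (.node l la c ra r) * f (.anchor la.inv) * f l =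
      f r * f (.anchor ra) * f c * f (.anchor la.inv) * f l

theorem node_mem_G5 {l c r : Term} {la ra : Anchor} (h : Term.node l la c ra r ∈ G) :
    Term.node l la c ra r ∈ G5 := by
  rcases h with h | ⟨a, h⟩
  · exact h
  · simp at h

/-- The homomorphism from `F_1^1` given by a family satisfying its relations. -/
def TermRep.lift {M : Type*} [Monoid M] {f : Term → M} (hf : TermRep f) : F11 →ₙ* M where
  toFun q := Con.liftOn q (FreeSemigroup.lift (fun g : Gen => f g.1)) (by
    intro a b hab
    have h0 : rho ≤ Con.ker (FreeSemigroup.lift (fun g : Gen => f g.1)) := by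
      refine Con.conGen_le.2 fun a b hab => ?_
      rw [Con.ker_rel]
      cases hab with
      | x_xi_x => simpa [genA] using hf.x_xi_x
      | xi_x_xi => simpa [genA] using hf.xi_x_xi
      | gxx g hg => simpa [genA, hg] using hf.gxx
      | one_mul g => simp [genA, hf.one]
      | mul_one g => simp [genA, hf.one]
      | idem g hg => simpa using hf.idem _ hg
      | left g l c r la ra hg h2 =>
        have h := hf.left l.1 la c.1 ra r.1 (node_mem_G5 (hg ▸ g.2)) (by rwa [hg] at h2)
        simpa [genA, hg] using h
      | right g l c r la ra hg h2 =>
        have h := hf.right l.1 la c.1 ra r.1 (node_mem_G5 (hg ▸ g.2)) (by rwa [hg] at h2)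
        simpa [genA, hg] using h
      | sandwich g l c r la ra hg h2 =>
        have h := hf.sandwich l.1 la c.1 ra r.1 (node_mem_G5 (hg ▸ g.2)) (by rwa [hg] at h2)
        simpa [genA, hg] using h
    exact h0 hab)
  map_mul' p q := by
    induction p, q using Con.induction_on₂ with
    | _ u v => exact map_mul (FreeSemigroup.lift (fun g : Gen => f g.1)) u v

/-! ## The letters of `G` in an arbitrary regular monoid -/

theorem Anchor.inv_inv (a : Anchor) : a.inv.inv = a := by cases a <;> rfl

theorem left_eq_right_of_mem_Ge : ∀ {i : ℕ} {g : Term}, g ∈ Ge i → g.left = g.right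
  | 0, _, h => h.elim
  | 1, g, h => by
    obtain rfl : g = MonogenicWeak.gxx := h
    rfl
  | i + 2, g, h => by
    obtain ⟨k, -, rfl | rfl⟩ := h <;> rfl

theorem left_mem_Ge : ∀ {i : ℕ} {g : Term}, g ∈ Ge (i + 1) → g.left ∈ Gi i ∨ g.left = Term.one
  | 0, g, h => by
    obtain rfl : g = MonogenicWeak.gxx := h
    exact Or.inr rfl
  | i + 1, g, h => by
    obtain ⟨k, hk, rfl | rfl⟩ := h <;> exact Or.inl (Or.inl hk)

/-- The entries of the 5-tuples of height at least two. -/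
theorem exists_node_of_mem_Gi {i : ℕ} {g : Term} (h : g ∈ Gi (i + 2)) :
    ∃ l la c ra r, g = .node l la c ra r ∧ l ∈ Gi (i + 1) ∧ (c ∈ Gi i ∨ c = Term.one) ∧
      r ∈ Gi (i + 1) ∧
      ((c, la) = (l.left, l.leftAnchor.inv) ∨ (c, la) = (l.right, l.rightAnchor.inv)) ∧
      ((c, ra) = (r.left, r.leftAnchor.inv) ∨ (c, ra) = (r.right, r.rightAnchor.inv)) := by
  rcases h with ⟨k, hk, rfl | rfl⟩ | h
  · exact ⟨_, _, _, _, _, rfl, Or.inl hk, left_mem_Ge hk, Or.inl hk, Or.inl rfl,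
      Or.inr (by rw [left_eq_right_of_mem_Ge hk])⟩
  · exact ⟨_, _, _, _, _, rfl, Or.inl hk, left_mem_Ge hk, Or.inl hk,
      Or.inr (by rw [left_eq_right_of_mem_Ge hk]), Or.inl rfl⟩
  · cases i with
    | zero => exact h.elim
    | succ i =>
      obtain ⟨l, la, c, ra, r, rfl, hl, hc, hr, -, h1, h2⟩ := h
      exact ⟨l, la, c, ra, r, rfl, hl, Or.inl hc, hr, h1, h2⟩

section

variable {K : Type*} [Monoid K]

def anchorVal (x xi : K) : Anchor → K
  | .one => 1
  | .x => x
  | .xi => xi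

/-- Values of the terms in a monoid, for an operation `inv` that selects inverses. -/
def termVal (x xi : K) (inv : K → K) : Term → K
  | .anchor a => anchorVal x xi a
  | .node l la c ra r =>
    if Term.node l la c ra r = gxx then x * xi
    else termVal x xi inv c * anchorVal x xi la.inv * termVal x xi inv l *
      inv (termVal x xi inv r * anchorVal x xi ra * termVal x xi inv c * anchorVal x xi la.inv *
        termVal x xi inv l) *
      termVal x xi inv r * anchorVal x xi ra * termVal x xi inv c

/-- The element `c a' l t r b c`, for an inverse `t` of `r b c a' l`. -/
theorem sandwich_element {c l r a a' b b' t : K} (hc : c * c = c)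
    (hl : l * (a * c * a') * l = l) (hr : r * (b * c * b') * r = r)
    (ht : t * (r * b * c * a' * l) * t = t)
    (ht' : r * b * c * a' * l * t * (r * b * c * a' * l) = r * b * c * a' * l) {g : K}
    (hg : g = c * a' * l * t * r * b * c) :
    g * g = g ∧ c * (a' * l * a) * g = g ∧ g * (b' * r * b) * c = g ∧
      r * b * g * a' * l = r * b * c * a' * l ∧
      g * (a' * l * a) * g = g ∧ g * (b' * r * b) * g = g := by
  -- The hypotheses become rewriting rules for right-associated products, and these rules reduce all
  -- six claims.
  have h1 : ∀ z, c * (c * z) = c * z := fun z => by rw [← mul_assoc, hc]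
  have h2 : ∀ z, l * (a * (c * (a' * (l * z)))) = l * z := fun z => by
    conv_rhs => rw [← hl]
    simp only [mul_assoc]
  have h3 : ∀ z, r * (b * (c * (b' * (r * z)))) = r * z := fun z => by
    conv_rhs => rw [← hr]
    simp only [mul_assoc]
  have h4 : ∀ z, t * (r * (b * (c * (a' * (l * (t * z)))))) = t * z := fun z => by
    conv_rhs => rw [← ht]
    simp only [mul_assoc]
  simp only [mul_assoc] at ht'
  subst hg
  refine ⟨?_, ?_, ?_, ?_, ?_, ?_⟩ <;> simp only [mul_assoc, h1, h2, h3, h4, ht']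

variable {x xi : K} {inv : K → K}

/-- Induction on the height. Since `c` with its anchor comes from an entry of `l`, the identities
carried for `l` give `l (a c a') l = l`, where `a` is the left anchor, and similarly for `r`. These
are the hypotheses of `sandwich_element`, whose last two conclusions keep the induction going. -/
theorem termVal_properties (h1 : x * xi * x = x) (hinv : ∀ s, inv s * s * inv s = inv s)
    (hinv' : ∀ s, s * inv s * s = s) (i : ℕ) : ∀ g ∈ Gi i,
    (termVal x xi inv g * termVal x xi inv g = termVal x xi inv g ∧
      termVal x xi inv g * (anchorVal x xi g.leftAnchor.inv * termVal x xi inv g.left *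
        anchorVal x xi g.leftAnchor) * termVal x xi inv g = termVal x xi inv g ∧
      termVal x xi inv g * (anchorVal x xi g.rightAnchor.inv * termVal x xi inv g.right *
        anchorVal x xi g.rightAnchor) * termVal x xi inv g = termVal x xi inv g) ∧
    (2 ≤ g.height → ∀ l la c ra r, g = .node l la c ra r →
      termVal x xi inv c * (anchorVal x xi la.inv * termVal x xi inv l * anchorVal x xi la) *
        termVal x xi inv g = termVal x xi inv g ∧
      termVal x xi inv g * (anchorVal x xi ra.inv * termVal x xi inv r * anchorVal x xi ra) *
        termVal x xi inv c = termVal x xi inv g ∧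
      termVal x xi inv r * anchorVal x xi ra * termVal x xi inv g * anchorVal x xi la.inv *
        termVal x xi inv l =
      termVal x xi inv r * anchorVal x xi ra * termVal x xi inv c * anchorVal x xi la.inv *
        termVal x xi inv l) := by
  induction i using Nat.strong_induction_on with
  | _ i ih =>
    intro g hg
    match i, ih, hg with
    | 0, _, hg => simp [Gi, Ge, Gd] at hg
    | 1, _, hg =>
      obtain rfl : g = gxx := hg.resolve_right fun h => h
      have hv : termVal x xi inv gxx = x * xi := if_pos rfl
      have h2 : x * xi * (x * xi) = x * xi := by rw [← mul_assoc, h1]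
      refine ⟨⟨?_, ?_, ?_⟩, fun h => absurd h (by decide)⟩
      · rw [hv, h2]
      · rw [hv]
        change x * xi * (1 * 1 * 1) * (x * xi) = _
        simp only [mul_one, h2]
      · rw [hv]
        change x * xi * (x * 1 * xi) * (x * xi) = _
        rw [mul_one, h2, h2]
    | i + 2, ih, hg =>
      have hh := height_of_mem_Gi _ _ hg
      obtain ⟨l, la, c, ra, r, rfl, hl, hc, hr, hcl, hcr⟩ := exists_node_of_mem_Gi hg
      have hv : termVal x xi inv (.node l la c ra r) = _ :=
        if_neg (fun h => by rw [h] at hh; simp [gxx, Term.height] at hh)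
      obtain ⟨hl1, hl2⟩ := (ih (i + 1) (by omega) l hl).1.2
      obtain ⟨hr1, hr2⟩ := (ih (i + 1) (by omega) r hr).1.2
      have ec : termVal x xi inv c * termVal x xi inv c = termVal x xi inv c := by
        rcases hc with hc | rfl
        · exact (ih i (by omega) c hc).1.1
        · exact one_mul _
      have key : ∀ (k : Term) (a : Anchor),
          termVal x xi inv k * (anchorVal x xi k.leftAnchor.inv * termVal x xi inv k.left *
            anchorVal x xi k.leftAnchor) * termVal x xi inv k = termVal x xi inv k →
          termVal x xi inv k * (anchorVal x xi k.rightAnchor.inv * termVal x xi inv k.right *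
            anchorVal x xi k.rightAnchor) * termVal x xi inv k = termVal x xi inv k →
          ((c, a) = (k.left, k.leftAnchor.inv) ∨ (c, a) = (k.right, k.rightAnchor.inv)) →
          termVal x xi inv k * (anchorVal x xi a * termVal x xi inv c *
            anchorVal x xi a.inv) * termVal x xi inv k = termVal x xi inv k := by
        intro k a e1 e2 h
        simp only [Prod.mk.injEq] at h
        rcases h with ⟨rfl, rfl⟩ | ⟨rfl, rfl⟩ <;> rwa [Anchor.inv_inv]
      obtain ⟨g1, g2, g3, g4, g5, g6⟩ := sandwich_element ec (key l la hl1 hl2 hcl)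
        (key r ra hr1 hr2 hcr) (hinv _) (hinv' _) hv
      refine ⟨⟨g1, g5, g6⟩, ?_⟩
      intro _ l' la' c' ra' r' h
      cases h
      exact ⟨g2, g3, g4⟩

theorem termRep_termVal (h1 : x * xi * x = x) (h2 : xi * x * xi = xi)
    (hinv : ∀ s, inv s * s * inv s = inv s) (hinv' : ∀ s, s * inv s * s = s) :
    TermRep (termVal x xi inv) where
  x_xi_x := h1
  xi_x_xi := h2
  gxx := if_pos rfl
  one := rfl
  idem g hg := by
    rcases hg with ⟨i, -, hg⟩ | rfl
    · exact (termVal_properties h1 hinv hinv' i g hg).1.1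
    · exact one_mul _
  left l la c ra r hg h := by
    obtain ⟨i, -, hg⟩ := hg
    exact ((termVal_properties h1 hinv hinv' i _ hg).2 h l la c ra r rfl).1
  right l la c ra r hg h := by
    obtain ⟨i, -, hg⟩ := hg
    exact ((termVal_properties h1 hinv hinv' i _ hg).2 h l la c ra r rfl).2.1
  sandwich l la c ra r hg h := by
    obtain ⟨i, -, hg⟩ := hg
    exact ((termVal_properties h1 hinv hinv' i _ hg).2 h l la c ra r rfl).2.2

/-- A regular monoid with two mutually inverse elements receives a homomorphism from `F_1^1`. -/
theorem exists_termRep (hreg : ∀ s : K, ∃ t, s * t * s = s) (h1 : x * xi * x = x)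
    (h2 : xi * x * xi = xi) :
    ∃ f : Term → K, TermRep f ∧ f (.anchor .x) = x ∧ f (.anchor .xi) = xi := by
  choose t ht using hreg
  -- If `s t s = s`, then `t s t` and `s` are mutually inverse.
  refine ⟨_, termRep_termVal (inv := fun s => t s * s * t s) h1 h2 ?_ ?_, rfl, rfl⟩
  · intro s
    calc t s * s * t s * s * (t s * s * t s) = t s * (s * t s * s) * (t s * s * t s) := by
          simp only [mul_assoc]
      _ = t s * s * (t s * s * t s) := by rw [ht]
      _ = t s * (s * t s * s) * t s := by simp only [mul_assoc]
      _ = t s * s * t s := by rw [ht]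
  · intro s
    calc s * (t s * s * t s) * s = s * t s * s * t s * s := by simp only [mul_assoc]
      _ = s := by rw [ht, ht]

end

/-! ## The family of the letters of `H` in `F_1` -/

theorem code_mem_G5 {l c r : Tri} (h : Tri.node l c r ∈ H) : code (.node l c r) ∈ G5 := by
  rcases code_mem_Gprime h with h | h
  · exact h
  · simp [code] at h

section

variable {M : Type*} [Monoid M] {f : Term → M}

/-- The element `δ' g δ` given by a letter of `H`. -/
def pull (f : Term → M) (h : Tri) : M :=
  f (.anchor (delta false (tau h))) * f (code h) * f (.anchor (delta (tau h) false))

namespace TermRep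

variable (hf : TermRep f)
include hf

theorem delta_self_mul (i : Bool) (z : M) : f (.anchor (delta i i)) * z = z := by
  rw [delta_self, show f (.anchor .one) = 1 from hf.one, one_mul]

theorem code_left {l c r : Tri} (h : Tri.node l c r ∈ H) :
    f (code c) * (f (.anchor (delta (tau c) (tau l))) * f (code l) *
      f (.anchor (delta (tau l) (tau c)))) * f (code (.node l c r)) = f (code (.node l c r)) := by
  have := hf.left _ _ _ _ _ (code_mem_G5 h) (by
    rw [height_code]; have := (node_height_two h).1; omega)
  rwa [delta_inv] at this

theorem code_right {l c r : Tri} (h : Tri.node l c r ∈ H) :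
    f (code (.node l c r)) * (f (.anchor (delta (tau c) (tau r))) * f (code r) *
      f (.anchor (delta (tau r) (tau c)))) * f (code c) = f (code (.node l c r)) := by
  have := hf.right _ _ _ _ _ (code_mem_G5 h) (by
    rw [height_code]; have := (node_height_two h).1; omega)
  rwa [delta_inv] at this

theorem code_sandwich {l c r : Tri} (h : Tri.node l c r ∈ H) :
    f (code r) * f (.anchor (delta (tau r) (tau c))) * f (code (.node l c r)) *
      f (.anchor (delta (tau c) (tau l))) * f (code l) =
    f (code r) * f (.anchor (delta (tau r) (tau c))) * f (code c) *
      f (.anchor (delta (tau c) (tau l))) * f (code l) := by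
  have := hf.sandwich _ _ _ _ _ (code_mem_G5 h) (by
    rw [height_code]; have := (node_height_two h).1; omega)
  rwa [delta_inv] at this

/-- A tuple of type `true` absorbs its middle entry on the left, and the chain of middle entries
ends at `g_{xx'} = x x'`. -/
theorem x_xi_mul_code {h : Tri} (hh : h ∈ H) (ht : tau h = true) :
    f (.anchor .x) * (f (.anchor .xi) * f (code h)) = f (code h) := by
  induction h with
  | one => simp [tau] at ht
  | e => simp [tau] at ht
  | f =>
    change _ * (_ * f MonogenicWeak.gxx) = f MonogenicWeak.gxx
    rw [hf.gxx, ← mul_assoc, ← mul_assoc, hf.x_xi_x]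
  | node l c r _ ih _ =>
    rw [← hf.code_left hh]
    have := ih (node_mem_H.1 hh).1.1 ht
    simp only [← mul_assoc] at this ⊢
    rw [this]

/-- Only the case of two types `true` is not formal: there the anchors `x x'` between the letters
must vanish, and the right-hand letter absorbs them. -/
theorem junction {g h : Tri} (hh : h ∈ H) (z : M) :
    f (code g) * (f (.anchor (delta (tau g) false)) * (f (.anchor (delta false (tau h))) *
      (f (code h) * z))) =
    f (code g) * (f (.anchor (delta (tau g) (tau h))) * (f (code h) * z)) := by
  have h1 : ∀ z, f (.anchor .one) * z = z := fun z => by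
    rw [show f (.anchor .one) = 1 from hf.one, one_mul]
  cases hg : tau g <;> cases ht : tau h <;> simp only [delta, h1]
  rw [← mul_assoc (f (.anchor .xi)), ← mul_assoc (f (.anchor .x)), hf.x_xi_mul_code hh ht]

/-- The inner anchors of a product merge by `junction` into those of the relations of `F_1^1`. The
outer anchors are the same on both sides. -/
theorem iRep_pull : IRep (pull f) where
  one := by
    change f Term.one * f Term.one * f Term.one = 1
    rw [hf.one, one_mul, one_mul]
  idem h hh := by
    simp only [pull, mul_assoc]
    rw [hf.junction hh, hf.delta_self_mul, ← mul_assoc (f (code h)) (f (code h)),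
      hf.idem _ (code_mem_Gprime hh)]
  left l c r hh := by
    obtain ⟨h1, h2, -⟩ := node_mem_H.1 hh
    have e := congrArg (fun z => f (.anchor (delta false (tau c))) * (z *
      f (.anchor (delta (tau c) false)))) (hf.code_left hh)
    simp only [mul_assoc] at e
    simp only [pull, mul_assoc]
    rw [hf.junction h1.2.1, hf.junction hh, tau_node]
    exact e
  right l c r hh := by
    obtain ⟨h1, h2, -⟩ := node_mem_H.1 hh
    have e := congrArg (fun z => f (.anchor (delta false (tau c))) * (z *
      f (.anchor (delta (tau c) false)))) (hf.code_right hh)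
    simp only [mul_assoc] at e
    simp only [pull, mul_assoc]
    rw [hf.junction h2.2.1, hf.junction h2.1, tau_node]
    exact e
  sandwich l c r hh := by
    obtain ⟨h1, h2, -⟩ := node_mem_H.1 hh
    have ec := hf.idem _ (code_mem_Gprime h1.1)
    have e1 : f (code c) * f (code (.node l c r)) = f (code (.node l c r)) := by
      rw [← hf.code_left hh]
      simp only [← mul_assoc, ec]
    have e2 : ∀ z, f (code (.node l c r)) * (f (code c) * z) = f (code (.node l c r)) * z := by
      intro z
      rw [← hf.code_right hh]
      simp only [mul_assoc]
      rw [← mul_assoc (f (code c)) (f (code c)), ec]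
    have e := congrArg (fun z => f (.anchor (delta false (tau r))) * (z *
      f (.anchor (delta (tau l) false)))) (hf.code_sandwich hh)
    simp only [mul_assoc] at e
    simp only [pull, mul_assoc]
    rw [hf.junction h1.2.1, hf.junction h1.1, hf.junction hh, hf.junction h1.1]
    simp only [tau_node, hf.delta_self_mul]
    rw [← mul_assoc (f (code c)) (f (code (.node l c r))), e1, e2, e, hf.junction h1.1]

/-- The value of an i-landscape and that of its relabelling. -/
theorem ev_pull {g : Tri} {t : List Tri} (hu : IsILandscape ⟨g, t⟩) :
    ev (pull f) (g :: t) = f (.anchor (delta false (tau g))) * (f (code g) *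
      (((codeSteps g t).map fun p => f (.anchor p.1) * f p.2).prod *
        f (.anchor (delta (tau (t.getLastD g)) false)))) := by
  induction t generalizing g with
  | nil => simp [ev, codeSteps, pull, mul_assoc]
  | cons k t ih =>
    rw [isILandscape_cons] at hu
    rw [ev_cons, ih hu.2, pull, List.getLastD_cons, codeSteps, List.map_cons, List.prod_cons]
    simp only [mul_assoc]
    rw [hf.junction hu.2.head_mem]

end TermRep

end

/-! ## The automorphism of `F_2^1` that exchanges `e` and `f` -/

def swapTri : Tri → Tri
  | .one => .one
  | .e => .f
  | .f => .e
  | .node l c r => .node (swapTri l) (swapTri c) (swapTri r)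

theorem swapTri_swapTri (h : Tri) : swapTri (swapTri h) = h := by
  induction h with
  | node l c r h1 h2 h3 => simp [swapTri, h1, h2, h3]
  | _ => rfl

theorem iBelow_swapTri {g k : Tri} (h : IBelow g k) : IBelow (swapTri g) (swapTri k) := by
  cases k with
  | one => exact h.elim
  | e => rw [show g = .one from h]; exact rfl
  | f => rw [show g = .one from h]; exact rfl
  | node l c r => exact h.imp (congrArg _) (congrArg _)

theorem swapTri_mem_H {h : Tri} (hh : h ∈ H) : swapTri h ∈ H := by
  induction h with
  | one => exact one_mem_H
  | e => exact f_mem_H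
  | f => exact e_mem_H
  | node l c r h1 h2 h3 =>
    obtain ⟨hl, hr, hne⟩ := node_mem_H.1 hh
    exact node_mem_H.2 ⟨⟨h2 hl.1, h1 hl.2.1, iBelow_swapTri hl.2.2⟩,
      ⟨h2 hl.1, h3 hr.2.1, iBelow_swapTri hr.2.2⟩, fun h => hne (by
        rw [← swapTri_swapTri l, h, swapTri_swapTri])⟩

section

attribute [local instance] monoidF21

theorem iRep_swap : IRep fun t => letter (swapTri t) where
  one := iRep_letter.one
  idem _ hh := iRep_letter.idem _ (swapTri_mem_H hh)
  left _ _ _ hh := iRep_letter.left _ _ _ (swapTri_mem_H hh)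
  right _ _ _ hh := iRep_letter.right _ _ _ (swapTri_mem_H hh)
  sandwich _ _ _ hh := iRep_letter.sandwich _ _ _ (swapTri_mem_H hh)

/-- The powers of the automorphism. -/
noncomputable def swapPow : Bool → F21 → F21
  | true, q => iRep_swap.lift q
  | false, q => q

theorem swapPow_mul (i : Bool) (p q : F21) : swapPow i (p * q) = swapPow i p * swapPow i q := by
  cases i
  · rfl
  · exact map_mul iRep_swap.lift p q

theorem swapPow_letter {t : Tri} (ht : t ∈ H) : swapPow true (letter t) = letter (swapTri t) :=
  iRep_swap.lift_letter ht

theorem swapPow_one (i : Bool) : swapPow i 1 = 1 := by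
  cases i
  · rfl
  · rw [← iRep_letter.one, swapPow_letter one_mem_H, swapTri]

theorem swapPow_swapPow (i j : Bool) (q : F21) : swapPow i (swapPow j q) = swapPow (i ^^ j) q := by
  cases i <;> cases j <;> try rfl
  induction q using F21_induction with
  | hl t ht =>
    rw [swapPow_letter ht, swapPow_letter (swapTri_mem_H ht), swapTri_swapTri]
    rfl
  | hm t ht b ih =>
    rw [swapPow_mul, swapPow_mul, ih, swapPow_letter ht, swapPow_letter (swapTri_mem_H ht),
      swapTri_swapTri]
    rfl

/-- The semidirect product of `F_2^1` and the group of order two. -/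
@[ext]
structure Twist where
  fst : F21
  snd : Bool

noncomputable instance : Monoid Twist where
  mul p q := ⟨p.fst * swapPow p.snd q.fst, p.snd ^^ q.snd⟩
  one := ⟨1, false⟩
  mul_assoc p q r := by
    apply Twist.ext
    · change p.fst * swapPow p.snd q.fst * swapPow (p.snd ^^ q.snd) r.fst =
        p.fst * swapPow p.snd (q.fst * swapPow q.snd r.fst)
      rw [swapPow_mul, swapPow_swapPow, mul_assoc]
    · exact Bool.xor_assoc _ _ _
  one_mul p := by
    apply Twist.ext
    · exact one_mul p.fst
    · exact Bool.false_xor _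
  mul_one p := by
    apply Twist.ext
    · change p.fst * swapPow p.snd 1 = p.fst
      rw [swapPow_one, mul_one]
    · exact Bool.xor_false _

theorem Twist.mk_mul (a b : F21) (i j : Bool) :
    (⟨a, i⟩ : Twist) * ⟨b, j⟩ = ⟨a * swapPow i b, i ^^ j⟩ := rfl

theorem Twist.mk_false_mul (a b : F21) : (⟨a, false⟩ : Twist) * ⟨b, false⟩ = ⟨a * b, false⟩ := rfl

/-- An inverse in `F_2^1` is twisted by the power of the swap carried by the element. -/
theorem Twist.regular (s : Twist) : ∃ t, s * t * s = s := by
  obtain ⟨a, i⟩ := s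
  obtain ⟨b, hb⟩ := F21_regular a
  refine ⟨⟨swapPow i b, i⟩, ?_⟩
  rw [mk_mul, mk_mul, swapPow_swapPow, Bool.xor_self, Bool.false_xor]
  change (⟨a * b * a, i⟩ : Twist) = _
  rw [hb]

/-- The values of the letters of `H` under any choice of the values of the letters of `G`. -/
theorem pull_eq_letter {f : Term → Twist} (hf : TermRep f)
    (hx : f (.anchor .x) = ⟨letter .e, true⟩) (hxi : f (.anchor .xi) = ⟨letter .f, true⟩)
    {h : Tri} (hh : h ∈ H) : pull f h = ⟨letter h, false⟩ := by
  have h1 : f (.anchor .one) = 1 := hf.one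
  have he := iRep_letter.idem .e e_mem_H
  have hF := iRep_letter.idem .f f_mem_H
  have hg : f gxx = ⟨letter .e, false⟩ := by
    rw [hf.gxx, hx, hxi, Twist.mk_mul, swapPow_letter f_mem_H, swapTri, he]
    rfl
  induction h with
  | one => rw [hf.iRep_pull.one, iRep_letter.one]; rfl
  | e =>
    change f (.anchor .one) * f gxx * f (.anchor .one) = _
    rw [h1, one_mul, mul_one, hg]
  | f =>
    change f (.anchor .xi) * f gxx * f (.anchor .x) = _
    rw [hx, hxi, hg, Twist.mk_mul, Twist.mk_mul, swapPow_letter e_mem_H, swapTri, hF]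
    change (⟨letter .f * swapPow true (letter .e), false⟩ : Twist) = _
    rw [swapPow_letter e_mem_H, swapTri, hF]
  | node l c r ihl ihc ihr =>
    obtain ⟨hl, hr, -⟩ := node_mem_H.1 hh
    have hp := hf.iRep_pull
    have e0 := hp.idem _ hh
    have e1 := hp.left _ _ _ hh
    have e2 := hp.right _ _ _ hh
    have e3 := hp.sandwich _ _ _ hh
    generalize pull f (.node l c r) = y at e0 e1 e2 e3 ⊢
    obtain ⟨t, i⟩ := y
    -- An idempotent has trivial component in the group of order two.
    have hi : i = false := by
      have := congrArg Twist.snd e0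
      change (i ^^ i) = i at this
      rw [← this, Bool.xor_self]
    subst hi
    rw [ihc hl.1, ihl hl.2.1, Twist.mk_false_mul, Twist.mk_false_mul] at e1
    rw [ihc hl.1, ihr hr.2.1, Twist.mk_false_mul, Twist.mk_false_mul] at e2
    rw [ihc hl.1, ihl hl.2.1, ihr hr.2.1] at e3
    simp only [Twist.mk_false_mul] at e3
    rw [eq_node hh (congrArg Twist.fst e1) (congrArg Twist.fst e2) (congrArg Twist.fst e3)]

/-- `F_2^1` is the only submonoid that is regular and contains `e` and `f`. -/
theorem mem_of_regular {V : Set F21} (h1 : (1 : F21) ∈ V) (hmul : ∀ p ∈ V, ∀ q ∈ V, p * q ∈ V)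
    (hreg : ∀ p ∈ V, ∃ q ∈ V, p * q * p = p) (he : letter .e ∈ V) (hF : letter .f ∈ V) (q : F21) :
    q ∈ V := by
  have hf := iRep_letter
  have hlet : ∀ h ∈ H, letter h ∈ V := by
    intro h hh
    induction h with
    | one => rwa [hf.one]
    | e => exact he
    | f => exact hF
    | node l c r ihl ihc ihr =>
      obtain ⟨hl, hr, -⟩ := node_mem_H.1 hh
      have vl := ihl hl.2.1
      have vc := ihc hl.1
      have vr := ihr hr.2.1
      -- With `t` chosen for `r c l`, the element `c l t r c` of `V` satisfies the three relations
      -- of the triple, so it is that letter by rigidity.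
      obtain ⟨t, ht, hs⟩ := hreg _ (hmul _ (hmul _ vr _ vc) _ vl)
      have e1 : ∀ z, letter l * (letter c * (letter l * z)) = letter l * z := fun z => by
        conv_rhs => rw [← hf.below_mul hl]
        simp only [mul_assoc]
      have e2 : letter r * (letter c * letter r) = letter r := by
        rw [← mul_assoc, hf.below_mul hr]
      have e2' : ∀ z, letter r * (letter c * (letter r * z)) = letter r * z := fun z => by
        conv_rhs => rw [← hf.below_mul hr]
        simp only [mul_assoc]
      have e3 : ∀ z, letter c * (letter c * z) = letter c * z := fun z => by
        rw [← mul_assoc, hf.idem c hl.1]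
      rw [← eq_node hh (t := letter c * letter l * t * letter r * letter c)]
      · exact hmul _ (hmul _ (hmul _ (hmul _ vc _ vl) _ ht) _ vr) _ vc
      · simp only [mul_assoc, e1]
      · simp only [mul_assoc, e2']
      · simp only [mul_assoc, e3] at hs ⊢
        exact hs
  induction q using F21_induction with
  | hl t ht => exact hlet t ht
  | hm t ht b hb => exact hmul _ (hlet t ht) _ hb

end

/-! ## The embedding of `F_2^1` into `F_1^1` -/

theorem toGen_of_mem {t : Term} (h : t ∈ G) : toGen t = ⟨t, h⟩ := by
  rw [toGen, dif_pos h]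

theorem toGen_anchor (a : Anchor) : toGen (.anchor a) = genA a :=
  toGen_of_mem (Or.inr ⟨a, rfl⟩)

/-- A letter as an element of `F_1^1`. -/
noncomputable def termCls (t : Term) : F11 := cls (w (toGen t))

theorem cls_eq_of_rel {u v : FreeSemigroup Gen} (h : Rel u v) : cls u = cls v :=
  (Con.eq rho).2 (ConGen.Rel.of _ _ h)

theorem cls_one_mul (q : F11) : cls (wA .one) * q = q := by
  induction q using Con.induction_on with
  | H u =>
    induction u using FreeSemigroup.recOnMul with
    | ih1 g => exact cls_eq_of_rel (.one_mul g)
    | ih2 g u h1 h2 =>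
      change cls _ * (cls _ * cls u) = cls _ * cls u
      rw [← mul_assoc]
      exact congrArg (· * cls u) h1

theorem cls_mul_one (q : F11) : q * cls (wA .one) = q := by
  induction q using Con.induction_on with
  | H u =>
    induction u using FreeSemigroup.recOnMul with
    | ih1 g => exact cls_eq_of_rel (.mul_one g)
    | ih2 g u h1 h2 =>
      change cls (w g) * cls u * cls _ = cls (w g) * cls u
      rw [mul_assoc]
      exact congrArg (cls (w g) * ·) h2

/-- The monoid structure of `F_1^1`. -/
@[reducible] def monoidF11 : Monoid F11 where
  __ := (inferInstance : Mul F11)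
  mul_assoc := mul_assoc
  one := cls (wA .one)
  one_mul := cls_one_mul
  mul_one := cls_mul_one

theorem entries_mem_G {l c r : Term} {la ra : Anchor} (h : Term.node l la c ra r ∈ G5)
    (h2 : 2 ≤ l.height + 1) : l ∈ G ∧ c ∈ G ∧ r ∈ G := by
  obtain ⟨i, hi, h⟩ := h
  have hh := height_of_mem_Gi _ _ h
  obtain ⟨j, rfl⟩ : ∃ j, i = j + 2 := ⟨i - 2, by simp only [Term.height] at hh; omega⟩
  obtain ⟨l', la', c', ra', r', he, hl, hc, hr, -⟩ := exists_node_of_mem_Gi h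
  cases he
  refine ⟨Or.inl ⟨_, by omega, hl⟩, ?_, Or.inl ⟨_, by omega, hr⟩⟩
  rcases hc with hc | rfl
  · rcases Nat.eq_zero_or_pos j with rfl | hj
    · simp [Gi, Ge, Gd] at hc
    · exact Or.inl ⟨j, hj, hc⟩
  · exact Or.inr ⟨_, rfl⟩

section

attribute [local instance] monoidF21 monoidF11

theorem termRep_termCls : TermRep termCls where
  x_xi_x := by
    simp only [termCls, toGen_anchor]
    exact cls_eq_of_rel .x_xi_x
  xi_x_xi := by
    simp only [termCls, toGen_anchor]
    exact cls_eq_of_rel .xi_x_xi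
  gxx := by
    have h : gxx ∈ G := Or.inl ⟨1, le_rfl, Or.inl rfl⟩
    simp only [termCls, toGen_anchor, toGen_of_mem h]
    exact cls_eq_of_rel (.gxx _ rfl)
  one := by
    simp only [termCls, toGen_anchor]
    rfl
  idem g hg := by
    have h : g ∈ G := by
      rcases hg with hg | rfl
      · exact Or.inl hg
      · exact Or.inr ⟨_, rfl⟩
    simp only [termCls, toGen_of_mem h]
    exact cls_eq_of_rel (.idem _ hg)
  left l la c ra r h h2 := by
    obtain ⟨hl, hc, hr⟩ := entries_mem_G h h2
    have hg : Term.node l la c ra r ∈ G := Or.inl h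
    simp only [termCls, toGen_anchor, toGen_of_mem hl, toGen_of_mem hc, toGen_of_mem hg]
    exact cls_eq_of_rel (.left ⟨_, hg⟩ ⟨l, hl⟩ ⟨c, hc⟩ ⟨r, hr⟩ la ra rfl h2)
  right l la c ra r h h2 := by
    obtain ⟨hl, hc, hr⟩ := entries_mem_G h h2
    have hg : Term.node l la c ra r ∈ G := Or.inl h
    simp only [termCls, toGen_anchor, toGen_of_mem hr, toGen_of_mem hc, toGen_of_mem hg]
    exact cls_eq_of_rel (.right ⟨_, hg⟩ ⟨l, hl⟩ ⟨c, hc⟩ ⟨r, hr⟩ la ra rfl h2)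
  sandwich l la c ra r h h2 := by
    obtain ⟨hl, hc, hr⟩ := entries_mem_G h h2
    have hg : Term.node l la c ra r ∈ G := Or.inl h
    simp only [termCls, toGen_anchor, toGen_of_mem hr, toGen_of_mem hc, toGen_of_mem hl,
      toGen_of_mem hg]
    exact cls_eq_of_rel (.sandwich ⟨_, hg⟩ ⟨l, hl⟩ ⟨c, hc⟩ ⟨r, hr⟩ la ra rfl h2)

theorem TermRep.lift_termCls {M : Type*} [Monoid M] {f : Term → M} (hf : TermRep f) {t : Term}
    (ht : t ∈ G) : hf.lift (termCls t) = f t := by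
  rw [termCls, toGen_of_mem ht]
  rfl

/-- The embedding of `F_2^1` into `F_1^1`. -/
noncomputable def embed : F21 →ₙ* F11 := termRep_termCls.iRep_pull.lift

theorem embed_letter {h : Tri} (hh : h ∈ H) : embed (letter h) = pull termCls h :=
  termRep_termCls.iRep_pull.lift_letter hh

theorem code_mem_G {h : Tri} (hh : h ∈ H) : code h ∈ G := by
  rcases code_mem_Gprime hh with h | h
  · exact Or.inl h
  · exact Or.inr ⟨.one, h.symm⟩

/-- The homomorphism from `F_1^1` to the semidirect product is a left inverse of `embed`, up to the
inclusion of `F_2^1`. By `pull_eq_letter` this holds for any choice of inverses made in the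
construction. -/
theorem embed_injective : Function.Injective embed := by
  have he := iRep_letter.idem .e e_mem_H
  have hF := iRep_letter.idem .f f_mem_H
  have sE : swapPow true (letter .e) = letter .f := swapPow_letter e_mem_H
  have sF : swapPow true (letter .f) = letter .e := swapPow_letter f_mem_H
  obtain ⟨f, hf, hx, hxi⟩ := exists_termRep (x := (⟨letter .e, true⟩ : Twist))
    (xi := ⟨letter .f, true⟩) Twist.regular
    (by
      rw [Twist.mk_mul, Twist.mk_mul, sF, he]
      change (⟨letter .e * letter .e, true⟩ : Twist) = _
      rw [he])
    (by
      rw [Twist.mk_mul, Twist.mk_mul, sE, hF]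
      change (⟨letter .f * letter .f, true⟩ : Twist) = _
      rw [hF])
  have hl : ∀ h ∈ H, hf.lift (embed (letter h)) = ⟨letter h, false⟩ := fun h hh => by
    rw [embed_letter hh, ← pull_eq_letter hf hx hxi hh, pull, map_mul, map_mul,
      hf.lift_termCls (code_mem_G hh), hf.lift_termCls (Or.inr ⟨_, rfl⟩),
      hf.lift_termCls (Or.inr ⟨_, rfl⟩)]
    rfl
  have key : ∀ q, hf.lift (embed q) = ⟨q, false⟩ := fun q => by
    induction q using F21_induction with
    | hl t ht => exact hl t ht
    | hm t ht b ih => rw [map_mul, map_mul, ih, hl t ht, Twist.mk_false_mul]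
  intro p q h
  have := key p
  rw [h, key q] at this
  exact (congrArg Twist.fst this).symm

theorem embed_one : embed 1 = 1 := by
  rw [← iRep_letter.one, embed_letter one_mem_H, termRep_termCls.iRep_pull.one]

theorem cls_word (u : AltWord) :
    cls u.word = termCls u.start *
      (u.steps.map fun p => termCls (.anchor p.1) * termCls p.2).prod := by
  have h0 : ∀ (g : Gen) (l : List Gen), cls ⟨g, l⟩ = cls (w g) * (l.map fun k => cls (w k)).prod := by
    intro g l
    induction l generalizing g with
    | nil => rw [List.map_nil, List.prod_nil, mul_one]; rfl
    | cons k l ih =>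
      rw [List.map_cons, List.prod_cons, ← ih]
      rfl
  rw [AltWord.word, h0]
  have h1 : ∀ l : List (Anchor × Term),
      ((l.flatMap fun p => [genA p.1, toGen p.2]).map fun k => cls (w k)).prod =
      (l.map fun p => termCls (.anchor p.1) * termCls p.2).prod := by
    intro l
    induction l with
    | nil => rfl
    | cons p l ih =>
      rw [List.flatMap_cons, List.map_append, List.prod_append, ih, List.map_cons, List.prod_cons]
      simp [termCls, toGen_anchor]
  rw [h1]
  rfl

/-- The anchors contributed by consecutive letters merge into the anchors of the relabelled word,
and those at the two ends are trivial because the word begins and ends with `1`. -/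
theorem embed_clsI {p : IWord} (hp : p ∈ MRi) :
    embed (clsI (IWord.word p)) = cls (codeWord p).word := by
  obtain ⟨g, t⟩ := p
  obtain ⟨h1, h2, h3, -⟩ := hp
  obtain rfl : g = .one := h2
  have h3' : t.getLastD .one = .one := h3
  rw [clsI_word, embed, IRep.lift_ev _ h1.1]
  change ev _ (.one :: t) = _
  rw [termRep_termCls.ev_pull h1, cls_word, h3', show tau .one = false from rfl,
    termRep_termCls.delta_self_mul, delta_self,
    show termCls (.anchor .one) = 1 from termRep_termCls.one, mul_one]
  rfl

/-- The normal form of the identity is the trivial word, and i-mountains are nontrivial by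
definition. -/
theorem clsI_mem_F2 {p : IWord} (hp : p ∈ Mi) : clsI (IWord.word p) ∈ F2 := by
  intro h
  obtain ⟨g, t⟩ := p
  obtain ⟨⟨h1, h2, h3, h4⟩, h5⟩ := hp
  obtain rfl : g = .one := h2
  rw [clsI_word, ← F21_one, ← iRep_letter.one] at h
  refine h4 (eq_of_ev_eq (b := []) h1 (isILandscape_nil.2 one_mem_H) h3 rfl h5 ?_ ?_)
  · intro i hi
    cases hi
  · rw [ev_cons _ [], ev_nil, mul_one]
    exact h

theorem exists_mountain {q : F21} (hq : q ∈ F2) : ∃ p ∈ Mi, q = clsI (IWord.word p) := by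
  obtain ⟨a, h1, h2, rfl⟩ := exists_landscape q
  have hp : (⟨.one, a⟩ : IWord) ∈ MRi := by
    refine ⟨h1, rfl, h2, ?_⟩
    rintro rfl
    refine hq ?_
    rw [ev_cons, ev_nil, mul_one, iRep_letter.one]
    rfl
  obtain ⟨v, hv⟩ := exists_isIReduct h1
  refine ⟨v, hv.mem_Mi hp, ?_⟩
  rw [← hv.clsI_eq h1, clsI_word]
  rfl

theorem embed_mem_F1 (q : F2) : embed q ∈ F1 := fun h =>
  q.2 (embed_injective (h.trans embed_one.symm))

/-- The embedding of `F_2` into `F_1`. -/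
noncomputable def embedF : F2 →ₙ* F1 where
  toFun q := ⟨embed q, embed_mem_F1 q⟩
  map_mul' p q := Subtype.ext (map_mul embed p.1 q.1)

theorem embedF_injective : Function.Injective embedF := fun _ _ h =>
  Subtype.ext (embed_injective (congrArg Subtype.val h))

theorem termCls_one_mul (z : F11) : termCls (.anchor .one) * z = z := by
  rw [show termCls (.anchor .one) = 1 from termRep_termCls.one, one_mul]

theorem xF_val : (xF : F11) = termCls (.anchor .x) := by rw [termCls, toGen_anchor]; rfl

theorem xiF_val : (xiF : F11) = termCls (.anchor .xi) := by rw [termCls, toGen_anchor]; rfl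

theorem eF_val : (eF : F21) = letter .e := by rw [letter, toHGen_of_mem e_mem_H]; rfl

theorem fF_val : (fF : F21) = letter .f := by rw [letter, toHGen_of_mem f_mem_H]; rfl

theorem embedF_eF : embedF eF = xF * xiF := by
  apply Subtype.ext
  change embed eF = xF.1 * xiF.1
  rw [eF_val, embed_letter e_mem_H, xF_val, xiF_val, ← termRep_termCls.gxx]
  change termCls (.anchor .one) * termCls gxx * termCls (.anchor .one) = _
  rw [termCls_one_mul, show termCls (.anchor .one) = 1 from termRep_termCls.one, mul_one]

theorem embedF_fF : embedF fF = xiF * xF := by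
  apply Subtype.ext
  change embed fF = xiF.1 * xF.1
  rw [fF_val, embed_letter f_mem_H, xF_val, xiF_val]
  change termCls (.anchor .xi) * termCls gxx * termCls (.anchor .x) = _
  rw [termRep_termCls.gxx, ← mul_assoc, termRep_termCls.xi_x_xi]

theorem eF_idem : eF * eF = eF := by
  apply Subtype.ext
  change eF.1 * eF.1 = eF.1
  rw [eF_val, iRep_letter.idem _ e_mem_H]

theorem fF_idem : fF * fF = fF := by
  apply Subtype.ext
  change fF.1 * fF.1 = fF.1
  rw [fF_val, iRep_letter.idem _ f_mem_H]

theorem F2_regular (q : F2) : ∃ q' : F2, q * q' * q = q := by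
  obtain ⟨q, hq⟩ := q
  obtain ⟨t, ht⟩ := F21_regular q
  have ht' : q * (t * q * t) * q = q := by
    calc q * (t * q * t) * q = q * t * q * t * q := by simp only [mul_assoc]
      _ = q := by rw [ht, ht]
  -- The factor `t` may be the identity, but `t q t` always lies in `F_2`.
  refine ⟨⟨t * q * t, ?_⟩, Subtype.ext ht'⟩
  by_cases h1 : t = 1
  · rwa [h1, one_mul, mul_one]
  · exact F2.mul_mem (F2.mul_mem h1 hq) h1

end

/-! ### The subsemigroup of `F_1` and its weak generation -/

theorem embedF_val (q : F2) : ((embedF q : F1) : F11) = embed q := rfl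

/-- The subsemigroup `F_2°` of `F_1`. -/
noncomputable def F2circ : Subsemigroup F1 := embedF.srange

theorem mem_F2circ {s : F1} : s ∈ F2circ ↔ ∃ q, embedF q = s := MulHom.mem_srange

/-- The isomorphism from `F_2` onto `F_2°`. -/
noncomputable def isoF2 : F2 ≃* F2circ :=
  MulEquiv.ofBijective embedF.srangeRestrict
    ⟨fun _ _ h => embedF_injective (congrArg Subtype.val h), embedF.srangeRestrict_surjective⟩

theorem isoF2_val (q : F2) : ((isoF2 q : F2circ) : F1) = embedF q := rfl

theorem bijOn_cls : Set.BijOn (fun u : AltWord => cls u.word) Mcirc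
    (Subtype.val '' (F2circ : Set F1)) := by
  refine ⟨?_, ?_, ?_⟩
  · intro u hu
    obtain ⟨p, hp, rfl⟩ := exists_codeWord_eq_of_mem_Mcirc hu
    exact ⟨embedF ⟨_, clsI_mem_F2 hp⟩, mem_F2circ.2 ⟨_, rfl⟩, embed_clsI hp.1⟩
  · intro u hu v hv h
    obtain ⟨p, hp, rfl⟩ := exists_codeWord_eq_of_mem_Mcirc hu
    obtain ⟨q, hq, rfl⟩ := exists_codeWord_eq_of_mem_Mcirc hv
    simp only [← embed_clsI hp.1, ← embed_clsI hq.1] at h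
    rw [eq_of_clsI_eq hp hq (embed_injective h)]
  · rintro _ ⟨s, hs, rfl⟩
    obtain ⟨q, rfl⟩ := mem_F2circ.1 hs
    obtain ⟨p, hp, h⟩ := exists_mountain q.2
    refine ⟨codeWord p, codeWord_mem_Mcirc hp, ?_⟩
    simp only [← embed_clsI hp.1, ← h, embedF_val]

theorem cls_odot {u v : AltWord} (hu : u ∈ Mcirc) (hv : v ∈ Mcirc) :
    cls (odot u v).word = cls u.word * cls v.word := by
  obtain ⟨p, hp, rfl⟩ := exists_codeWord_eq_of_mem_Mcirc hu
  obtain ⟨q, hq, rfl⟩ := exists_codeWord_eq_of_mem_Mcirc hv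
  rw [odot_codeWord hp.1 hq.1, ← embed_clsI (iodot_mem_Mi hp.1 hq.1).1, clsI_iodot hp.1 hq.1,
    map_mul, embed_clsI hp.1, embed_clsI hq.1]

theorem regular_F2circ : IsRegularSubsemigroup F2circ := by
  intro s hs
  obtain ⟨q, rfl⟩ := mem_F2circ.1 hs
  obtain ⟨t, ht⟩ := F2_regular q
  exact ⟨embedF t, mem_F2circ.2 ⟨t, rfl⟩, by rw [← map_mul, ← map_mul, ht]⟩

theorem weaklyGenerated_F2circ : IsWeaklyGeneratedBy F2circ {xF * xiF, xiF * xF} := by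
  refine ⟨regular_F2circ, ?_, fun U hU hreg hX => le_antisymm hU fun s hs => ?_⟩
  · rintro _ (rfl | rfl)
    · exact mem_F2circ.2 ⟨_, embedF_eF⟩
    · exact mem_F2circ.2 ⟨_, embedF_fF⟩
  · let := monoidF21
    obtain ⟨q, rfl⟩ := mem_F2circ.1 hs
    -- The preimage of `U` is enlarged by the identity, since `mem_of_regular` is stated for
    -- submonoids of `F_2^1`. Regularity passes to the preimage because `U` lies in the image of an
    -- injective homomorphism.
    have key := mem_of_regular (V := {q | q = 1 ∨ ∃ h : q ∈ F2, embedF ⟨q, h⟩ ∈ U}) (Or.inl rfl)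
      (by
        rintro p (rfl | ⟨hp, hpU⟩) q (rfl | ⟨hq, hqU⟩)
        · exact Or.inl (one_mul _)
        · exact Or.inr ⟨by rwa [one_mul], by simpa only [one_mul] using hqU⟩
        · exact Or.inr ⟨by rwa [mul_one], by simpa only [mul_one] using hpU⟩
        · exact Or.inr ⟨F2.mul_mem hp hq, by
            have := U.mul_mem hpU hqU
            rwa [← map_mul] at this⟩)
      (by
        rintro p (rfl | ⟨hp, hpU⟩)
        · exact ⟨1, Or.inl rfl, by rw [one_mul, one_mul]⟩
        · obtain ⟨t, htU, ht⟩ := hreg _ hpU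
          obtain ⟨⟨t, ht2⟩, rfl⟩ := mem_F2circ.1 (hU htU)
          rw [← map_mul, ← map_mul] at ht
          exact ⟨t, Or.inr ⟨ht2, htU⟩, congrArg Subtype.val (embedF_injective ht)⟩)
      (Or.inr ⟨eF_val ▸ eF.2, by
        have h : (⟨letter .e, eF_val ▸ eF.2⟩ : F2) = eF := Subtype.ext eF_val.symm
        rw [h, embedF_eF]
        exact hX (Or.inl rfl)⟩)
      (Or.inr ⟨fF_val ▸ fF.2, by
        have h : (⟨letter .f, fF_val ▸ fF.2⟩ : F2) = fF := Subtype.ext fF_val.symm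
        rw [h, embedF_fF]
        exact hX (Or.inr rfl)⟩) q.1
    rcases key with h | ⟨_, h⟩
    · exact (q.2 h).elim
    · exact h

theorem isoF2_symm {u : AltWord} (hu : u ∈ Mcirc) {s : F2circ}
    (h : ((s : F1) : F11) = cls u.word) :
    ((isoF2.symm s : F2) : F21) = clsI (IWord.word (phibar u)) := by
  obtain ⟨p, hp, rfl⟩ := exists_codeWord_eq_of_mem_Mcirc hu
  obtain ⟨q, rfl⟩ := isoF2.surjective s
  rw [isoF2_val, embedF_val, ← embed_clsI hp.1] at h
  rw [MulEquiv.symm_apply_apply, phibar_codeWord_of_mem hp.1, embed_injective h]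

end MonogenicWeak

theorem corollaryc66 :
    -- relabelling is a bijection from `MR°` onto the i-mountain ranges, with inverse `ψ̄`
    Set.BijOn phibar MRcirc MRi ∧
    Set.BijOn psibar MRi MRcirc ∧
    Set.InvOn psibar phibar MRcirc MRi ∧
    -- it commutes with uplifting of rivers, and `MR°` is closed for uplifting of rivers
    (∀ (i : ℕ) (u v : AltWord), u ∈ MRcirc →
      UpliftAt i u v →
      v ∈ MRcirc ∧
        IUpliftAt i (phibar u) (phibar v)) ∧
    -- the products of `M°` and of the i-mountains are well defined, and the relabelling is an
    -- isomorphism from `M°` onto the i-mountains, with inverse `ψ̄`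
    Set.BijOn phibar Mcirc Mi ∧
    Set.BijOn psibar Mi Mcirc ∧
    (∀ u ∈ Mcirc, ∀ v ∈ Mcirc,
      (∃! w, IsReduct (u.join v) w) ∧
      odot u v ∈ Mcirc ∧
      phibar (odot u v) =
        iodot (phibar u) (phibar v)) ∧
    (∀ p ∈ Mi, ∀ q ∈ Mi,
      (∃! w, IsIReduct (IWord.join p q) w) ∧
      iodot p q ∈ Mi ∧
      psibar (iodot p q) =
        odot (psibar p) (psibar q)) ∧
    -- the subsemigroup `S = F_2°` of `F_1` corresponding to `M°`
    ∃ S : Subsemigroup F1,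
      Set.BijOn (fun u => cls u.word) Mcirc
        (Subtype.val '' (S : Set F1)) ∧
      (∀ u ∈ Mcirc, ∀ v ∈ Mcirc,
        cls (odot u v).word =
          cls u.word * cls v.word) ∧
      IsRegularSubsemigroup S ∧
      IsIdempotentElem (xF * xiF) ∧
      IsIdempotentElem (xiF * xF) ∧
      IsWeaklyGeneratedBy S
        {xF * xiF, xiF * xF} ∧
      -- the isomorphism from `F_2` onto `S` induced by the relabelling
      ∃ Φ : F2 ≃* S,
        ((Φ eF : S) : F1) = xF * xiF ∧
        ((Φ fF : S) : F1) = xiF * xF ∧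
        ∀ u ∈ Mcirc, ∀ s : S,
          ((s : F1) : F11) = cls u.word →
          ((Φ.symm s : F2) : F21) =
            clsI (IWord.word (phibar u)) := by
  refine ⟨bijOn_phibar, bijOn_psibar, invOn_psibar_phibar, uplift_phibar, bijOn_phibar_mountains,
    bijOn_psibar_mountains, fun u hu v hv => odot_mountains hu hv,
    fun p hp q hq => iodot_mountains hp hq, F2circ, bijOn_cls, fun u hu v hv => cls_odot hu hv,
    regular_F2circ, ?_, ?_, weaklyGenerated_F2circ, isoF2, embedF_eF, embedF_fF,
    fun u hu s h => isoF2_symm hu h⟩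
  · change _ * _ = _
    rw [← embedF_eF, ← map_mul, eF_idem]
  · change _ * _ = _
    rw [← embedF_fF, ← map_mul, fF_idem]
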